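/- Work in the real projective plane $\mathbb{P}^2=\mathbb{P}(\mathbb{R}^3)$ with the natural action of $\mathrm{SL}_3(\mathbb{R})$. A subset is *convex* if it meets every projective line in a connected set, and *properly convex* if moreover its closure is contained in an affine chart (the complement of a projective line). An element of $\mathrm{SL}_3(\mathbb{R})$ is *hyperbolic* if it is conjugate to $\mathrm{diag}(\lambda^+,\lambda^0,\lambda^-)$ with $\lambda^+>\lambda^0>\lambda^->0$, *quasi-hyperbolic* if it is conjugate to $\begin{pmatrix}\alpha&1&0\\0&\alpha&0\\0&0&\beta\end{pmatrix}$ with $\alpha,\beta>0$, $\alpha^2\beta=1$, $\alpha,\beta\neq1$, and *parabolic* if it is conjugate to $\begin{pmatrix}1&1&0\\0&1&1\\0&0&1\end{pmatrix}$. A *pointed triangle* is a closed projective triangle with its three vertices removed. Let $\delta_1,\delta_2,\delta_3\in \mathrm{SL}_3(\mathbb{R})$ each be hyperbolic, quasi-hyperbolic or parabolic. Let $(T_0,T_1,T_2,T_3,\gamma_1,\gamma_2,\gamma_3)$ represent a point of $\mathbb{Q}_{\delta_1,\delta_2,\delta_3}$; that is, with indices in $\{1,2,3\}$ read modulo $3$: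 1. $T_0,\dots,T_3$ are pointed triangles, $T_0$ has vertices $p_1,p_2,p_3$, and for $i=1,2,3$ the triangle $T_i$ has vertices $q_i,p_{i+1},p_{i+2}$ and $T_0\cap T_i$ is the edge of $T_0$ opposite to $p_i$; 2. $\overline{T_0}\cup\overline{T_1}\cup\overline{T_2}\cup\overline{T_3}$ is a convex hexagon with exactly six sides; 3. $\gamma_1,\gamma_2,\gamma_3\in\mathrm{SL}_3(\mathbb{R})$ and $\gamma_3\gamma_2\gamma_1=1$; 4. $\gamma_i(T_{i+1})=T_{i+2}$, and on vertices $\gamma_i(p_i)=p_i$, $\gamma_i(q_{i+1})=p_{i+1}$, $\gamma_i(p_{i+2})=q_{i+2}$, for $i=1,2,3$; 5. $\gamma_i$ is conjugate to $\delta_i$ in $\mathrm{SL}_3(\mathbb{R})$ for $i=1,2,3$. Let $G$ be the subgroup of $\mathrm{SL}_3(\mathbb{R})$ generated by $\gamma_1,\gamma_2,\gamma_3$, and let $\Omega=\bigcup_{g\in G}g\,(T_0\cup T_1\cup T_2\cup T_3)$. Then $\Omega$ is a properly convex open set, and $G$ is isomorphic to the free group on two generators. Moreover $\Omega/G$ is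 a properly convex projective pair of pants (without boundary) whose elementary loops have holonomy conjugate to $\delta_1^{\pm1},\delta_2^{\pm1},\delta_3^{\pm1}$. Precisely: $G$ is discrete, preserves $\Omega$ and acts on it freely and properly discontinuously; there is a homeomorphism from $\Omega/G$ onto the sphere $S^2$ minus three distinct points $a_1,a_2,a_3$; and for each $i$, elementary loops going around the end $a_i$ exist, and each of them has holonomy conjugate in $\mathrm{SL}_3(\mathbb{R})$ to $\delta_i$ or to $\delta_i^{-1}$. Here a loop $c$ in $\Omega/G$ is an elementary loop going around the end $a_i$ if there is a closed embedding of the cylinder $S^1\times[0,\infty)$ into $\Omega/G$ that maps $S^1\times\{0\}$ to $c$ and $S^1\times(0,\infty)$ onto an open set, and whose image accumulates at $a_i$; and $g\in G$ is a holonomy of $c$ if some lift of $c$ to $\Omega$ goes from a point $x$ to $gx$. -/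

import Mathlib

open scoped LinearAlgebra.Projectivization Pointwise Topology

noncomputable section

namespace ConvexPants

/-- The vector space `ℝ³`. -/
abbrev V3 : Type := Fin 3 → ℝ

/-- The real projective plane. -/
abbrev P2 : Type := ℙ ℝ V3

/-- The group `SL₃(ℝ)`; Mathlib provides its action on the projective plane. -/
abbrev SL3 : Type := Matrix.SpecialLinearGroup (Fin 3) ℝ

/-- The projective plane carries the quotient topology of `ℝ³ ∖ {0}`. -/
instance instTopologicalSpaceP2 : TopologicalSpace P2 :=
  TopologicalSpace.coinduced (Projectivization.mk' ℝ : {v : V3 // v ≠ 0} → P2) inferInstance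

/-! ### Convexity in the projective plane -/

/-- The projective line with equation `f = 0` (a genuine line when `f ≠ 0`). -/
def projLine (f : Module.Dual ℝ V3) : Set P2 :=
  {x | f x.rep = 0}

/-- A subset of the projective plane is convex if it meets every projective line in a
connected (possibly empty) set. -/
def IsConvexSet (C : Set P2) : Prop :=
  ∀ f : Module.Dual ℝ V3, f ≠ 0 → IsPreconnected (C ∩ projLine f)

/-- A subset is properly convex if it is convex and its closure lies in an affine chart,
that is, in the complement of a projective line. -/
def IsProperlyConvex (C : Set P2) : Prop :=
  IsConvexSet C ∧ ∃ f : Module.Dual ℝ V3, f ≠ 0 ∧ Disjoint (closure C) (projLine f)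

/-! ### Triangles and polygons -/

/-- The image in the projective plane of the closed convex cone spanned by the `w i`. -/
def projCone {n : ℕ} (w : Fin n → V3) : Set P2 :=
  {x | ∃ a : Fin n → ℝ, (∀ i, 0 ≤ a i) ∧
    ∃ h : ∑ i, a i • w i ≠ 0, x = Projectivization.mk ℝ (∑ i, a i • w i) h}

/-- `T` is a pointed triangle with vertices `v 0, v 1, v 2`: one of the (four) closed triangles of
the projective plane with these vertices, with its three vertices removed. -/
def IsPointedTriangle (v : Fin 3 → P2) (T : Set P2) : Prop :=
  ∃ e : Fin 3 → V3, LinearIndependent ℝ e ∧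
    (∀ i, ∃ h : e i ≠ 0, v i = Projectivization.mk ℝ (e i) h) ∧
    T = projCone e \ Set.range v

/-- The edge, opposite to `v i`, of a pointed triangle `T` with vertices `v`: the points of `T`
on the line through the two other vertices. -/
def edge (v : Fin 3 → P2) (T : Set P2) (i : Fin 3) : Set P2 :=
  {x | x ∈ T ∧ x.submodule ≤ (v (i + 1)).submodule ⊔ (v (i + 2)).submodule}

/-- `H` is a (closed) convex polygon of an affine chart `{f = 1}`, with exactly `n` vertices, hence
exactly `n` sides when `3 ≤ n`. -/
def IsConvexPolygon (n : ℕ) (H : Set P2) : Prop :=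
  ∃ (f : Module.Dual ℝ V3) (w : Fin n → V3), (∀ i, f (w i) = 1) ∧
    ConvexIndependent ℝ w ∧ H = projCone w

/-! ### Types of elements of `SL₃(ℝ)` -/

/-- Conjugacy of real `3 × 3` matrices. -/
def IsConjMatrix (A B : Matrix (Fin 3) (Fin 3) ℝ) : Prop :=
  ∃ P : GL (Fin 3) ℝ, A * (P : Matrix (Fin 3) (Fin 3) ℝ) = (P : Matrix (Fin 3) (Fin 3) ℝ) * B

def IsHyperbolic (g : SL3) : Prop :=
  ∃ a b c : ℝ, b < a ∧ c < b ∧ 0 < c ∧ a * b * c = 1 ∧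
    IsConjMatrix (g : Matrix (Fin 3) (Fin 3) ℝ) !![a, 0, 0; 0, b, 0; 0, 0, c]

def IsQuasiHyperbolic (g : SL3) : Prop :=
  ∃ a b : ℝ, 0 < a ∧ 0 < b ∧ a ^ 2 * b = 1 ∧ a ≠ 1 ∧ b ≠ 1 ∧
    IsConjMatrix (g : Matrix (Fin 3) (Fin 3) ℝ) !![a, 1, 0; 0, a, 0; 0, 0, b]

def IsParabolic (g : SL3) : Prop :=
  IsConjMatrix (g : Matrix (Fin 3) (Fin 3) ℝ) !![1, 1, 0; 0, 1, 1; 0, 0, 1]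

/-! ### The combinatorial object -/

/-- The four pointed triangles `T₀, T 0, T 1, T 2` and the three elements `γ 0, γ 1, γ 2`.
The vertices of `T₀` are the `p i`, and `T i` is glued to `T₀` along the edge opposite to `p i`
and has `q i` as third vertex. Indices are read modulo 3. -/
structure IsHexagonGluing (δ : Fin 3 → SL3) (T₀ : Set P2) (T : Fin 3 → Set P2) (γ : Fin 3 → SL3)
    (p q : Fin 3 → P2) : Prop where
  triangle_zero : IsPointedTriangle p T₀
  triangle : ∀ i, IsPointedTriangle (Function.update p i (q i)) (T i)
  inter : ∀ i, T₀ ∩ T i = edge p T₀ i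
  hexagon : IsConvexPolygon 6 (closure T₀ ∪ ⋃ i, closure (T i))
  prod_eq_one : γ 2 * γ 1 * γ 0 = 1
  map_triangle : ∀ i, γ i • T (i + 1) = T (i + 2)
  map_fixed : ∀ i, γ i • p i = p i
  map_outer : ∀ i, γ i • q (i + 1) = p (i + 1)
  map_inner : ∀ i, γ i • p (i + 2) = q (i + 2)
  conj : ∀ i, IsConj (γ i) (δ i)

/-- `(T₀, T, γ)` represents a point of the space `ℚ_{δ₁,δ₂,δ₃}`. -/
def IsQPoint (δ : Fin 3 → SL3) (T₀ : Set P2) (T : Fin 3 → Set P2) (γ : Fin 3 → SL3) : Prop :=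
  ∃ p q : Fin 3 → P2, IsHexagonGluing δ T₀ T γ p q

/-- The group generated by the `γ i`. -/
def holGroup (γ : Fin 3 → SL3) : Subgroup SL3 :=
  Subgroup.closure (Set.range γ)

/-- The union of the translates of the four triangles. -/
def tiledSet (T₀ : Set P2) (T : Fin 3 → Set P2) (γ : Fin 3 → SL3) : Set P2 :=
  ⋃ g ∈ holGroup γ, g • (T₀ ∪ ⋃ i, T i)

/-! ### Properly convex projective surfaces -/

/-- `Ω` is a nonempty properly convex open set, and `G` is a discrete group of projective
transformations that preserves `Ω` and acts on it freely and properly discontinuously, so that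
`Ω → Ω / G` is a universal covering and `Ω / G` is a properly convex projective surface with
developing map the inclusion of `Ω` and holonomy group `G`. -/
structure IsProperlyConvexSurface (G : Subgroup SL3) (Ω : Set P2) : Prop where
  nonempty : Ω.Nonempty
  isOpen : IsOpen Ω
  properlyConvex : IsProperlyConvex Ω
  discrete : DiscreteTopology G
  preserves : ∀ g ∈ G, g • Ω = Ω
  free : ∀ g ∈ G, ∀ x ∈ Ω, g • x = x → g = 1
  properlyDiscontinuous : ∀ K ⊆ Ω, IsCompact K → {g | g ∈ G ∧ (g • K ∩ K).Nonempty}.Finite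

/-- The relation "to be in the same `G`-orbit" on `Ω`. -/
def orbitSetoid (G : Subgroup SL3) (Ω : Set P2) : Setoid Ω where
  r x y := ∃ g ∈ G, g • (x : P2) = y
  iseqv :=
    { refl := fun x => ⟨1, G.one_mem, one_smul _ _⟩
      symm := fun {x y} ⟨g, hg, h⟩ => ⟨g⁻¹, G.inv_mem hg, by rw [← h, inv_smul_smul]⟩
      trans := fun {x y z} ⟨g, hg, h⟩ ⟨k, hk, h'⟩ =>
        ⟨k * g, G.mul_mem hk hg, by rw [mul_smul, h, h']⟩ }

/-- The quotient `Ω / G`, with the quotient topology. -/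
abbrev OrbitSpace (G : Subgroup SL3) (Ω : Set P2) : Type :=
  Quotient (orbitSetoid G Ω)

/-- `g` is a holonomy of the loop `c` of `Ω / G`: some lift of `c` to `Ω` goes from a point `x`
to the point `g • x`. (When `G` acts freely and properly discontinuously, `g` is determined by `c`
up to conjugation in `G`.) -/
def IsHolonomy (G : Subgroup SL3) (Ω : Set P2) (c : Circle → OrbitSpace G Ω) (g : SL3) : Prop :=
  g ∈ G ∧ ∃ l : C(unitInterval, Ω),
    (∀ t, (Quotient.mk (orbitSetoid G Ω) (l t)) = c (Circle.exp (2 * Real.pi * (t : ℝ)))) ∧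
    g • (l 0 : P2) = l 1

/-- `C` is the elementary component of the elementary loop `c` in the surface `S` without boundary:
a closed subset, which is a cylinder `S¹ × [0, ∞)` with the single boundary curve `c`, and whose
open part `S¹ × (0, ∞)` is open in `S`. -/
def IsElementaryComponent {S : Type*} [TopologicalSpace S] (c : Circle → S) (C : Set S) : Prop :=
  ∃ h : Circle × Set.Ici (0 : ℝ) → S, Topology.IsClosedEmbedding h ∧
    IsOpen (h '' {x | 0 < (x.2 : ℝ)}) ∧ (∀ z, h (z, ⟨0, Set.self_mem_Ici⟩) = c z) ∧ Set.range h = C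

/-- The `2`-sphere. -/
abbrev Sphere2 : Type := Metric.sphere (0 : EuclideanSpace ℝ (Fin 3)) 1

/-- `Ω / G` is a properly convex projective pair of pants (without boundary): a properly convex
projective surface homeomorphic, by `φ`, to the sphere minus three points `a 0, a 1, a 2`.
Moreover the elementary loops that go around the end `a i` have holonomy conjugate
to `δ i` or to its inverse. -/
def IsProperlyConvexPants (G : Subgroup SL3) (Ω : Set P2) (δ : Fin 3 → SL3) : Prop :=
  IsProperlyConvexSurface G Ω ∧
  ∃ (a : Fin 3 → Sphere2) (φ : OrbitSpace G Ω ≃ₜ {x : Sphere2 // x ∉ Set.range a}),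
    Function.Injective a ∧
    ∀ i, (∃ (c : Circle → OrbitSpace G Ω) (C : Set (OrbitSpace G Ω)),
        IsElementaryComponent c C ∧ a i ∈ closure ((fun x => (φ x : Sphere2)) '' C)) ∧
      ∀ (c : Circle → OrbitSpace G Ω) (C : Set (OrbitSpace G Ω)),
        IsElementaryComponent c C → a i ∈ closure ((fun x => (φ x : Sphere2)) '' C) →
        (∃ g, IsHolonomy G Ω c g) ∧
        ∀ g, IsHolonomy G Ω c g → IsConj g (δ i) ∨ IsConj g (δ i)⁻¹

end ConvexPants

end

open scoped LinearAlgebra.Projectivization Pointwise Topology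

noncomputable section

namespace ConvexPants

/-! ### Triangles arranged along a tree: determinant inequalities -/

section

/-! Everything is lifted to `ℝ³`, where triangles become cones and "to the left of an oriented edge"
becomes the positivity of a determinant. The translates of the four triangles are indexed by words
of left and right turns, starting from an oriented edge. The heart of the proof is local-to-global:
every triangle reached by such a word lies strictly to the left of the line of the first edge
(`side_walk`). Turns in one direction rotate about a single vertex, where a supporting line shared
by the whole fan of edges keeps the fan within a half-turn (`side_fan`). At the first turn in the
other direction, the rest of the word is confined to a sector between two rays already known to be
on the left, and a Plücker relation concludes (`side_walk_left`).

The supporting line at a vertex is a line through the fixed point `p i` invariant under `γ i`. It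
exists because the eigenvalues of `γ i` are positive, and it leaves both other vertices of `T₀` on
the same side because the hexagon is convex and `γ i` maps its vertices as prescribed
(`exists_support`). The types of the `δ i` enter only through the positivity of eigenvalues.

Consequences for the domain: two tiles meet only along a common edge (`sameTile_or_edge`); a segment
crosses finitely many edges, so the union of the cones is convex (`add_mem_dom_of_walk`); it is open
because the open quadrilateral around each edge is contained in two tiles and these quadrilaterals
cover. Three supporting forms are positive on the domain and have no common zero, whence proper
convexity (`isProperlyConvex_Omega`).

Consequences for the group: a quadrilateral meets only two tiles, of different kinds, so no
nontrivial element moves one of its points inside it (`eq_one_of_mem_star`). This yields freeness of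
the action, discreteness, proper discontinuity and the covering map. The quadrilateral `T₀ ∪ T 0` is
a fundamental domain, and ping-pong with the regions beyond its four sides shows that the group is
free (`freeGen_injective`).

The quotient consists of `T₀` and `T 0` with corresponding edges identified. This is the double of a
pointed triangle, that is, a sphere minus three points (`homeo`). An elementary component
accumulating at an end contains a neighbourhood of the end, hence a small loop around it with
holonomy `(γ i)⁻¹`. That holonomy is conjugate to a power of the holonomy of the component; since `γ
i` is not a proper power in the free group, the exponent is `1` or `-1`
(`holonomy_of_isElementaryComponent`). -/

/-- The determinant of three vectors of `ℝ³`. -/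
def det3 (x y z : V3) : ℝ :=
  x 0 * (y 1 * z 2 - y 2 * z 1) - x 1 * (y 0 * z 2 - y 2 * z 0) + x 2 * (y 0 * z 1 - y 1 * z 0)

theorem det3_smul_left (c : ℝ) (x y z : V3) : det3 (c • x) y z = c * det3 x y z := by
  simp [det3]; ring

theorem det3_smul_mid (c : ℝ) (x y z : V3) : det3 x (c • y) z = c * det3 x y z := by
  simp [det3]; ring

theorem det3_smul_right (c : ℝ) (x y z : V3) : det3 x y (c • z) = c * det3 x y z := by
  simp [det3]; ring

theorem det3_add_right (x y z w : V3) : det3 x y (z + w) = det3 x y z + det3 x y w := by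
  simp [det3]; ring

theorem det3_rotate (x y z : V3) : det3 x y z = det3 y z x := by
  simp [det3]; ring

theorem det3_swap (x y z : V3) : det3 y x z = -det3 x y z := by
  simp [det3]; ring

theorem det3_self_right (x y : V3) : det3 x y y = 0 := by
  simp [det3]; ring

theorem det3_self_left (x y : V3) : det3 x y x = 0 := by
  simp [det3]; ring

/-- A three-term Plücker relation with all signs positive: when `a p q` is positively oriented, a
vector `x` in the sector at `a` between `p` and `q` is to the left of `a b` as soon as `p` and `q`
are. -/
theorem det3_plucker (a b p q x : V3) :
    det3 a p q * det3 a b x = det3 q a x * det3 a b p + det3 a p x * det3 a b q := by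
  simp [det3]; ring

/-- Cramer's rule. -/
theorem det3_cramer (a b c v : V3) :
    det3 a b c • v = det3 b c v • a + det3 c a v • b + det3 a b v • c := by
  funext i
  fin_cases i <;> simp [det3] <;> ring

theorem linear_cramer (f : V3 →ₗ[ℝ] ℝ) (a b c v : V3) :
    det3 a b c * f v = det3 b c v * f a + det3 c a v * f b + det3 a b v * f c := by
  have := congrArg f (det3_cramer a b c v)
  simpa using this

/-- The combinatorics and the geometry of a tiling of a convex set by triangles, arranged along a
trivalent tree. The type `E` is that of the oriented edges; an oriented edge enters the triangle
on its left. The map `rev` reverses the edges and `rot` permutes the three edges that enter the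
same triangle: if `e` goes from `a` to `b` and enters the triangle `abc`, then `rot e` goes from
`c` to `a`. The linear form `supp e` defines a supporting line at the origin of `e`. -/
structure ConvexTiling (E : Type*) where
  rev : E → E
  rot : E → E
  vtx : E → V3
  supp : E → V3 →ₗ[ℝ] ℝ
  rev_rev : ∀ e, rev (rev e) = e
  rot_rot_rot : ∀ e, rot (rot (rot e)) = e
  vtx_rev : ∀ e, ∃ c : ℝ, 0 < c ∧ vtx (rev e) = c • vtx (rot (rot e))
  det_pos : ∀ e, 0 < det3 (vtx e) (vtx (rot (rot e))) (vtx (rot e))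
  supp_vtx : ∀ e, supp e (vtx e) = 0
  supp_pos : ∀ e, 0 < supp e (vtx (rot (rot e)))
  supp_rev_rot : ∀ e, ∃ c : ℝ, 0 < c ∧ supp (rev (rot e)) = c • supp e
  connected : ∀ S : Set E, S.Nonempty → (∀ e ∈ S, rev e ∈ S) → (∀ e ∈ S, rot e ∈ S) →
    ∀ e, e ∈ S

namespace ConvexTiling

variable {E : Type*} (t : ConvexTiling E)

/-- The linear form vanishing on the edge `e` and positive on its left. -/
def side (e : E) (v : V3) : ℝ := det3 (t.vtx e) (t.vtx (t.rot (t.rot e))) v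

/-- Turn left, through the triangle entered by `e`. -/
def left (e : E) : E := t.rev (t.rot e)

/-- Turn right, through the triangle entered by `e`. -/
def right (e : E) : E := t.rev (t.rot (t.rot e))

/-- Follow a sequence of left and right turns. -/
def walk : List Bool → E → E
  | [], e => e
  | true :: w, e => walk w (t.left e)
  | false :: w, e => walk w (t.right e)

theorem walk_append (w w' : List Bool) (e : E) :
    t.walk (w ++ w') e = t.walk w' (t.walk w e) := by
  induction w generalizing e with
  | nil => rfl
  | cons b w ih => cases b <;> simp [walk, ih]

theorem side_add (e : E) (v w : V3) : t.side e (v + w) = t.side e v + t.side e w :=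
  det3_add_right _ _ _ _

theorem side_smul (e : E) (c : ℝ) (v : V3) : t.side e (c • v) = c * t.side e v :=
  det3_smul_right _ _ _ _

theorem vtx_left (e : E) : ∃ c : ℝ, 0 < c ∧ t.vtx (t.left e) = c • t.vtx e := by
  obtain ⟨c, hc, h⟩ := t.vtx_rev (t.rot e)
  exact ⟨c, hc, by rw [left, h, t.rot_rot_rot]⟩

theorem end_rev (e : E) : ∃ c : ℝ, 0 < c ∧ t.vtx (t.rot (t.rot (t.rev e))) = c • t.vtx e := by
  obtain ⟨c, hc, h⟩ := t.vtx_rev (t.rev e)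
  refine ⟨c⁻¹, inv_pos.2 hc, ?_⟩
  rw [t.rev_rev] at h
  rw [h, smul_smul, inv_mul_cancel₀ hc.ne', one_smul]

theorem end_left (e : E) :
    ∃ c : ℝ, 0 < c ∧ t.vtx (t.rot (t.rot (t.left e))) = c • t.vtx (t.rot e) :=
  t.end_rev _

theorem vtx_right (e : E) : ∃ c : ℝ, 0 < c ∧ t.vtx (t.right e) = c • t.vtx (t.rot e) := by
  obtain ⟨c, hc, h⟩ := t.vtx_rev (t.rot (t.rot e))
  exact ⟨c, hc, by rw [right, h, t.rot_rot_rot]⟩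

theorem end_right (e : E) :
    ∃ c : ℝ, 0 < c ∧ t.vtx (t.rot (t.rot (t.right e))) = c • t.vtx (t.rot (t.rot e)) :=
  t.end_rev _

theorem side_rev (e : E) : ∃ c : ℝ, 0 < c ∧ ∀ v, t.side (t.rev e) v = -(c * t.side e v) := by
  obtain ⟨c, hc, h⟩ := t.vtx_rev e
  obtain ⟨d, hd, k⟩ := t.end_rev e
  refine ⟨c * d, mul_pos hc hd, fun v => ?_⟩
  rw [side, side, h, k, det3_smul_left, det3_smul_mid, det3_swap]
  ring

/-- The three edges that enter a triangle share the same exits under different names. In particular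
a right turn from `e` is a left turn from `rot e`, which allows an induction to change its base edge
without lengthening the word. -/
theorem left_rot (e : E) : t.left (t.rot e) = t.right e := rfl

theorem right_rot (e : E) : t.right (t.rot e) = t.rev e := by rw [right, t.rot_rot_rot]

theorem left_rot_rot (e : E) : t.left (t.rot (t.rot e)) = t.rev e := by
  rw [left, t.rot_rot_rot]

theorem right_rot_rot (e : E) : t.right (t.rot (t.rot e)) = t.left e := by
  rw [right, t.rot_rot_rot]; rfl

/-- The mirror image of a tiling. -/
def mirror : ConvexTiling E where
  rev := t.rev
  rot e := t.rot (t.rot e)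
  -- Exchanging left and right reverses orientation. In odd dimension a global minus sign restores
  -- the positivity of the determinants, and the supporting forms change sign accordingly.
  vtx e := -t.vtx (t.rot (t.rot e))
  supp e := -t.supp (t.rev e)
  rev_rev := t.rev_rev
  rot_rot_rot e := by simp only [t.rot_rot_rot]
  vtx_rev e := by
    obtain ⟨c, hc, h⟩ := t.end_rev e
    exact ⟨c, hc, by simp only [t.rot_rot_rot, h, smul_neg]⟩
  det_pos e := by
    have := t.det_pos e
    simp only [t.rot_rot_rot]
    convert this using 1
    simp [det3]; ring
  supp_vtx e := by
    obtain ⟨c, hc, h⟩ := t.vtx_rev e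
    have := t.supp_vtx (t.rev e)
    rw [h] at this
    simpa [hc.ne'] using this
  supp_pos e := by
    have := t.supp_pos (t.rev e)
    obtain ⟨c, hc, h⟩ := t.end_rev e
    rw [h] at this
    simp only [t.rot_rot_rot]
    simpa [hc] using this
  supp_rev_rot e := by
    obtain ⟨c, hc, h⟩ := t.supp_rev_rot (t.rot (t.rot e))
    refine ⟨c⁻¹, inv_pos.2 hc, ?_⟩
    rw [t.rot_rot_rot] at h
    rw [t.rev_rev, h, smul_neg, smul_smul, inv_mul_cancel₀ hc.ne', one_smul]
  connected S hS h₁ h₂ := t.connected S hS h₁ fun e he => by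
    have := h₂ _ (h₂ e he)
    rwa [t.rot_rot_rot] at this

theorem mirror_left (e : E) : t.mirror.left e = t.right e := rfl

theorem mirror_right (e : E) : t.mirror.right e = t.left e := by
  simp [right, left, mirror, t.rot_rot_rot]

theorem mirror_walk (w : List Bool) (e : E) : t.mirror.walk w e = t.walk (w.map not) e := by
  induction w generalizing e with
  | nil => rfl
  | cons b w ih => cases b <;> simp [walk, ih, mirror_left, mirror_right]

theorem mirror_side_vtx (e e' : E) :
    t.mirror.side e (t.mirror.vtx (t.mirror.rot e')) = t.side e (t.vtx (t.rot e')) := by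
  simp only [side, mirror, t.rot_rot_rot]
  simp [det3]; ring

theorem vtx_iterate_left (k : ℕ) (e : E) :
    ∃ c : ℝ, 0 < c ∧ t.vtx (t.left^[k] e) = c • t.vtx e := by
  induction k with
  | zero => exact ⟨1, one_pos, by simp⟩
  | succ k ih =>
    obtain ⟨c, hc, h⟩ := ih
    obtain ⟨d, hd, h'⟩ := t.vtx_left (t.left^[k] e)
    exact ⟨d * c, mul_pos hd hc, by rw [Function.iterate_succ_apply', h', h, smul_smul]⟩

theorem supp_iterate_left (k : ℕ) (e : E) :
    ∃ c : ℝ, 0 < c ∧ t.supp (t.left^[k] e) = c • t.supp e := by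
  induction k with
  | zero => exact ⟨1, one_pos, by simp⟩
  | succ k ih =>
    obtain ⟨c, hc, h⟩ := ih
    obtain ⟨d, hd, h'⟩ := t.supp_rev_rot (t.left^[k] e)
    exact ⟨d * c, mul_pos hd hc, by
      rw [Function.iterate_succ_apply', left, h', h, smul_smul]⟩

theorem supp_end_iterate_left (k : ℕ) (e : E) :
    0 < t.supp e (t.vtx (t.rot (t.rot (t.left^[k] e)))) := by
  obtain ⟨c, hc, h⟩ := t.supp_iterate_left k e
  have := t.supp_pos (t.left^[k] e)
  rw [h] at this
  simpa [hc] using this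

theorem side_apex (e : E) : 0 < t.side e (t.vtx (t.rot e)) := t.det_pos e

/-- Around a vertex, the edges turn by less than a half-turn. -/
theorem side_fan (k : ℕ) (e : E) : 0 < t.side e (t.vtx (t.rot (t.left^[k] e))) := by
  induction k with
  | zero => exact t.side_apex e
  | succ k ih =>
    set f := t.left^[k] e with hf
    rw [Function.iterate_succ_apply', ← hf]
    obtain ⟨c, hc, h⟩ := t.vtx_iterate_left (k + 1) e
    obtain ⟨d, hd, h'⟩ := t.end_left f
    have h₁ := t.side_apex (t.left f)
    rw [Function.iterate_succ_apply', ← hf] at h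
    rw [side, h, h', det3_smul_left, det3_smul_mid] at h₁
    have s₀ := t.supp_pos e
    have s₁ := t.supp_end_iterate_left (k + 1) e
    have s₂ := t.supp_end_iterate_left (k + 2) e
    rw [Function.iterate_succ_apply', ← hf, h'] at s₁
    rw [Function.iterate_succ_apply', Function.iterate_succ_apply', ← hf] at s₂
    obtain ⟨d', hd', h''⟩ := t.end_left (t.left f)
    rw [h''] at s₂
    simp only [map_smul, smul_eq_mul, mul_pos_iff_of_pos_left hd, mul_pos_iff_of_pos_left hd',
      mul_pos_iff_of_pos_left hc] at s₁ s₂ h₁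
    -- The supporting form kills the common origin `a` of the edges. For directions `b`, `c`, `d` it
    -- leaves `det a b d * η c = det a b c * η d + det a c d * η b`, where every factor on the right
    -- is positive.
    have hc0 := linear_cramer (t.supp e) (t.vtx e) (t.vtx (t.rot (t.rot e))) (t.vtx (t.rot f))
      (t.vtx (t.rot (t.left f)))
    rw [t.supp_vtx, mul_zero, zero_add] at hc0
    simp only [side] at ih ⊢
    rw [det3_swap (t.vtx e) (t.vtx (t.rot f))] at hc0
    nlinarith [mul_pos ih s₂, mul_pos h₁ s₀]

theorem walk_replicate_true (k : ℕ) (e : E) :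
    t.walk (List.replicate k true) e = t.left^[k] e := by
  induction k generalizing e with
  | zero => rfl
  | succ k ih => simp [List.replicate_succ, walk, ih]

theorem exists_replicate_true (w : List Bool) :
    ∃ k w', w = List.replicate k true ++ w' ∧ (w' = [] ∨ ∃ w'', w' = false :: w'') := by
  induction w with
  | nil => exact ⟨0, [], rfl, Or.inl rfl⟩
  | cons b w ih =>
    cases b with
    | false => exact ⟨0, false :: w, rfl, Or.inr ⟨w, rfl⟩⟩
    | true =>
      obtain ⟨k, w', rfl, h⟩ := ih
      exact ⟨k + 1, w', by simp [List.replicate_succ], h⟩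

/-- The word is split at its first right turn. Before it, the walk rotates about the origin of `e`,
which `side_fan` controls. After it, the apex lies in the sector between the two sides of the
current triangle at that origin; both sides point to the left of `e`, so `det3_plucker` applies. -/
theorem side_walk_left (w : List Bool) (e : E)
    (ih : ∀ (w' : List Bool) (e : E), w'.length < w.length + 1 →
      0 < t.side e (t.vtx (t.rot (t.walk w' e)))) :
    0 < t.side e (t.vtx (t.rot (t.walk (true :: w) e))) := by
  obtain ⟨k, w', rfl, h⟩ := exists_replicate_true w
  change 0 < t.side e (t.vtx (t.rot (t.walk (List.replicate k true ++ w') (t.left e))))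
  rw [walk_append, walk_replicate_true, ← Function.iterate_succ_apply]
  rcases h with rfl | ⟨w, rfl⟩
  · exact t.side_fan _ _
  set f := t.left^[k + 1] e with hf
  set x := t.vtx (t.rot (t.walk (false :: w) f)) with hx
  have h₁ : 0 < t.side f x := ih _ _ (by simp)
  -- Reading the right turn from `f` as a left turn from `rot f` keeps the length of the word, which
  -- is still shorter than the original because at least one left turn was removed.
  have h₂ : 0 < t.side (t.rot f) x := by
    have : t.walk (false :: w) f = t.walk (true :: w) (t.rot f) := rfl
    rw [hx, this]
    exact ih _ _ (by simp)
  obtain ⟨c, hc, h⟩ := t.vtx_iterate_left (k + 1) e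
  rw [← hf] at h
  have f₁ := t.side_fan k e
  obtain ⟨d, hd, h'⟩ := t.end_left (t.left^[k] e)
  rw [← Function.iterate_succ_apply' t.left, ← hf] at h'
  have f₂ := t.side_fan (k + 1) e
  rw [← hf] at f₂
  have p := t.det_pos f
  rw [side, t.rot_rot_rot] at h₂
  rw [side] at h₁
  rw [h] at h₁ h₂ p
  rw [h'] at h₁ p
  simp only [det3_smul_left, det3_smul_mid, mul_pos_iff_of_pos_left hc,
    mul_pos_iff_of_pos_left hd] at h₁ h₂ p
  have := det3_plucker (t.vtx e) (t.vtx (t.rot (t.rot e))) (t.vtx (t.rot (t.left^[k] e)))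
    (t.vtx (t.rot f)) x
  simp only [side] at f₁ f₂ ⊢
  exact pos_of_mul_pos_right (by rw [this]; positivity) p.le

/-- Every triangle reached by turning left and right lies on the left of the first edge. -/
theorem side_walk (w : List Bool) (e : E) : 0 < t.side e (t.vtx (t.rot (t.walk w e))) := by
  induction hn : w.length using Nat.strong_induction_on generalizing t w e with
  | _ n ih =>
    subst hn
    match w, ih with
    | [], _ => exact t.side_apex e
    | true :: w, ih => exact t.side_walk_left w e fun w' e h => ih _ h t w' e rfl
    -- A word beginning with a right turn begins with a left turn in the mirror image; for this
    -- reason the induction ranges over all tilings as well.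
    | false :: w, ih =>
      have := t.mirror.side_walk_left (w.map not) e fun w' e h =>
        ih _ (by simpa using h) t.mirror w' e rfl
      rw [mirror_side_vtx, mirror_walk] at this
      simpa [Function.comp_def] using this

/-- The edges reached from `e` by turning left and right. -/
def Beyond (e e' : E) : Prop := ∃ w, t.walk w e = e'

theorem Beyond.left {e e' : E} (h : t.Beyond e e') : t.Beyond e (t.left e') := by
  obtain ⟨w, rfl⟩ := h
  exact ⟨w ++ [true], by simp [walk_append, walk]⟩

theorem Beyond.right {e e' : E} (h : t.Beyond e e') : t.Beyond e (t.right e') := by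
  obtain ⟨w, rfl⟩ := h
  exact ⟨w ++ [false], by simp [walk_append, walk]⟩

theorem beyond_refl (e : E) : t.Beyond e e := ⟨[], rfl⟩

theorem Beyond.trans {e e' e'' : E} (h : t.Beyond e e') (h' : t.Beyond e' e'') :
    t.Beyond e e'' := by
  obtain ⟨w, rfl⟩ := h
  obtain ⟨w', rfl⟩ := h'
  exact ⟨w ++ w', by simp [walk_append]⟩

@[elab_as_elim]
theorem Beyond.rec_right {e : E} {P : E → Prop} (h₀ : P e)
    (hl : ∀ e', t.Beyond e e' → P e' → P (t.left e'))
    (hr : ∀ e', t.Beyond e e' → P e' → P (t.right e')) {e' : E} (h : t.Beyond e e') : P e' := by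
  obtain ⟨w, rfl⟩ := h
  induction w using List.reverseRecOn with
  | nil => exact h₀
  | append_singleton w b ih =>
    cases b
    · simpa [walk_append, walk] using hr _ ⟨w, rfl⟩ ih
    · simpa [walk_append, walk] using hl _ ⟨w, rfl⟩ ih

theorem Beyond.cases_tail {e e' : E} (h : t.Beyond e e') :
    e' = e ∨ ∃ f, t.Beyond e f ∧ (e' = t.left f ∨ e' = t.right f) := by
  refine Beyond.rec_right t (Or.inl rfl) ?_ ?_ h
  · exact fun f hf _ => Or.inr ⟨f, hf, Or.inl rfl⟩
  · exact fun f hf _ => Or.inr ⟨f, hf, Or.inr rfl⟩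

theorem side_apex_of_beyond {e e' : E} (h : t.Beyond e e') :
    0 < t.side e (t.vtx (t.rot e')) := by
  obtain ⟨w, rfl⟩ := h
  exact t.side_walk w e

/-- The pointed cone over the pointed triangle entered by `e`. -/
def cone (e : E) : Set V3 :=
  {v | 0 ≤ t.side e v ∧ 0 ≤ t.side (t.rot e) v ∧ 0 ≤ t.side (t.rot (t.rot e)) v ∧
    0 < t.side e v + t.side (t.rot e) v ∧ 0 < t.side (t.rot e) v + t.side (t.rot (t.rot e)) v ∧
    0 < t.side (t.rot (t.rot e)) v + t.side e v}

theorem cone_rot (e : E) : t.cone (t.rot e) = t.cone e := by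
  ext v
  simp only [cone, Set.mem_ofPred_eq, t.rot_rot_rot]
  tauto

theorem add_mem_cone {e : E} {v w : V3} (hv : v ∈ t.cone e) (hw : w ∈ t.cone e) :
    v + w ∈ t.cone e := by
  simp only [cone, Set.mem_ofPred_eq, side_add] at *
  obtain ⟨_, _, _, _, _, _⟩ := hv
  obtain ⟨_, _, _, _, _, _⟩ := hw
  refine ⟨?_, ?_, ?_, ?_, ?_, ?_⟩ <;> linarith

theorem smul_mem_cone {e : E} {c : ℝ} (hc : 0 < c) {v : V3} (hv : v ∈ t.cone e) :
    c • v ∈ t.cone e := by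
  simp only [cone, Set.mem_ofPred_eq, side_smul, ← mul_add] at *
  obtain ⟨_, _, _, _, _, _⟩ := hv
  refine ⟨?_, ?_, ?_, ?_, ?_, ?_⟩ <;> positivity

/-- The union of the cones. -/
def dom : Set V3 := ⋃ e, t.cone e

/-- The three `side` values are, up to the determinant of the triangle, the coordinates of `v` in
its vertices. Signs of a linear form on a cone thus reduce to signs at the vertices. -/
theorem side_cramer (e : E) (f : V3 →ₗ[ℝ] ℝ) (v : V3) :
    det3 (t.vtx e) (t.vtx (t.rot (t.rot e))) (t.vtx (t.rot e)) * f v =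
      t.side (t.rot (t.rot e)) v * f (t.vtx e) +
      t.side (t.rot e) v * f (t.vtx (t.rot (t.rot e))) + t.side e v * f (t.vtx (t.rot e)) := by
  rw [linear_cramer]
  simp only [side, t.rot_rot_rot]

/-- Each turn keeps one endpoint of the edge and replaces the other by the apex, which is strictly
on the left by `side_walk`. So after at least one turn the endpoints cannot both lie on the line of
`e`. -/
theorem side_vtx_of_beyond {e e' : E} (h : t.Beyond e e') :
    0 ≤ t.side e (t.vtx e') ∧ 0 ≤ t.side e (t.vtx (t.rot (t.rot e'))) ∧
      (e' = e ∨ 0 < t.side e (t.vtx e') + t.side e (t.vtx (t.rot (t.rot e')))) := by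
  refine Beyond.rec_right t ?_ ?_ ?_ h
  · simp [side, det3_self_left, det3_self_right]
  · intro f hf ⟨h₁, h₂, h₃⟩
    obtain ⟨c, hc, h⟩ := t.vtx_left f
    obtain ⟨d, hd, h'⟩ := t.end_left f
    have := t.side_apex_of_beyond hf
    rw [h, h', side_smul, side_smul]
    exact ⟨by positivity, by positivity, Or.inr (by positivity)⟩
  · intro f hf ⟨h₁, h₂, h₃⟩
    obtain ⟨c, hc, h⟩ := t.vtx_right f
    obtain ⟨d, hd, h'⟩ := t.end_right f
    have := t.side_apex_of_beyond hf
    rw [h, h', side_smul, side_smul]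
    exact ⟨by positivity, by positivity, Or.inr (by positivity)⟩

/-- The linear form `side e`. -/
def sideₗ (e : E) : V3 →ₗ[ℝ] ℝ where
  toFun := t.side e
  map_add' := t.side_add e
  map_smul' := t.side_smul e

theorem side_nonneg_of_beyond {e e' : E} (h : t.Beyond e e') {v : V3} (hv : v ∈ t.cone e') :
    0 ≤ t.side e v := by
  obtain ⟨h₁, h₂, -⟩ := t.side_vtx_of_beyond h
  have h₃ := t.side_apex_of_beyond h
  obtain ⟨v₁, v₂, v₃, -⟩ := hv
  have := t.side_cramer e' (t.sideₗ e) v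
  refine nonneg_of_mul_nonneg_right (?_ : 0 ≤ _ * t.sideₗ e v) (t.det_pos e')
  rw [this]
  change 0 ≤ _ * t.side e _ + _ * t.side e _ + _ * t.side e _
  positivity

theorem side_pos_of_beyond {e e' : E} (h : t.Beyond e e') (hne : e' ≠ e) {v : V3}
    (hv : v ∈ t.cone e') : 0 < t.side e v := by
  obtain ⟨h₁, h₂, h₃⟩ := t.side_vtx_of_beyond h
  replace h₃ := h₃.resolve_left hne
  have h₄ := t.side_apex_of_beyond h
  obtain ⟨v₁, v₂, v₃, v₄, v₅, v₆⟩ := hv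
  have := t.side_cramer e' (t.sideₗ e) v
  refine pos_of_mul_pos_right (?_ : 0 < _ * t.sideₗ e v) (t.det_pos e').le
  rw [this]
  change 0 < _ * t.side e _ + _ * t.side e _ + _ * t.side e _
  rcases v₁.eq_or_lt with h0 | h0
  · rw [← h0] at v₄ v₆ ⊢
    have v₂' : 0 < t.side (t.rot e') v := by linarith
    have v₃' : 0 < t.side (t.rot (t.rot e')) v := by linarith
    rcases h₁.eq_or_lt with k | k
    · have : 0 < t.side e (t.vtx (t.rot (t.rot e'))) := by linarith
      positivity
    · positivity
  · positivity

/-- Walks do not come back: otherwise the apex of `e` would be strictly to the left of `left e`,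
although it is the end of that edge. -/
theorem beyond_left_ne {e e' : E} (h : t.Beyond (t.left e) e') : e' ≠ e := by
  rintro rfl
  have h₁ : 0 < t.side e' (t.vtx (t.rot e')) := t.side_apex e'
  obtain ⟨w, hw⟩ := h
  obtain ⟨c, hc, h⟩ := t.side_rev (t.rot e')
  have h₂ := t.side_apex_of_beyond ⟨w, hw⟩
  rw [left, h] at h₂
  simp [side, t.rot_rot_rot, det3_self_left] at h₂

theorem beyond_right_ne {e e' : E} (h : t.Beyond (t.right e) e') : e' ≠ e := by
  rintro rfl
  obtain ⟨w, hw⟩ := h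
  obtain ⟨c, hc, h⟩ := t.side_rev (t.rot (t.rot e'))
  have h₂ := t.side_apex_of_beyond ⟨w, hw⟩
  rw [right, h] at h₂
  simp [side, t.rot_rot_rot, det3_self_right] at h₂

theorem side_pos_of_beyond_left {e e' : E} (h : t.Beyond (t.left e) e') {v : V3}
    (hv : v ∈ t.cone e') : 0 < t.side e v :=
  t.side_pos_of_beyond (((t.beyond_refl e).left).trans t h) (t.beyond_left_ne h) hv

theorem side_pos_of_beyond_right {e e' : E} (h : t.Beyond (t.right e) e') {v : V3}
    (hv : v ∈ t.cone e') : 0 < t.side e v :=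
  t.side_pos_of_beyond (((t.beyond_refl e).right).trans t h) (t.beyond_right_ne h) hv

end ConvexTiling

end

/-! ### Adjacency of tiles, and openness and convexity of their union -/

section

namespace ConvexTiling

variable {E : Type*} (t : ConvexTiling E)

/-- Two edges that enter the same triangle. -/
def SameTile (e e' : E) : Prop := e' = e ∨ e' = t.rot e ∨ e' = t.rot (t.rot e)

theorem SameTile.cone_eq {e e' : E} (h : t.SameTile e e') : t.cone e' = t.cone e := by
  rcases h with rfl | rfl | rfl <;> simp only [cone_rot]

theorem SameTile.symm {e e' : E} (h : t.SameTile e e') : t.SameTile e' e := by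
  rcases h with rfl | rfl | rfl <;> simp [SameTile, t.rot_rot_rot]

theorem SameTile.trans {e e' e'' : E} (h : t.SameTile e e') (h' : t.SameTile e' e'') :
    t.SameTile e e'' := by
  rcases h with rfl | rfl | rfl <;> rcases h' with rfl | rfl | rfl <;>
    simp [SameTile, t.rot_rot_rot]

theorem sameTile_refl (e : E) : t.SameTile e e := Or.inl rfl

theorem sameTile_rot (e : E) : t.SameTile e (t.rot e) := Or.inr (Or.inl rfl)

theorem sameTile_rot_rot (e : E) : t.SameTile e (t.rot (t.rot e)) := Or.inr (Or.inr rfl)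

/-- An induction principle: a set of triangles is everything as soon as it is stable under
crossing edges. -/
theorem tile_induction {P : E → Prop} (e₀ : E) (h₀ : P e₀)
    (hP : ∀ e, P e → ∃ f, t.SameTile e f ∧ ∀ e', t.SameTile f e' →
      ∃ f', P f' ∧ t.SameTile f' (t.rev e')) (e : E) :
    ∃ f, P f ∧ t.SameTile f e := by
  refine t.connected {e | ∃ f, P f ∧ t.SameTile f e} ⟨e₀, e₀, h₀, t.sameTile_refl _⟩ ?_ ?_ e
  · rintro e ⟨f, hf, hfe⟩
    obtain ⟨f', hff', h⟩ := hP f hf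
    exact h e (SameTile.trans t (SameTile.symm t hff') hfe)
  · rintro e ⟨f, hf, hfe⟩
    exact ⟨f, hf, SameTile.trans t hfe (t.sameTile_rot e)⟩

/-- The triangles adjacent to a triangle that lies beyond `e`. -/
theorem Beyond.rev_cases {e d e' : E} (hd : t.Beyond e d) (h : t.SameTile d e') :
    (∃ f, t.Beyond e f ∧ t.SameTile f (t.rev e')) ∨ d = e ∧ e' = e := by
  rcases h with rfl | rfl | rfl
  · rcases Beyond.cases_tail t hd with rfl | ⟨f, hf, rfl | rfl⟩
    · exact Or.inr ⟨rfl, rfl⟩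
    · exact Or.inl ⟨f, hf, by rw [ConvexTiling.left, t.rev_rev]; exact t.sameTile_rot f⟩
    · exact Or.inl ⟨f, hf, by rw [ConvexTiling.right, t.rev_rev]; exact t.sameTile_rot_rot f⟩
  · exact Or.inl ⟨_, hd.left, t.sameTile_refl _⟩
  · exact Or.inl ⟨_, hd.right, t.sameTile_refl _⟩

/-- Any triangle is on the other side of some edge of a given triangle. -/
theorem tile_cases (e₀ e : E) :
    t.SameTile e₀ e ∨ ∃ i, t.SameTile e₀ i ∧ ∃ d, t.Beyond (t.rev i) d ∧ t.SameTile d e := by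
  obtain ⟨f, hf | ⟨i, hi, hf⟩, hfe⟩ := t.tile_induction
    (P := fun e => t.SameTile e₀ e ∨ ∃ i, t.SameTile e₀ i ∧ t.Beyond (t.rev i) e) e₀
    (Or.inl (t.sameTile_refl _)) (fun d hd => ⟨d, t.sameTile_refl _, fun e' he' => by
      rcases hd with hd | ⟨i, hi, hd⟩
      · exact ⟨_, Or.inr ⟨e', SameTile.trans t hd he', t.beyond_refl _⟩, t.sameTile_refl _⟩
      · rcases Beyond.rev_cases t hd he' with ⟨f, hf, h⟩ | ⟨rfl, rfl⟩
        · exact ⟨f, Or.inr ⟨i, hi, hf⟩, h⟩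
        · rw [t.rev_rev]
          exact ⟨i, Or.inl hi, t.sameTile_refl _⟩⟩) e
  · exact Or.inl (SameTile.trans t hf hfe)
  · exact Or.inr ⟨i, hi, f, hf, hfe⟩

theorem side_rev_nonneg {e : E} {v : V3} : 0 ≤ t.side (t.rev e) v ↔ t.side e v ≤ 0 := by
  obtain ⟨c, hc, h⟩ := t.side_rev e
  rw [h, neg_nonneg]
  constructor
  · intro h; by_contra hh; push Not at hh; have := mul_pos hc hh; linarith
  · intro h; exact mul_nonpos_of_nonneg_of_nonpos hc.le h

theorem side_rev_pos {e : E} {v : V3} : 0 < t.side (t.rev e) v ↔ t.side e v < 0 := by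
  obtain ⟨c, hc, h⟩ := t.side_rev e
  rw [h, neg_pos]
  exact ⟨fun h => by by_contra hh; push Not at hh; have := mul_nonneg hc.le hh; linarith,
    fun h => mul_neg_of_pos_of_neg hc h⟩

theorem SameTile.side_nonneg {e e' : E} (h : t.SameTile e e') {v : V3} (hv : v ∈ t.cone e) :
    0 ≤ t.side e' v := by
  rw [← SameTile.cone_eq t h] at hv
  exact hv.1

/-- Two distinct triangles can only meet along a common edge. -/
theorem sameTile_or_edge {e e' : E} {v : V3} (hv : v ∈ t.cone e) (hv' : v ∈ t.cone e') :
    t.SameTile e e' ∨ ∃ i, t.SameTile e i ∧ t.SameTile (t.rev i) e' ∧ t.side i v = 0 := by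
  rcases t.tile_cases e e' with h | ⟨i, hi, d, hd, hde⟩
  · exact Or.inl h
  · refine Or.inr ⟨i, hi, ?_⟩
    have h₁ := SameTile.side_nonneg t hi hv
    rw [SameTile.cone_eq t hde] at hv'
    rcases eq_or_ne d (t.rev i) with rfl | hne
    · have h₂ := t.side_nonneg_of_beyond hd hv'
      rw [side_rev_nonneg] at h₂
      exact ⟨hde, le_antisymm h₂ h₁⟩
    · have h₂ := t.side_pos_of_beyond hd hne hv'
      rw [side_rev_pos] at h₂
      exact absurd h₁ (not_le.2 h₂)

/-- The open quadrilateral cone around the edge `e`. -/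
def star (e : E) : Set V3 :=
  {v | 0 < t.side (t.rot e) v ∧ 0 < t.side (t.rot (t.rot e)) v ∧
    0 < t.side (t.rot (t.rev e)) v ∧ 0 < t.side (t.rot (t.rot (t.rev e))) v}

theorem continuous_side (e : E) : Continuous (t.side e) :=
  (t.sideₗ e).continuous_of_finiteDimensional

theorem isOpen_star (e : E) : IsOpen (t.star e) :=
  (isOpen_lt continuous_const (t.continuous_side _)).inter
    ((isOpen_lt continuous_const (t.continuous_side _)).inter
      ((isOpen_lt continuous_const (t.continuous_side _)).inter
        (isOpen_lt continuous_const (t.continuous_side _))))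

theorem star_subset (e : E) : t.star e ⊆ t.cone e ∪ t.cone (t.rev e) := by
  rintro v ⟨h₁, h₂, h₃, h₄⟩
  rcases le_total 0 (t.side e v) with h | h
  · exact Or.inl ⟨h, h₁.le, h₂.le, by linarith, by linarith, by linarith⟩
  · rw [← side_rev_nonneg] at h
    exact Or.inr ⟨h, h₃.le, h₄.le, by linarith, by linarith, by linarith⟩

/-- With its vertices removed, a triangle has no point on two of its sides. The quadrilateral around
the side containing `v`, or around any side when there is none, therefore contains `v`. -/
theorem exists_mem_star {e : E} {v : V3} (hv : v ∈ t.cone e) :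
    ∃ i, t.SameTile e i ∧ v ∈ t.star i := by
  have key : ∀ i, t.SameTile e i → 0 < t.side (t.rot i) v → 0 < t.side (t.rot (t.rot i)) v →
      ∃ i, t.SameTile e i ∧ v ∈ t.star i := fun i hi h₁ h₂ => by
    rw [← SameTile.cone_eq t hi] at hv
    refine ⟨i, hi, h₁, h₂, t.side_pos_of_beyond_right (e' := i) ?_ hv,
      t.side_pos_of_beyond_left (e' := i) ?_ hv⟩
    · rw [right_rot, t.rev_rev]; exact t.beyond_refl i
    · rw [left_rot_rot, t.rev_rev]; exact t.beyond_refl i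
  obtain ⟨h₁, h₂, h₃, h₄, h₅, h₆⟩ := hv
  rcases h₁.eq_or_lt with k | k
  · exact key e (t.sameTile_refl e) (by linarith) (by linarith)
  · rcases h₂.eq_or_lt with k' | k'
    · exact key (t.rot e) (t.sameTile_rot e) (by linarith) (by rwa [t.rot_rot_rot])
    · exact key (t.rot (t.rot e)) (t.sameTile_rot_rot e) (by rwa [t.rot_rot_rot])
        (by rwa [t.rot_rot_rot])

/-- The quadrilateral around `e` only meets two triangles. -/
theorem sameTile_of_mem_star {e e' : E} {v : V3} (hv : v ∈ t.star e) (hv' : v ∈ t.cone e') :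
    t.SameTile e e' ∨ t.SameTile (t.rev e) e' := by
  have key : ∀ e, v ∈ t.star e → v ∈ t.cone e → t.SameTile e e' ∨ t.SameTile (t.rev e) e' := by
    intro e hv hc
    rcases t.sameTile_or_edge hc hv' with h | ⟨i, rfl | rfl | rfl, h, h0⟩
    · exact Or.inl h
    · exact Or.inr h
    · exact absurd h0 hv.1.ne'
    · exact absurd h0 hv.2.1.ne'
  rcases t.star_subset e hv with h | h
  · exact key e hv h
  · have hv₂ : v ∈ t.star (t.rev e) := by
      obtain ⟨h₁, h₂, h₃, h₄⟩ := hv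
      exact ⟨h₃, h₄, by rwa [t.rev_rev], by rwa [t.rev_rev]⟩
    have := key _ hv₂ h
    rw [t.rev_rev] at this
    exact this.symm

theorem isOpen_dom : IsOpen t.dom := by
  rw [isOpen_iff_mem_nhds]
  intro v hv
  obtain ⟨e, he⟩ := Set.mem_iUnion.1 hv
  obtain ⟨i, -, hi⟩ := t.exists_mem_star he
  refine Filter.mem_of_superset ((t.isOpen_star i).mem_nhds hi) ((t.star_subset i).trans ?_)
  exact Set.union_subset (Set.subset_iUnion _ _) (Set.subset_iUnion _ _)

theorem smul_mem_dom {c : ℝ} (hc : 0 < c) {v : V3} (hv : v ∈ t.dom) : c • v ∈ t.dom := by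
  obtain ⟨e, he⟩ := Set.mem_iUnion.1 hv
  exact Set.mem_iUnion.2 ⟨e, t.smul_mem_cone hc he⟩

theorem zero_notMem_cone (e : E) : (0 : V3) ∉ t.cone e := by
  rintro ⟨-, -, -, h, -⟩
  have : ∀ e, t.side e 0 = 0 := fun e => (t.sideₗ e).map_zero
  simp [this] at h

theorem zero_notMem_dom : (0 : V3) ∉ t.dom := by
  intro h
  obtain ⟨e, he⟩ := Set.mem_iUnion.1 h
  exact t.zero_notMem_cone e he

/-- The combination of `v` and `w` on the edge `e`. -/
theorem exists_mem_edge {e d : E} (hd : t.Beyond e d) {v w : V3} (hv : v ∈ t.cone (t.rev e))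
    (hw : w ∈ t.cone d) (hvw : t.side (t.rev e) (v + w) < 0) :
    ∃ s : ℝ, 0 < s ∧ s ≤ 1 ∧ v + (1 - s) • w ∈ t.cone (t.rev e) ∧
      v + (1 - s) • w ∈ t.cone e := by
  set f := t.rev e with hf
  have hfe : t.rev f = e := t.rev_rev e
  have w₁ : 0 < t.side (t.rot f) w := t.side_pos_of_beyond_right
    (by rw [right_rot, hfe]; exact hd) hw
  have w₂ : 0 < t.side (t.rot (t.rot f)) w := t.side_pos_of_beyond_left
    (by rw [left_rot_rot, hfe]; exact hd) hw
  obtain ⟨v₀, v₁, v₂, v₃, v₄, v₅⟩ := hv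
  rw [side_add] at hvw
  have w₀ : t.side f w < 0 := by linarith
  -- `v + r • w` reaches the line of the edge exactly for `r = side f v / -side f w`, and `s = 1 -
  -- r` is the part of `w` still to be added.
  refine ⟨1 - t.side f v / -t.side f w, ?_, ?_, ?_⟩
  · rw [sub_pos, div_lt_one (by linarith)]; linarith
  · have : 0 ≤ t.side f v / -t.side f w := div_nonneg v₀ (by linarith)
    linarith
  set r := t.side f v / -t.side f w with hr
  have hr0 : 0 ≤ r := div_nonneg v₀ (by linarith)
  have h₀ : t.side f (v + r • w) = 0 := by
    rw [side_add, side_smul, hr, div_mul_eq_mul_div, mul_div_assoc, div_neg, div_self w₀.ne]; ring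
  have h₁ : 0 < t.side (t.rot f) (v + r • w) := by
    rw [side_add, side_smul]
    rcases hr0.eq_or_lt with h | h
    · have : t.side f v = 0 := by
        rw [eq_comm, hr, div_eq_zero_iff] at h
        exact h.resolve_right (by linarith)
      rw [← h]; linarith
    · positivity
  have h₂ : 0 < t.side (t.rot (t.rot f)) (v + r • w) := by
    rw [side_add, side_smul]
    rcases hr0.eq_or_lt with h | h
    · have : t.side f v = 0 := by
        rw [eq_comm, hr, div_eq_zero_iff] at h
        exact h.resolve_right (by linarith)
      rw [← h]; linarith
    · positivity
  rw [sub_sub_cancel]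
  have hfc : v + r • w ∈ t.cone f :=
    ⟨h₀.ge, h₁.le, h₂.le, by linarith, by linarith, by linarith⟩
  refine ⟨hfc, ?_⟩
  have k₀ : 0 ≤ t.side e (v + r • w) := by
    rw [← hfe, side_rev_nonneg]; exact h₀.le
  have k₁ : 0 < t.side (t.rot e) (v + r • w) := t.side_pos_of_beyond_right
    (by rw [right_rot]; exact t.beyond_refl f) hfc
  have k₂ : 0 < t.side (t.rot (t.rot e)) (v + r • w) := t.side_pos_of_beyond_left
    (by rw [left_rot_rot]; exact t.beyond_refl f) hfc
  exact ⟨k₀, k₁.le, k₂.le, by linarith, by linarith, by linarith⟩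

/-- Induction on the number of edges between the two tiles. If `v + w` leaves the tile of `v`, it
does so through the edge `e`: the portion of `w` that leads to this edge is absorbed into `v`, and
the remaining multiple of `w` is added from the next tile. -/
theorem add_mem_dom_of_walk (l : List Bool) (e : E) {v w : V3} (hv : v ∈ t.cone (t.rev e))
    (hw : w ∈ t.cone (t.walk l e)) : v + w ∈ t.dom := by
  induction l generalizing e v w with
  | nil =>
    by_cases hvw : t.side (t.rev e) (v + w) < 0
    · obtain ⟨s, h₀, h₁, -, h₂⟩ := t.exists_mem_edge (t.beyond_refl e) hv hw hvw
      have := t.add_mem_cone h₂ (t.smul_mem_cone h₀ hw)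
      rw [show v + (1 - s) • w + s • w = v + w by module] at this
      exact Set.mem_iUnion.2 ⟨_, this⟩
    · push Not at hvw
      have w₁ : 0 < t.side (t.rot (t.rev e)) w := t.side_pos_of_beyond_right
        (by rw [right_rot, t.rev_rev]; exact t.beyond_refl e) hw
      have w₂ : 0 < t.side (t.rot (t.rot (t.rev e))) w := t.side_pos_of_beyond_left
        (by rw [left_rot_rot, t.rev_rev]; exact t.beyond_refl e) hw
      obtain ⟨v₀, v₁, v₂, v₃, v₄, v₅⟩ := hv
      refine Set.mem_iUnion.2 ⟨t.rev e, hvw, ?_, ?_, ?_, ?_, ?_⟩ <;> simp only [side_add] at * <;>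
        linarith
  | cons b l ih =>
    have hd : t.Beyond e (t.walk (b :: l) e) := ⟨_, rfl⟩
    by_cases hvw : t.side (t.rev e) (v + w) < 0
    · obtain ⟨s, h₀, h₁, -, h₂⟩ := t.exists_mem_edge hd hv hw hvw
      rw [show v + w = v + (1 - s) • w + s • w by module]
      cases b with
      | true =>
        refine ih (t.left e) ?_ (t.smul_mem_cone h₀ hw)
        rwa [left, t.rev_rev, cone_rot]
      | false =>
        refine ih (t.right e) ?_ (t.smul_mem_cone h₀ hw)
        rwa [right, t.rev_rev, cone_rot, cone_rot]
    · push Not at hvw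
      have w₁ : 0 < t.side (t.rot (t.rev e)) w := t.side_pos_of_beyond_right
        (by rw [right_rot, t.rev_rev]; exact hd) hw
      have w₂ : 0 < t.side (t.rot (t.rot (t.rev e))) w := t.side_pos_of_beyond_left
        (by rw [left_rot_rot, t.rev_rev]; exact hd) hw
      obtain ⟨v₀, v₁, v₂, v₃, v₄, v₅⟩ := hv
      refine Set.mem_iUnion.2 ⟨t.rev e, hvw, ?_, ?_, ?_, ?_, ?_⟩ <;> simp only [side_add] at * <;>
        linarith

theorem add_mem_dom {v w : V3} (hv : v ∈ t.dom) (hw : w ∈ t.dom) : v + w ∈ t.dom := by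
  obtain ⟨e, he⟩ := Set.mem_iUnion.1 hv
  obtain ⟨e', he'⟩ := Set.mem_iUnion.1 hw
  rcases t.tile_cases e e' with h | ⟨i, hi, d, ⟨l, rfl⟩, hde⟩
  · rw [SameTile.cone_eq t h] at he'
    exact Set.mem_iUnion.2 ⟨e, t.add_mem_cone he he'⟩
  · rw [SameTile.cone_eq t hde] at he'
    refine t.add_mem_dom_of_walk l (t.rev i) ?_ he'
    rwa [t.rev_rev, SameTile.cone_eq t hi]

theorem convex_dom : Convex ℝ t.dom := by
  intro v hv w hw a b ha hb hab
  rcases ha.eq_or_lt with rfl | ha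
  · simp only [zero_add] at hab; subst hab; simpa using hw
  rcases hb.eq_or_lt with rfl | hb
  · simp only [add_zero] at hab; subst hab; simpa using hv
  exact t.add_mem_dom (t.smul_mem_dom ha hv) (t.smul_mem_dom hb hw)

/-- The inverse of `left`. -/
def unleft (e : E) : E := t.rot (t.rot (t.rev e))

theorem left_unleft (e : E) : t.left (t.unleft e) = e := by
  rw [unleft, left_rot_rot, t.rev_rev]

/-- The two hypotheses say that `v` is in the open sector at the origin of `e` bounded by two sides
of the triangle. The form kills the origin and is positive at the two other vertices, so the
remaining coordinate, of unknown sign, does not matter. -/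
theorem supp_sector {e : E} {v : V3} (h₁ : 0 < t.side e v) (h₂ : 0 < t.side (t.rot e) v) :
    0 < t.supp e v := by
  have h := t.side_cramer e (t.supp e) v
  rw [t.supp_vtx, mul_zero, zero_add] at h
  have s₁ := t.supp_pos e
  have s₂ := t.supp_end_iterate_left 1 e
  obtain ⟨c, hc, h'⟩ := t.end_left e
  simp only [Function.iterate_one, h', map_smul, smul_eq_mul, mul_pos_iff_of_pos_left hc] at s₂
  refine pos_of_mul_pos_right (?_ : 0 < _ * t.supp e v) (t.det_pos e).le
  rw [h]
  positivity

theorem supp_pos_of_mem_cone {e : E} {v : V3} (hv : v ∈ t.cone e) : 0 < t.supp e v := by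
  obtain ⟨v₀, v₁, v₂, v₃, v₄, v₅⟩ := hv
  have h := t.side_cramer e (t.supp e) v
  rw [t.supp_vtx, mul_zero, zero_add] at h
  have s₁ := t.supp_pos e
  have s₂ := t.supp_end_iterate_left 1 e
  obtain ⟨c, hc, h'⟩ := t.end_left e
  simp only [Function.iterate_one, h', map_smul, smul_eq_mul, mul_pos_iff_of_pos_left hc] at s₂
  refine pos_of_mul_pos_right (?_ : 0 < _ * t.supp e v) (t.det_pos e).le
  rw [h]
  rcases v₀.eq_or_lt with k | k
  · rw [← k] at v₃ ⊢
    have : 0 < t.side (t.rot e) v := by linarith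
    positivity
  · positivity

/-- The linear form `supp e` is positive on the whole tiled domain. -/
theorem supp_pos_of_mem_dom (e₀ : E) {v : V3} (hv : v ∈ t.dom) : 0 < t.supp e₀ v := by
  obtain ⟨e, he⟩ := Set.mem_iUnion.1 hv
  -- Invariant: a tile either belongs to the fan around the origin of `e₀`, or lies beyond the side
  -- opposite to this vertex in some tile of the fan, and then it is contained in the sector of that
  -- tile.
  obtain ⟨f, ⟨i, ⟨c, hc, hi⟩, hf⟩, hfe⟩ := t.tile_induction
    (P := fun e => ∃ i, (∃ c : ℝ, 0 < c ∧ t.supp e₀ = c • t.supp i) ∧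
      (e = i ∨ t.Beyond (t.right i) e)) e₀
    ⟨e₀, ⟨1, one_pos, by simp⟩, Or.inl rfl⟩ (fun d ⟨i, ⟨c, hc, hi⟩, hd⟩ => by
      refine ⟨d, t.sameTile_refl _, fun e' he' => ?_⟩
      rcases hd with rfl | hd
      · rcases he' with rfl | rfl | rfl
        · refine ⟨t.unleft e', ⟨t.unleft e', ?_, Or.inl rfl⟩, ?_⟩
          · obtain ⟨k, hk, h⟩ := t.supp_rev_rot (t.unleft e')
            have h2 := t.left_unleft e'
            rw [left] at h2
            rw [h2] at h
            exact ⟨c * k, by positivity, by rw [hi, h, smul_smul]⟩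
          · exact SameTile.symm t (t.sameTile_rot_rot _)
        · refine ⟨t.left d, ⟨t.left d, ?_, Or.inl rfl⟩, t.sameTile_refl _⟩
          obtain ⟨k, hk, h⟩ := t.supp_rev_rot d
          refine ⟨c * k⁻¹, by positivity, ?_⟩
          rw [hi, left, h, smul_smul, mul_assoc, inv_mul_cancel₀ hk.ne', mul_one]
        · exact ⟨t.right d, ⟨d, ⟨c, hc, hi⟩, Or.inr (t.beyond_refl _)⟩, t.sameTile_refl _⟩
      · rcases Beyond.rev_cases t hd he' with ⟨f, hf, h⟩ | ⟨rfl, rfl⟩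
        · exact ⟨f, ⟨i, ⟨c, hc, hi⟩, Or.inr hf⟩, h⟩
        · refine ⟨i, ⟨i, ⟨c, hc, hi⟩, Or.inl rfl⟩, ?_⟩
          rw [right, t.rev_rev]
          exact t.sameTile_rot_rot i) e
  rw [SameTile.cone_eq t hfe] at he
  rw [hi, LinearMap.smul_apply, smul_eq_mul]
  refine mul_pos hc ?_
  rcases hf with rfl | hf
  · exact t.supp_pos_of_mem_cone he
  · exact t.supp_sector (t.side_pos_of_beyond_right hf he)
      (t.side_pos_of_beyond_left (by rw [left_rot]; exact hf) he)

end ConvexTiling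

end

/-! ### Points of the projective plane -/

/-- The point of the projective plane defined by a nonzero vector. -/
def toP (v : V3) : P2 :=
  if h : v ≠ 0 then Projectivization.mk ℝ v h
  -- The value at the zero vector is arbitrary; totality makes `toP_smul` valid for every vector.
  else Projectivization.mk ℝ (fun _ => 1) (fun h => one_ne_zero (congrFun h 0))

theorem toP_of_ne {v : V3} (h : v ≠ 0) : toP v = Projectivization.mk ℝ v h := dif_pos h

theorem toP_rep (x : P2) : toP x.rep = x := by
  rw [toP_of_ne x.rep_nonzero, Projectivization.mk_rep]

theorem toP_eq_iff {v w : V3} (hv : v ≠ 0) (hw : w ≠ 0) :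
    toP v = toP w ↔ ∃ c : ℝ, c ≠ 0 ∧ v = c • w := by
  rw [toP_of_ne hv, toP_of_ne hw, Projectivization.mk_eq_mk_iff']
  constructor
  · rintro ⟨c, rfl⟩
    exact ⟨c, by rintro rfl; simp at hv, rfl⟩
  · rintro ⟨c, -, rfl⟩
    exact ⟨c, rfl⟩

theorem toP_smul {c : ℝ} (hc : c ≠ 0) (v : V3) : toP (c • v) = toP v := by
  by_cases hv : v = 0
  · simp [hv]
  · exact (toP_eq_iff (smul_ne_zero hc hv) hv).2 ⟨c, hc, rfl⟩

theorem smul_toP (g : SL3) {v : V3} (hv : v ≠ 0) : g • toP v = toP (g • v) := by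
  rw [toP_of_ne hv, toP_of_ne ((smul_ne_zero_iff_ne g).2 hv), Projectivization.smul_mk]

/-- Reduces openness in the projective plane to openness of the corresponding cone of vectors. -/
theorem isOpen_P2_iff {A : Set P2} : IsOpen A ↔ IsOpen {v : V3 | v ≠ 0 ∧ toP v ∈ A} := by
  have h0 : IsOpen {v : V3 | v ≠ 0} := isOpen_compl_singleton
  rw [isOpen_coinduced, h0.isOpenEmbedding_subtypeVal.isOpen_iff_image_isOpen]
  have : (Subtype.val '' ((Projectivization.mk' ℝ : {v : V3 // v ≠ 0} → P2) ⁻¹' A)) =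
      {v : V3 | v ≠ 0 ∧ toP v ∈ A} := by
    ext v
    constructor
    · rintro ⟨⟨v, hv⟩, hA, rfl⟩
      exact ⟨hv, by rw [toP_of_ne hv]; exact hA⟩
    · rintro ⟨hv, hA⟩
      exact ⟨⟨v, hv⟩, by rw [toP_of_ne hv] at hA; exact hA, rfl⟩
  exact iff_of_eq (congrArg _ this)

theorem continuousAt_toP {v : V3} (hv : v ≠ 0) : ContinuousAt toP v := by
  have h0 : IsOpen {v : V3 | v ≠ 0} := isOpen_compl_singleton
  refine continuousAt_def.2 fun A hA => ?_
  obtain ⟨U, hU, hUo, hvU⟩ := mem_nhds_iff.1 hA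
  refine Filter.mem_of_superset ((isOpen_P2_iff.1 hUo).mem_nhds ⟨hv, hvU⟩) ?_
  exact fun w hw => hU hw.2

theorem continuousOn_toP : ContinuousOn toP {v | v ≠ 0} :=
  fun _ hv => (continuousAt_toP hv).continuousWithinAt

theorem isClosed_P2 {A : Set P2} {B : Set V3} (hB : IsClosed B)
    (h : ∀ v, v ≠ 0 → (toP v ∈ A ↔ v ∈ B)) : IsClosed A := by
  rw [← isOpen_compl_iff, isOpen_P2_iff]
  have h0 : IsOpen {v : V3 | v ≠ 0} := isOpen_compl_singleton
  convert! h0.inter hB.isOpen_compl using 1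
  ext v
  constructor
  · exact fun ⟨hv, hA⟩ => ⟨hv, fun hb => hA ((h v hv).2 hb)⟩
  · exact fun ⟨hv, hA⟩ => ⟨hv, fun hb => hA ((h v hv).1 hb)⟩

theorem mem_projLine_toP {f : Module.Dual ℝ V3} {v : V3} (hv : v ≠ 0) :
    toP v ∈ projLine f ↔ f v = 0 := by
  obtain ⟨c, hc, h⟩ := (toP_eq_iff (toP v).rep_nonzero hv).1 (toP_rep (toP v))
  change f (toP v).rep = 0 ↔ _
  rw [h]
  simp [hc]

theorem mem_projCone {n : ℕ} {w : Fin n → V3} {x : P2} :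
    x ∈ projCone w ↔ ∃ a : Fin n → ℝ, (∀ i, 0 ≤ a i) ∧ ∑ i, a i • w i ≠ 0 ∧
      x = toP (∑ i, a i • w i) := by
  constructor
  · rintro ⟨a, ha, h, rfl⟩
    exact ⟨a, ha, h, (toP_of_ne h).symm⟩
  · rintro ⟨a, ha, h, rfl⟩
    exact ⟨a, ha, h, toP_of_ne h⟩

theorem projCone_smul_subset {n : ℕ} (w : Fin n → V3) {c : Fin n → ℝ} (hc : ∀ i, 0 < c i) :
    projCone (fun i => c i • w i) ⊆ projCone w := by
  intro x hx
  rw [mem_projCone] at hx ⊢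
  obtain ⟨a, ha, h, rfl⟩ := hx
  simp only [smul_smul] at h ⊢
  exact ⟨fun i => a i * c i, fun i => mul_nonneg (ha i) (hc i).le, h, rfl⟩

theorem projCone_smul {n : ℕ} (w : Fin n → V3) {c : Fin n → ℝ} (hc : ∀ i, 0 < c i) :
    projCone (fun i => c i • w i) = projCone w := by
  refine (projCone_smul_subset w hc).antisymm ?_
  have := projCone_smul_subset (fun i => c i • w i) (c := fun i => (c i)⁻¹)
    fun i => inv_pos.2 (hc i)
  simpa only [smul_smul, inv_mul_cancel₀ (hc _).ne', one_smul] using this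

theorem projCone_neg_subset {n : ℕ} (w : Fin n → V3) : projCone (fun i => -w i) ⊆ projCone w := by
  intro x hx
  rw [mem_projCone] at hx ⊢
  obtain ⟨a, ha, h, rfl⟩ := hx
  simp only [smul_neg, Finset.sum_neg_distrib] at h ⊢
  refine ⟨a, ha, by simpa using h, ?_⟩
  rw [← neg_one_smul ℝ, toP_smul (by norm_num)]

theorem projCone_neg {n : ℕ} (w : Fin n → V3) : projCone (fun i => -w i) = projCone w := by
  refine (projCone_neg_subset w).antisymm ?_
  simpa using projCone_neg_subset fun i => -w i

theorem projCone_smul' {n : ℕ} (w : Fin n → V3) {c : Fin n → ℝ}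
    (hc : (∀ i, 0 < c i) ∨ ∀ i, c i < 0) : projCone (fun i => c i • w i) = projCone w := by
  rcases hc with hc | hc
  · exact projCone_smul w hc
  · rw [← projCone_neg]
    have := projCone_smul w (c := fun i => -c i) fun i => neg_pos.2 (hc i)
    simpa only [neg_smul] using this

/-! ### Triangles -/

theorem det3_ne_zero_iff {e : Fin 3 → V3} :
    det3 (e 0) (e 1) (e 2) ≠ 0 ↔ LinearIndependent ℝ e := by
  have : det3 (e 0) (e 1) (e 2) = (Matrix.of e).det := by
    simp [det3, Matrix.det_fin_three]; ring
  rw [this, ← isUnit_iff_ne_zero, ← Matrix.isUnit_iff_isUnit_det,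
    ← Matrix.linearIndependent_rows_iff_isUnit]
  rfl

theorem det3_cyclic (e : Fin 3 → V3) (i : Fin 3) :
    det3 (e i) (e (i + 1)) (e (i + 2)) = det3 (e 0) (e 1) (e 2) := by
  fin_cases i
  · rfl
  · exact (det3_rotate _ _ _).symm
  · exact det3_rotate _ _ _

/-- The coordinates in a frame, up to the factor `det3 (e 0) (e 1) (e 2)`. -/
def coord (e : Fin 3 → V3) (i : Fin 3) (v : V3) : ℝ := det3 (e (i + 1)) (e (i + 2)) v

theorem coord_cramer (e : Fin 3 → V3) (v : V3) :
    det3 (e 0) (e 1) (e 2) • v = ∑ i, coord e i v • e i := by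
  rw [det3_cramer (e 0) (e 1) (e 2) v, Fin.sum_univ_three]
  rfl

theorem coord_sum (e : Fin 3 → V3) (a : Fin 3 → ℝ) (i : Fin 3) :
    coord e i (∑ j, a j • e j) = det3 (e 0) (e 1) (e 2) * a i := by
  fin_cases i <;> simp [coord, det3, Fin.sum_univ_three] <;> ring

theorem continuous_coord (e : Fin 3 → V3) (i : Fin 3) : Continuous (coord e i) := by
  unfold coord det3
  fun_prop

theorem coord_smul (e : Fin 3 → V3) (i : Fin 3) (c : ℝ) (v : V3) :
    coord e i (c • v) = c * coord e i v := det3_smul_right _ _ _ _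

theorem exists_sum_eq {e : Fin 3 → V3} (he : LinearIndependent ℝ e) (v : V3) :
    ∃ a : Fin 3 → ℝ, v = ∑ i, a i • e i := by
  have hD := det3_ne_zero_iff.2 he
  refine ⟨fun i => (det3 (e 0) (e 1) (e 2))⁻¹ * coord e i v, ?_⟩
  simp only [mul_smul, ← Finset.smul_sum]
  rw [← coord_cramer, smul_smul, inv_mul_cancel₀ hD, one_smul]

theorem sum_ne_zero {e : Fin 3 → V3} (he : LinearIndependent ℝ e) {a : Fin 3 → ℝ} {i : Fin 3}
    (ha : a i ≠ 0) : ∑ i, a i • e i ≠ 0 := fun h => by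
  have := coord_sum e a i
  rw [h] at this
  have h0 : coord e i 0 = 0 := by simp [coord, det3]
  rw [h0] at this
  exact mul_ne_zero (det3_ne_zero_iff.2 he) ha this.symm

/-- The two alternatives correspond to the two signs of a representative; the sign of the
determinant of the frame only exchanges them. -/
theorem toP_mem_projCone_iff {e : Fin 3 → V3} (he : LinearIndependent ℝ e) {v : V3} (hv : v ≠ 0) :
    toP v ∈ projCone e ↔ (∀ i, 0 ≤ coord e i v) ∨ ∀ i, coord e i v ≤ 0 := by
  have hD := det3_ne_zero_iff.2 he
  set D := det3 (e 0) (e 1) (e 2) with hDdef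
  constructor
  · rw [mem_projCone]
    rintro ⟨a, ha, h, hx⟩
    obtain ⟨c, hc, rfl⟩ := (toP_eq_iff hv h).1 hx
    simp only [coord_smul, coord_sum]
    rcases le_total 0 (c * det3 (e 0) (e 1) (e 2)) with h | h
    · left; intro i; rw [← mul_assoc]; exact mul_nonneg h (ha i)
    · right; intro i; rw [← mul_assoc]; exact mul_nonpos_of_nonpos_of_nonneg h (ha i)
  · rintro (h | h)
    · rw [mem_projCone]
      refine ⟨fun i => coord e i v, h, ?_, ?_⟩
      · rw [← coord_cramer]; exact smul_ne_zero hD hv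
      · rw [← coord_cramer, toP_smul hD]
    · rw [mem_projCone]
      refine ⟨fun i => -coord e i v, fun i => neg_nonneg.2 (h i), ?_, ?_⟩
      · simp only [neg_smul, Finset.sum_neg_distrib]
        rw [← coord_cramer]; exact neg_ne_zero.2 (smul_ne_zero hD hv)
      · simp only [neg_smul, Finset.sum_neg_distrib]
        rw [← coord_cramer, ← neg_smul, toP_smul (neg_ne_zero.2 hD)]

theorem isClosed_projCone {e : Fin 3 → V3} (he : LinearIndependent ℝ e) :
    IsClosed (projCone e) := by
  refine isClosed_P2 (B := {v | ∀ i, 0 ≤ coord e i v} ∪ {v | ∀ i, coord e i v ≤ 0}) ?_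
    fun v hv => toP_mem_projCone_iff he hv
  refine IsClosed.union ?_ ?_
  · simp only [Set.ofPred_forall]
    exact isClosed_iInter fun i => isClosed_le continuous_const (continuous_coord e i)
  · simp only [Set.ofPred_forall]
    exact isClosed_iInter fun i => isClosed_le (continuous_coord e i) continuous_const

theorem toP_sum_eq_vertex {e : Fin 3 → V3} (he : LinearIndependent ℝ e) {a : Fin 3 → ℝ}
    {i j : Fin 3} (hij : i ≠ j) (ha : a i ≠ 0) : toP (∑ k, a k • e k) ≠ toP (e j) := by
  intro h
  obtain ⟨c, hc, h⟩ := (toP_eq_iff (sum_ne_zero he ha) (he.ne_zero j)).1 h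
  have h1 := coord_sum e a i
  have h2 := coord_sum e (Pi.single j c) i
  have h3 : ∑ k, (Pi.single j c : Fin 3 → ℝ) k • e k = c • e j := by
    rw [Finset.sum_eq_single j] <;> simp +contextual
  rw [h3, ← h, h1, Pi.single_eq_of_ne hij] at h2
  simp only [mul_zero, mul_eq_zero] at h2
  exact h2.elim (det3_ne_zero_iff.2 he) ha

theorem closure_pointed {e : Fin 3 → V3} (he : LinearIndependent ℝ e) {v : Fin 3 → P2}
    (hv : ∀ i, v i = toP (e i)) : closure (projCone e \ Set.range v) = projCone e := by
  refine ((isClosed_projCone he).closure_subset_iff.2 Set.sdiff_subset).antisymm fun x hx => ?_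
  by_cases hxv : x ∈ Set.range v
  swap
  · exact subset_closure ⟨hx, hxv⟩
  obtain ⟨i, rfl⟩ := hxv
  rw [hv i]
  have lim : Filter.Tendsto (fun s : ℝ => toP (e i + s • (e (i + 1) + e (i + 2))))
      (𝓝[>] 0) (𝓝 (toP (e i))) := by
    have h1 : Filter.Tendsto (fun s : ℝ => e i + s • (e (i + 1) + e (i + 2))) (𝓝[>] 0)
        (𝓝 (e i)) := by
      have : Continuous fun s : ℝ => e i + s • (e (i + 1) + e (i + 2)) := by fun_prop
      have h := this.tendsto 0
      simp only [zero_smul, add_zero] at h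
      exact h.mono_left nhdsWithin_le_nhds
    exact (continuousAt_toP (he.ne_zero i)).tendsto.comp h1
  refine mem_closure_of_tendsto lim ?_
  filter_upwards [self_mem_nhdsWithin] with s hs
  have hs : 0 < s := hs
  have hsum : e i + s • (e (i + 1) + e (i + 2)) =
      ∑ k, (fun k => if k = i then 1 else s : Fin 3 → ℝ) k • e k := by
    fin_cases i <;> simp [Fin.sum_univ_three] <;> module
  have hne : ∀ k, (fun k => if k = i then 1 else s : Fin 3 → ℝ) k ≠ 0 := fun k => by
    change (if k = i then 1 else s) ≠ 0
    split_ifs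
    · exact one_ne_zero
    · exact hs.ne'
  rw [hsum]
  refine ⟨mem_projCone.2 ⟨_, fun k => ?_, sum_ne_zero he (hne i), rfl⟩, ?_⟩
  · split_ifs
    · exact zero_le_one
    · exact hs.le
  · rintro ⟨j, hj⟩
    have : j + 1 ≠ j := by fin_cases j <;> decide
    exact toP_sum_eq_vertex he this (hne (j + 1)) (by rw [← hj, hv])

/-! ### Convex position -/

/-- A point `x` of `s` is extreme in the hull of `s`, so the hull stays convex when `x` is removed.
If `X` missed `x`, this smaller convex set would contain `X`, hence the whole hull. This serves to
recognise the vertices of the hexagon among six given points. -/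
theorem notMem_convexHull_of_eq {F : Type*} [AddCommGroup F] [Module ℝ F] {s X : Set F}
    (hs : ConvexIndependent ℝ ((↑) : s → F)) (h : convexHull ℝ X = convexHull ℝ s) : s ⊆ X := by
  intro x hx
  by_contra hxX
  have hx' := convexIndependent_set_iff_notMem_convexHull_sdiff.1 hs x hx
  rcases (s \ {x}).eq_empty_or_nonempty with h0 | h0
  · have : s = {x} := by
      ext y
      constructor
      · intro hy
        by_contra hne
        exact (Set.eq_empty_iff_forall_notMem.1 h0) y ⟨hy, hne⟩
      · rintro rfl; exact hx
    rw [this, convexHull_singleton] at h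
    have hX : X ⊆ {x} := h ▸ subset_convexHull ℝ X
    have hne : X.Nonempty := by
      rw [← convexHull_nonempty_iff (𝕜 := ℝ), h]; exact Set.singleton_nonempty x
    obtain ⟨y, hy⟩ := hne
    have := hX hy
    rw [Set.mem_singleton_iff] at this
    exact hxX (this ▸ hy)
  have hconv : Convex ℝ (convexHull ℝ s \ {x}) := by
    have hins : convexHull ℝ s = convexJoin ℝ {x} (convexHull ℝ (s \ {x})) := by
      rw [← convexHull_insert h0, Set.insert_sdiff_singleton, Set.insert_eq_of_mem hx]
    rintro y ⟨hy, hyx⟩ z ⟨hz, hzx⟩ a b ha hb hab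
    refine ⟨convex_convexHull ℝ s hy hz ha hb hab, fun hxx => hx' ?_⟩
    rw [hins] at hy hz
    simp only [convexJoin_singleton_left, Set.mem_iUnion] at hy hz
    obtain ⟨y', hy', α, α', hα, hα', hαα, rfl⟩ := hy
    obtain ⟨z', hz', β, β', hβ, hβ', hββ, rfl⟩ := hz
    have hα0 : 0 < α' := hα'.lt_of_ne fun h => hyx (by
      subst h; have : α = 1 := by linarith
      simp [this])
    have hβ0 : 0 < β' := hβ'.lt_of_ne fun h => hzx (by
      subst h; have : β = 1 := by linarith
      simp [this])
    have hc : 0 < a * α' + b * β' := by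
      rcases ha.eq_or_lt with h | h
      · have : b = 1 := by linarith
        subst this; rw [← h]; linarith
      · positivity
    have hxx : a • (α • x + α' • y') + b • (β • x + β' • z') = x := hxx
    -- The two points lie on segments from `x` to points `y'`, `z'` of the hull of the others.
    -- Solving for `x`, with total weight `a * α' + b * β' > 0` on `y'` and `z'`, would put `x` in
    -- that hull.
    have : x = (a * α' / (a * α' + b * β')) • y' + (b * β' / (a * α' + b * β')) • z' := by
      have h1 : (a * α' + b * β') • x = (a * α') • y' + (b * β') • z' := by
        have e1 : α = 1 - α' := by linarith
        have e2 : β = 1 - β' := by linarith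
        have e3 : a = 1 - b := by linarith
        subst e1 e2
        have h2 : a • ((1 - α') • x + α' • y') + b • ((1 - β') • x + β' • z') =
          (a + b) • x - (a * α' + b * β') • x + (a * α') • y' + (b * β') • z' := by module
        rw [h2, hab, one_smul] at hxx
        have h3 : x - (a * α' + b * β') • x + (a * α') • y' + (b * β') • z' =
          x + ((a * α') • y' + (b * β') • z' - (a * α' + b * β') • x) := by abel
        rw [h3, add_eq_left, sub_eq_zero] at hxx
        exact hxx.symm
      rw [div_eq_inv_mul, div_eq_inv_mul, mul_smul _ (a * α'), mul_smul _ (b * β'), ← smul_add,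
        ← h1, smul_smul, inv_mul_cancel₀ hc.ne', one_smul]
    have hm := convex_convexHull ℝ (s \ {x}) hy' hz'
      (show 0 ≤ a * α' / (a * α' + b * β') by positivity)
      (show 0 ≤ b * β' / (a * α' + b * β') by positivity) (by rw [← add_div, div_self hc.ne'])
    rwa [← this] at hm
  have hXs : X ⊆ convexHull ℝ s \ {x} := fun y hy =>
    ⟨h ▸ subset_convexHull ℝ X hy, fun hyx => hxX (by rw [← hyx]; exact hy)⟩
  have := convexHull_min hXs hconv
  rw [h] at this
  exact (this (subset_convexHull ℝ s hx)).2 rfl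

theorem mem_convexHull_of_toP_mem {n : ℕ} {w : Fin n → V3} {f : Module.Dual ℝ V3}
    (hw : ∀ i, f (w i) = 1) {v : V3} (hv : f v = 1) (h : toP v ∈ projCone w) :
    v ∈ convexHull ℝ (Set.range w) := by
  obtain ⟨a, ha, h0, hx⟩ := mem_projCone.1 h
  obtain ⟨c, hc, hvc⟩ := (toP_eq_iff (by rintro rfl; simp at hv) h0).1 hx
  have hsum : c * ∑ i, a i = 1 := by
    have := congrArg f hvc
    simpa [hv, hw] using this.symm
  have hpos : 0 ≤ ∑ i, a i := Finset.sum_nonneg fun i _ => ha i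
  have hc0 : 0 < c := by
    by_contra hcn
    push Not at hcn
    have := mul_nonpos_of_nonpos_of_nonneg hcn hpos
    linarith
  rw [hvc, Finset.smul_sum]
  simp only [smul_smul]
  refine (convex_convexHull ℝ _).sum_mem (fun i _ => mul_nonneg hc0.le (ha i)) ?_
    fun i _ => subset_convexHull ℝ _ ⟨i, rfl⟩
  rw [← Finset.mul_sum, hsum]

/-- The form `f` has no zero on nonzero nonnegative combinations of the `w i`, hence none on those
of `e`. Values of opposite signs at two vectors of the frame would produce a zero between them; so
the signs agree, and rescaling to `f = 1` does not change the triangle. -/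
theorem normalize_frame {n : ℕ} {w : Fin n → V3} {f : Module.Dual ℝ V3} (hw : ∀ i, f (w i) = 1)
    {e : Fin 3 → V3} (he : LinearIndependent ℝ e) (hsub : projCone e ⊆ projCone w) :
    ∃ e' : Fin 3 → V3, LinearIndependent ℝ e' ∧ (∀ i, f (e' i) = 1) ∧
      (∀ i, toP (e' i) = toP (e i)) ∧ projCone e' = projCone e := by
  have key : ∀ a : Fin 3 → ℝ, (∀ i, 0 ≤ a i) → ∑ i, a i • e i ≠ 0 → f (∑ i, a i • e i) ≠ 0 := by
    intro a ha h0 hf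
    obtain ⟨b, hb, h1, hx⟩ := mem_projCone.1 (hsub (mem_projCone.2 ⟨a, ha, h0, rfl⟩))
    obtain ⟨c, hc, hvc⟩ := (toP_eq_iff h0 h1).1 hx
    rw [hvc] at hf
    have hb0 : ∑ i, b i = 0 := by simpa [hw, hc] using hf
    have : ∀ i, b i = 0 := fun i =>
      (Finset.sum_eq_zero_iff_of_nonneg fun i _ => hb i).1 hb0 i (Finset.mem_univ i)
    simp [this] at h1
  have hne : ∀ i, f (e i) ≠ 0 := fun i => by
    have h3 : ∑ k, (Pi.single i 1 : Fin 3 → ℝ) k • e k = e i := by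
      rw [Finset.sum_eq_single i] <;> simp +contextual
    rw [← h3]
    refine key _ (fun k => ?_) (by rw [h3]; exact he.ne_zero i)
    by_cases h : k = i
    · subst h; simp
    · simp [h]
  have hsame : ∀ i j, 0 < f (e i) → 0 < f (e j) := fun i j hi => by
    by_contra hj
    have hj : f (e j) < 0 := lt_of_le_of_ne (not_lt.1 hj) (hne j)
    have hij : i ≠ j := by rintro rfl; linarith
    have h3 : ∑ k, (Pi.single i (-f (e j)) + Pi.single j (f (e i)) : Fin 3 → ℝ) k • e k =
        (-f (e j)) • e i + f (e i) • e j := by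
      simp only [Pi.add_apply, add_smul, Finset.sum_add_distrib]
      rw [Finset.sum_eq_single i, Finset.sum_eq_single j] <;> simp +contextual
    refine key (Pi.single i (-f (e j)) + Pi.single j (f (e i))) (fun k => ?_) ?_ ?_
    · rw [Pi.add_apply]
      by_cases h : k = i
      · subst h; simp [hij, hj.le]
      · by_cases h' : k = j
        · subst h'; simp [h, hi.le]
        · simp [h, h']
    · refine sum_ne_zero he (i := j) ?_
      simp [hij.symm, hi.ne']
    · rw [h3]; simp; ring
  refine ⟨fun i => (f (e i))⁻¹ • e i, ?_, fun i => by simp [hne i],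
    fun i => toP_smul (inv_ne_zero (hne i)) _, projCone_smul' e ?_⟩
  · exact he.units_smul fun i => Units.mk0 _ (inv_ne_zero (hne i))
  · by_cases h : 0 < f (e 0)
    · exact Or.inl fun i => inv_pos.2 (hsame 0 i h)
    · refine Or.inr fun i => inv_lt_zero.2 (lt_of_le_of_ne (not_lt.1 fun hi => h ?_) (hne i))
      exact hsame i 0 hi

/-! ### Linear algebra of `SL₃(ℝ)` -/

theorem sl_smul_apply (g : SL3) (v : V3) (i : Fin 3) :
    (g • v) i = g.1 i 0 * v 0 + g.1 i 1 * v 1 + g.1 i 2 * v 2 := by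
  rw [← Fin.sum_univ_three fun j => g.1 i j * v j]
  rfl

theorem sl_smul_smul (g : SL3) (c : ℝ) (v : V3) : g • c • v = c • g • v := smul_comm _ _ _

theorem det3_sl_smul (g : SL3) (x y z : V3) : det3 (g • x) (g • y) (g • z) = det3 x y z := by
  have h := g.2
  rw [Matrix.det_fin_three] at h
  have : det3 (g • x) (g • y) (g • z) =
      (g.1 0 0 * g.1 1 1 * g.1 2 2 - g.1 0 0 * g.1 1 2 * g.1 2 1 - g.1 0 1 * g.1 1 0 * g.1 2 2 +
        g.1 0 1 * g.1 1 2 * g.1 2 0 + g.1 0 2 * g.1 1 0 * g.1 2 1 -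
        g.1 0 2 * g.1 1 1 * g.1 2 0) * det3 x y z := by
    simp only [det3, sl_smul_apply]
    ring
  rw [this, h, one_mul]

/-- The first-order term in `s` of `det (1 + s g)` applied to three vectors. -/
theorem det3_trace (g : SL3) (x y z : V3) :
    det3 (g • x) y z + det3 x (g • y) z + det3 x y (g • z) =
      (g.1 0 0 + g.1 1 1 + g.1 2 2) * det3 x y z := by
  simp only [det3, sl_smul_apply]
  ring

/-- The action of `g` on `ℝ³`, as a linear map. -/
def actₗ (g : SL3) : V3 →ₗ[ℝ] V3 := DistribSMul.toLinearMap ℝ V3 g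

theorem actₗ_apply (g : SL3) (v : V3) : actₗ g v = g • v := rfl

theorem smul_ne_zero_iff' (g : SL3) {v : V3} : g • v ≠ 0 ↔ v ≠ 0 := smul_ne_zero_iff_ne g

theorem continuous_smul_sl (g : SL3) : Continuous fun v : V3 => g • v :=
  (actₗ g).continuous_of_finiteDimensional

/-- An element whose eigenvalues are all positive. -/
def HasPosEigenvalues (g : SL3) : Prop :=
  ∃ a b c : ℝ, 0 < a ∧ 0 < b ∧ 0 < c ∧ a * b * c = 1 ∧ g.1 0 0 + g.1 1 1 + g.1 2 2 = a + b + c ∧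
    ∀ x : ℝ, (x • (1 : Matrix (Fin 3) (Fin 3) ℝ) - g.1).det = (x - a) * (x - b) * (x - c)

theorem hasPosEigenvalues_of_conj {g : SL3} {B : Matrix (Fin 3) (Fin 3) ℝ}
    (h : IsConjMatrix g.1 B) {a b c : ℝ} (ha : 0 < a) (hb : 0 < b) (hc : 0 < c)
    (habc : a * b * c = 1) (htr : B.trace = a + b + c)
    (hdet : ∀ x : ℝ, (x • (1 : Matrix (Fin 3) (Fin 3) ℝ) - B).det =
      (x - a) * (x - b) * (x - c)) : HasPosEigenvalues g := by
  obtain ⟨U, hU⟩ := h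
  have hg : g.1 = U.1 * B * (U⁻¹ : GL (Fin 3) ℝ).1 := by
    rw [← hU, Units.mul_inv_cancel_right]
  refine ⟨a, b, c, ha, hb, hc, habc, ?_, fun x => ?_⟩
  · rw [← htr, ← Matrix.trace_fin_three, hg]
    exact Matrix.trace_units_conj U B
  · rw [← hdet, ← Matrix.det_units_conj U (x • 1 - B), hg]
    congr 1
    rw [mul_sub, sub_mul, mul_smul_comm, mul_one, smul_mul_assoc, Units.mul_inv]

/-- The three types enter the proof only through this common property. -/
theorem hasPosEigenvalues_of_type {δ : SL3}
    (h : IsHyperbolic δ ∨ IsQuasiHyperbolic δ ∨ IsParabolic δ) : HasPosEigenvalues δ := by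
  rcases h with ⟨a, b, c, h₁, h₂, h₃, h₄, h⟩ | ⟨a, b, h₁, h₂, h₃, -, -, h⟩ | h
  · refine hasPosEigenvalues_of_conj h (by linarith) (by linarith) h₃ h₄ ?_ fun x => ?_
    · simp [Matrix.trace_fin_three]
    · simp [Matrix.det_fin_three]
  · refine hasPosEigenvalues_of_conj h h₁ h₁ h₂ (by rw [← h₃]; ring) ?_ fun x => ?_
    · simp [Matrix.trace_fin_three]
    · simp [Matrix.det_fin_three]
  · refine hasPosEigenvalues_of_conj h one_pos one_pos one_pos (by norm_num) ?_ fun x => ?_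
    · simp [Matrix.trace_fin_three]
    · simp [Matrix.det_fin_three]

theorem HasPosEigenvalues.of_isConj {g δ : SL3} (h : HasPosEigenvalues δ) (hg : IsConj g δ) :
    HasPosEigenvalues g := by
  obtain ⟨a, b, c, ha, hb, hc, habc, htr, hdet⟩ := h
  obtain ⟨U, hU⟩ := isConj_iff.1 hg
  refine hasPosEigenvalues_of_conj (B := δ.1) ?_ ha hb hc habc
    (by rw [Matrix.trace_fin_three, htr]) hdet
  refine ⟨(Matrix.SpecialLinearGroup.toGL U)⁻¹, ?_⟩
  have h1 : g * U⁻¹ = U⁻¹ * δ := by rw [← hU]; group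
  have h2 := congrArg (fun x : SL3 => x.1) h1
  rw [← map_inv]
  exact h2

theorem HasPosEigenvalues.eigenvalue {g : SL3} (h : HasPosEigenvalues g) {v : V3} (hv : v ≠ 0)
    {l : ℝ} (hl : g • v = l • v) : 0 < l ∧ ∃ μ ν : ℝ, 0 < μ ∧ 0 < ν ∧
      g.1 0 0 + g.1 1 1 + g.1 2 2 = l + μ + ν ∧ l * μ * ν = 1 := by
  obtain ⟨a, b, c, ha, hb, hc, habc, htr, hdet⟩ := h
  have h0 : (l • (1 : Matrix (Fin 3) (Fin 3) ℝ) - g.1).det = 0 := by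
    refine Matrix.exists_mulVec_eq_zero_iff.1 ⟨v, hv, ?_⟩
    rw [Matrix.sub_mulVec, Matrix.smul_mulVec, Matrix.one_mulVec, sub_eq_zero]
    exact hl.symm
  rw [hdet, mul_eq_zero, mul_eq_zero, sub_eq_zero, sub_eq_zero, sub_eq_zero] at h0
  rcases h0 with (rfl | rfl) | rfl
  · exact ⟨ha, b, c, hb, hc, by rw [htr], habc⟩
  · exact ⟨hb, a, c, ha, hc, by rw [htr]; ring, by rw [← habc]; ring⟩
  · exact ⟨hc, a, b, ha, hb, by rw [htr]; ring, by rw [← habc]; ring⟩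

/-- An invariant line through a fixed point. -/
theorem exists_eigenform {g : SL3} {p : V3} {l μ ν : ℝ} (hp : g • p = l • p)
    (htr : g.1 0 0 + g.1 1 1 + g.1 2 2 = l + μ + ν) (hdet : l * μ * ν = 1) (y : V3) :
    ∃ η : V3 →ₗ[ℝ] ℝ, η p = 0 ∧ (∀ v, η (g • v) = μ * η v) ∧ η y = -det3 p y (g • y) := by
  have h1 : ∀ y z, det3 p (g • y) z + det3 p y (g • z) = (μ + ν) * det3 p y z := fun y z => by
    have := det3_trace g p y z
    rw [hp, det3_smul_left, htr] at this
    linarith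
  have h2 : ∀ y z, det3 p (g • y) (g • z) = μ * ν * det3 p y z := fun y z => by
    have := det3_sl_smul g p y z
    rw [hp, det3_smul_left] at this
    linear_combination μ * ν * this - det3 p (g • y) (g • z) * hdet
  let D : V3 →ₗ[ℝ] ℝ :=
    { toFun := det3 p y, map_add' := det3_add_right p y, map_smul' := fun c => det3_smul_right c p y }
  -- On the quotient by `p`, Cayley–Hamilton gives `(g - μ) (g - ν) = 0`. A form that kills `p`,
  -- precomposed with `ν - g`, is therefore multiplied by `μ` under `g`. The choice `D = det3 p y`
  -- makes the value at `y` explicit.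
  refine ⟨-(D ∘ₗ actₗ g) + ν • D, ?_, fun v => ?_, ?_⟩
  · change -det3 p y (g • p) + ν * det3 p y p = 0
    rw [hp, det3_smul_right, det3_self_left]; ring
  · change -det3 p y (g • g • v) + ν * det3 p y (g • v) =
      μ * (-det3 p y (g • v) + ν * det3 p y v)
    have e1 := h1 y (g • v)
    rw [h2] at e1
    linear_combination -e1
  · change -det3 p y (g • y) + ν * det3 p y y = _
    rw [det3_self_right]; ring

/-! ### Lifting the hexagon to `ℝ³` -/

/-- The vectors `P i`, `Q i` lift the vertices of the hexagon. -/
structure HexagonLift (γ : Fin 3 → SL3) (P Q : Fin 3 → V3) : Prop where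
  det_pos : 0 < det3 (P 0) (P 1) (P 2)
  outer : ∀ i, ∃ x y z : ℝ, 0 < x ∧ 0 < y ∧ 0 < z ∧
    Q i = -(x • P i) + y • P (i + 1) + z • P (i + 2)
  fixed : ∀ i, ∃ l : ℝ, 0 < l ∧ γ i • P i = l • P i
  map_outer : ∀ i, ∃ l : ℝ, 0 < l ∧ γ i • Q (i + 1) = l • P (i + 1)
  map_inner : ∀ i, ∃ l : ℝ, 0 < l ∧ γ i • P (i + 2) = l • Q (i + 2)
  prod_eq_one : γ 2 * γ 1 * γ 0 = 1
  support : ∀ i, ∃ η : V3 →ₗ[ℝ] ℝ, η (P i) = 0 ∧ 0 < η (P (i + 1)) ∧ 0 < η (P (i + 2)) ∧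
    ∃ μ : ℝ, 0 < μ ∧ ∀ v, η (γ i • v) = μ * η v

theorem fin3_add_two_add_one (i : Fin 3) : i + 2 + 1 = i := by fin_cases i <;> rfl
theorem fin3_add_one_add_two (i : Fin 3) : i + 1 + 2 = i := by fin_cases i <;> rfl
theorem fin3_add_one_add_one (i : Fin 3) : i + 1 + 1 = i + 2 := by fin_cases i <;> rfl
theorem fin3_add_two_add_two (i : Fin 3) : i + 2 + 2 = i + 1 := by fin_cases i <;> rfl

theorem fin3_cases (i j : Fin 3) : j = i ∨ j = i + 1 ∨ j = i + 2 := by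
  fin_cases i <;> fin_cases j <;> decide

theorem fin3_sum (i : Fin 3) {M : Type*} [AddCommMonoid M] (f : Fin 3 → M) :
    ∑ j, f j = f i + f (i + 1) + f (i + 2) := by
  fin_cases i
  · exact Fin.sum_univ_three f
  · rw [Fin.sum_univ_three, add_rotate]; rfl
  · rw [Fin.sum_univ_three, add_rotate, add_rotate]; rfl

theorem det3_update {P : Fin 3 → V3} {q : V3} {i : Fin 3} {x y z : ℝ}
    (hq : q = x • P i + y • P (i + 1) + z • P (i + 2)) :
    det3 (Function.update P i q 0) (Function.update P i q 1) (Function.update P i q 2) =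
      x * det3 (P 0) (P 1) (P 2) := by
  subst hq
  fin_cases i <;> simp [det3, Function.update] <;> ring

/-- The invariant form is normalised on `q`: since `γ` sends `q` to a positive multiple of `p₁`, its
value there is a positive multiple of `det3 p p₁ p₂`. Invariance with `μ > 0` transfers positivity
from `q` to `p₁`, and the position of `q` across the edge transfers it to `p₂`. Either of the two
remaining eigenvalues may serve as `μ`. -/
theorem exists_support {γ : SL3} (hγ : HasPosEigenvalues γ) {p p₁ p₂ q : V3}
    (hdet : 0 < det3 p p₁ p₂) {x y z : ℝ} (hx : 0 < x) (hy : 0 < y)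
    (hq : q = -(x • p₁) + y • p₂ + z • p) {l a : ℝ} (hp : γ • p = l • p) (ha : 0 < a)
    (hqa : γ • q = a • p₁) :
    ∃ η : V3 →ₗ[ℝ] ℝ, η p = 0 ∧ 0 < η p₁ ∧ 0 < η p₂ ∧
      ∃ μ : ℝ, 0 < μ ∧ ∀ v, η (γ • v) = μ * η v := by
  have hp0 : p ≠ 0 := by rintro rfl; simp [det3] at hdet
  obtain ⟨-, μ, ν, hμ, hν, htr, hd⟩ := hγ.eigenvalue hp0 hp
  obtain ⟨η, h₀, h₁, h₂⟩ := exists_eigenform hp htr hd q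
  have hηq : 0 < η q := by
    rw [h₂, hqa, det3_smul_right, hq]
    have : det3 p (-(x • p₁) + y • p₂ + z • p) p₁ = -(y * det3 p p₁ p₂) := by
      simp [det3]; ring
    rw [this]
    have := mul_pos ha (mul_pos hy hdet)
    linarith
  have hηp₁ : 0 < η p₁ := by
    have := h₁ q
    rw [hqa, map_smul, smul_eq_mul] at this
    exact pos_of_mul_pos_right (by rw [this]; positivity) ha.le
  refine ⟨η, h₀, hηp₁, ?_, μ, hμ, h₁⟩
  have : y * η p₂ = η q + x * η p₁ := by
    rw [hq]; simp [h₀]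
  exact pos_of_mul_pos_right (by rw [this]; positivity) hy.le

theorem eq_of_toP_eq {f : Module.Dual ℝ V3} {v w : V3} (hv : f v = 1) (hw : f w = 1)
    (h : toP v = toP w) : v = w := by
  obtain ⟨c, hc, rfl⟩ := (toP_eq_iff (by rintro rfl; simp at hv) (by rintro rfl; simp at hw)).1 h
  rw [map_smul, hw, smul_eq_mul, mul_one] at hv
  rw [hv, one_smul]

theorem mem_edge_toP {P : Fin 3 → V3} (hP : ∀ i, P i ≠ 0) {p : Fin 3 → P2}
    (hp : ∀ i, p i = toP (P i)) {T : Set P2} {i : Fin 3} {v : V3} (hv : v ≠ 0)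
    (h : toP v ∈ edge p T i) : ∃ a b : ℝ, v = a • P (i + 1) + b • P (i + 2) := by
  have := h.2
  rw [hp, hp, toP_of_ne hv, toP_of_ne (hP _), toP_of_ne (hP _), Projectivization.submodule_mk,
    Projectivization.submodule_mk, Projectivization.submodule_mk, ← Submodule.span_union,
    Submodule.span_singleton_le_iff_mem, Set.singleton_union, Submodule.mem_span_pair] at this
  obtain ⟨a, b, h⟩ := this
  exact ⟨a, b, h.symm⟩

theorem sum_update (P : Fin 3 → V3) (q : V3) (i : Fin 3) (a : Fin 3 → ℝ) :
    ∑ j, a j • Function.update P i q j = a i • q + a (i + 1) • P (i + 1) + a (i + 2) • P (i + 2) := by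
  rw [fin3_sum i]
  have h1 : i + 1 ≠ i := by fin_cases i <;> decide
  have h2 : i + 2 ≠ i := by fin_cases i <;> decide
  rw [Function.update_self, Function.update_of_ne h1, Function.update_of_ne h2]

/-- The signs of the coordinates of `q` are forced one by one. A positive coordinate on `P i` would
make the interiors of the two triangles overlap near their common edge; a nonpositive coordinate on
another vertex would put the third one in the hull of `q` and two vertices, against convex position.
-/
theorem exists_outer_of_convex {P : Fin 3 → V3} (hP : LinearIndependent ℝ P) {q : V3} {i : Fin 3}
    (hq : LinearIndependent ℝ (Function.update P i q)) {f : Module.Dual ℝ V3}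
    (hf : ∀ i, f (P i) = 1) (hfq : f q = 1) {p : Fin 3 → P2} (hp : ∀ i, p i = toP (P i))
    {T₀ T : Set P2} (hT₀ : T₀ = projCone P \ Set.range p)
    (hT : T = projCone (Function.update P i q) \ Set.range (Function.update p i (toP q)))
    (hinter : T₀ ∩ T = edge p T₀ i)
    (h₁ : P (i + 1) ∉ convexHull ℝ {q, P i, P (i + 2)})
    (h₂ : P (i + 2) ∉ convexHull ℝ {q, P i, P (i + 1)}) :
    ∃ x y z : ℝ, 0 < x ∧ 0 < y ∧ 0 < z ∧ q = -(x • P i) + y • P (i + 1) + z • P (i + 2) := by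
  obtain ⟨a, ha⟩ := exists_sum_eq hP q
  rw [fin3_sum i] at ha
  have hsum : a i + a (i + 1) + a (i + 2) = 1 := by
    have := congrArg f ha
    simpa [hf, hfq] using this.symm
  have hne : a i ≠ 0 := fun h => by
    have := det3_update ha
    rw [h, zero_mul] at this
    exact det3_ne_zero_iff.2 hq this
  have hi1 : i + 1 ≠ i := by fin_cases i <;> decide
  have hi2 : i + 2 ≠ i := by fin_cases i <;> decide
  have hi3 : i + 2 ≠ i + 1 := by fin_cases i <;> decide
  have hneg : a i < 0 := by
    by_contra hpos
    replace hpos : 0 < a i := lt_of_le_of_ne (not_lt.1 hpos) hne.symm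
    -- A point close to the common edge: with `r` this large, `q + r • P (i + 1) + r • P (i + 2)`
    -- has positive coordinates in both frames.
    set r := |a (i + 1)| + |a (i + 2)| + 1 with hr
    have hr0 : 0 < r := by positivity
    set c : Fin 3 → ℝ := fun j => if j = i then 1 else r with hc
    have hci : c i = 1 := by simp [hc]
    have hci1 : c (i + 1) = r := by simp [hc]
    have hci2 : c (i + 2) = r := by simp [hc]
    set b : Fin 3 → ℝ := fun j => if j = i then a i else a j + r with hb
    have hbi : b i = a i := by simp [hb]
    have hbi1 : b (i + 1) = a (i + 1) + r := by simp [hb]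
    have hbi2 : b (i + 2) = a (i + 2) + r := by simp [hb]
    have hb1 : 0 < a (i + 1) + r := by
      have := neg_abs_le (a (i + 1)); have := abs_nonneg (a (i + 2)); linarith
    have hb2 : 0 < a (i + 2) + r := by
      have := neg_abs_le (a (i + 2)); have := abs_nonneg (a (i + 1)); linarith
    have hcpos : ∀ j, 0 < c j := fun j => by
      rcases fin3_cases i j with rfl | rfl | rfl
      · rw [hci]; exact one_pos
      · rwa [hci1]
      · rwa [hci2]
    have hbpos : ∀ j, 0 < b j := fun j => by
      rcases fin3_cases i j with rfl | rfl | rfl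
      · rwa [hbi]
      · rwa [hbi1]
      · rwa [hbi2]
    have e1 : ∑ j, c j • Function.update P i q j = ∑ j, b j • P j := by
      rw [sum_update, fin3_sum i, ha, hci, hci1, hci2, hbi, hbi1, hbi2]
      module
    have hv : ∑ j, b j • P j ≠ 0 := sum_ne_zero hP (i := i) (hbpos i).ne'
    have hmem : toP (∑ j, b j • P j) ∈ T₀ ∩ T := by
      constructor
      · rw [hT₀]
        refine ⟨mem_projCone.2 ⟨b, fun j => (hbpos j).le, hv, rfl⟩, ?_⟩
        rintro ⟨j, hj⟩
        have : j + 1 ≠ j := by fin_cases j <;> decide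
        exact toP_sum_eq_vertex hP this (hbpos (j + 1)).ne' (by rw [← hj, hp])
      · rw [hT, ← e1]
        refine ⟨mem_projCone.2 ⟨c, fun j => (hcpos j).le, e1 ▸ hv, rfl⟩, ?_⟩
        rintro ⟨j, hj⟩
        have : j + 1 ≠ j := by fin_cases j <;> decide
        refine toP_sum_eq_vertex hq this (hcpos (j + 1)).ne' ?_
        rw [← hj]
        by_cases hji : j = i
        · subst hji; simp
        · simp [hji, hp]
    rw [hinter] at hmem
    obtain ⟨x, y, hxy⟩ := mem_edge_toP hP.ne_zero hp hv hmem
    have k1 := coord_sum P b i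
    rw [hxy] at k1
    have k2 : coord P i (x • P (i + 1) + y • P (i + 2)) = 0 := by
      simp [coord, det3]; ring
    rw [k2] at k1
    exact mul_ne_zero (det3_ne_zero_iff.2 hP) (hbpos i).ne' k1.symm
  have key : ∀ u v : V3, ∀ s r : ℝ, q = a i • P i + s • u + r • v → a i + s + r = 1 → s ≤ 0 →
      v ∈ convexHull ℝ {q, P i, u} := by
    intro u v s r hq' hs hs0
    have hr : 0 < r := by linarith
    have hv : v = (1 / r) • q + (-a i / r) • P i + (-s / r) • u := by
      rw [hq']
      match_scalars <;> field_simp <;> ring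
    have hconv := convex_convexHull ℝ {q, P i, u}
    have m1 : q ∈ convexHull ℝ {q, P i, u} := subset_convexHull _ _ (by simp)
    have m2 : P i ∈ convexHull ℝ {q, P i, u} := subset_convexHull _ _ (by simp)
    have m3 : u ∈ convexHull ℝ {q, P i, u} := subset_convexHull _ _ (by simp)
    have := hconv.sum_mem (t := Finset.univ) (w := ![1 / r, -a i / r, -s / r]) (z := ![q, P i, u])
      (fun j _ => by
        fin_cases j
        · exact (one_div_pos.2 hr).le
        · exact div_nonneg (by linarith) hr.le
        · exact div_nonneg (by linarith) hr.le)
      (by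
        simp only [Fin.sum_univ_three, Matrix.cons_val_zero, Matrix.cons_val_one, Matrix.cons_val]
        rw [← add_div, ← add_div, div_eq_one_iff_eq hr.ne']; linarith)
      (fun j _ => by fin_cases j <;> assumption)
    rw [Fin.sum_univ_three] at this
    rw [hv]
    exact this
  refine ⟨-a i, a (i + 1), a (i + 2), by linarith, ?_, ?_, by rw [neg_smul, neg_neg]; exact ha⟩
  · by_contra h
    exact h₂ (key (P (i + 1)) (P (i + 2)) _ _ ha hsum (not_lt.1 h))
  · by_contra h
    exact h₁ (key (P (i + 2)) (P (i + 1)) (a (i + 2)) (a (i + 1)) (by rw [ha]; abel)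
      (by linarith) (not_lt.1 h))

theorem exists_lift {δ γ : Fin 3 → SL3} {T₀ : Set P2} {T : Fin 3 → Set P2} {p q : Fin 3 → P2}
    (h : IsHexagonGluing δ T₀ T γ p q) :
    ∃ P Q : Fin 3 → V3, LinearIndependent ℝ P ∧
      (∀ i, LinearIndependent ℝ (Function.update P i (Q i))) ∧
      (∀ i, p i = toP (P i)) ∧ (∀ i, q i = toP (Q i)) ∧ T₀ = projCone P \ Set.range p ∧
      (∀ i, T i = projCone (Function.update P i (Q i)) \
        Set.range (Function.update p i (q i))) ∧
      ∀ i, ∃ x y z : ℝ, 0 < x ∧ 0 < y ∧ 0 < z ∧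
        Q i = -(x • P i) + y • P (i + 1) + z • P (i + 2) := by
  obtain ⟨e, he, hpe, hT₀⟩ := h.triangle_zero
  choose e' he' hpe' hT using h.triangle
  obtain ⟨f, w, hw, hconv, hH⟩ := h.hexagon
  have hpe₂ : ∀ i, p i = toP (e i) := fun i => by
    obtain ⟨h0, h⟩ := hpe i
    rw [h, toP_of_ne h0]
  have hpe'₂ : ∀ i j, Function.update p i (q i) j = toP (e' i j) := fun i j => by
    obtain ⟨h0, h⟩ := hpe' i j
    rw [h, toP_of_ne h0]
  have hcl₀ : closure T₀ = projCone e := by rw [hT₀]; exact closure_pointed he hpe₂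
  have hcl : ∀ i, closure (T i) = projCone (e' i) := fun i => by
    rw [hT i]; exact closure_pointed (he' i) (hpe'₂ i)
  simp only [hcl₀, hcl] at hH
  obtain ⟨P, hP, hfP, hPe, hcP⟩ := normalize_frame hw he
    (by rw [← hH]; exact Set.subset_union_left)
  have hex := fun i => normalize_frame hw (he' i)
    (by rw [← hH]; exact (Set.subset_iUnion (fun i => projCone (e' i)) i).trans
          Set.subset_union_right)
  choose P' hP' hfP' hPe' hcP' using hex
  have hup : ∀ i, P' i = Function.update P i (P' i i) := fun i => by
    funext j
    by_cases hji : j = i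
    · subst hji; simp
    · rw [Function.update_of_ne hji]
      refine eq_of_toP_eq (hfP' i j) (hfP j) ?_
      rw [hPe', ← hpe'₂, Function.update_of_ne hji, hpe₂, hPe]
  have hp : ∀ i, p i = toP (P i) := fun i => by rw [hpe₂, hPe]
  have hq : ∀ i, q i = toP (P' i i) := fun i => by
    rw [hPe', ← hpe'₂, Function.update_self]
  have hT₀' : T₀ = projCone P \ Set.range p := by rw [hT₀, hcP]
  have hT' : ∀ i, T i = projCone (Function.update P i (P' i i)) \
      Set.range (Function.update p i (q i)) := fun i => by rw [hT i, ← hcP', ← hup]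
  refine ⟨P, fun i => P' i i, hP, fun i => hup i ▸ hP' i, hp, hq, hT₀', hT', fun i => ?_⟩
  set X : Set V3 := Set.range P ∪ Set.range fun i => P' i i with hX
  have hPX : ∀ i, P i ∈ X := fun i => Or.inl ⟨i, rfl⟩
  have hQX : ∀ i, P' i i ∈ X := fun i => Or.inr ⟨i, rfl⟩
  have hull : convexHull ℝ X = convexHull ℝ (Set.range w) := by
    refine (convexHull_min ?_ (convex_convexHull ℝ _)).antisymm
      (convexHull_min ?_ (convex_convexHull ℝ _))
    · have vert : ∀ (e : Fin 3 → V3) j, LinearIndependent ℝ e → toP (e j) ∈ projCone e :=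
        fun e j he => by
          have h3 : ∑ k, (Pi.single j 1 : Fin 3 → ℝ) k • e k = e j := by
            rw [Finset.sum_eq_single j] <;> simp +contextual
          refine mem_projCone.2 ⟨Pi.single j 1, fun k => ?_, by rw [h3]; exact he.ne_zero j,
            by rw [h3]⟩
          by_cases h : k = j
          · subst h; simp
          · simp [h]
      rintro v (⟨j, rfl⟩ | ⟨j, rfl⟩)
      · refine mem_convexHull_of_toP_mem hw (hfP j) ?_
        rw [← hH, ← hcP]
        exact Or.inl (vert P j hP)
      · refine mem_convexHull_of_toP_mem hw (hfP' j j) ?_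
        rw [← hH]
        refine Or.inr (Set.mem_iUnion.2 ⟨j, ?_⟩)
        rw [← hcP']
        exact vert (P' j) j (hP' j)
    · rintro v ⟨j, rfl⟩
      have : toP (w j) ∈ projCone w := by
        have h3 : ∑ k, (Pi.single j 1 : Fin 6 → ℝ) k • w k = w j := by
          rw [Finset.sum_eq_single j] <;> simp +contextual
        refine mem_projCone.2 ⟨Pi.single j 1, fun k => ?_, ?_, by rw [h3]⟩
        · by_cases h : k = j
          · subst h; simp
          · simp [h]
        · rw [h3]; intro h0; have := hw j; rw [h0] at this; simp at this
      rw [← hH, ← hcP] at this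
      rcases this with h | h
      · exact convexHull_mono (by rw [hX]; exact Set.subset_union_left)
          (mem_convexHull_of_toP_mem hfP (hw j) h)
      · obtain ⟨k, hk⟩ := Set.mem_iUnion.1 h
        rw [← hcP'] at hk
        refine convexHull_mono ?_ (mem_convexHull_of_toP_mem (hfP' k) (hw j) hk)
        rintro v ⟨m, rfl⟩
        rw [hup k]
        by_cases hmk : m = k
        · subst hmk; rw [Function.update_self]; exact hQX m
        · rw [Function.update_of_ne hmk]; exact hPX m
  have hsub : Set.range w ⊆ X := notMem_convexHull_of_eq hconv.range hull
  have hXfin : X.Finite := (Set.finite_range _).union (Set.finite_range _)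
  have hcard : X.ncard ≤ (Set.range w).ncard := by
    have h6 : (Set.range w).ncard = 6 := by
      rw [← Nat.card_coe_set_eq, Nat.card_range_of_injective hconv.injective]; simp
    have h3 : ∀ g : Fin 3 → V3, (Set.range g).ncard ≤ 3 := fun g => by
      rw [← Set.image_univ]
      refine (Set.ncard_image_le Set.finite_univ).trans ?_
      simp [Set.ncard_univ]
    rw [h6]
    exact (Set.ncard_union_le _ _).trans (add_le_add (h3 _) (h3 _))
  -- The six vertices of the hexagon belong to `X`, and `X` has at most six elements; so the `P i`
  -- and the `P' i i` are precisely the vertices and are in convex position.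
  have hXw : Set.range w = X := Set.eq_of_subset_of_ncard_le hsub hcard hXfin
  have hXc : ∀ x ∈ X, x ∉ convexHull ℝ (X \ {x}) := by
    rw [← convexIndependent_set_iff_notMem_convexHull_sdiff, ← hXw]
    exact hconv.range
  have hPinj := hP.injective
  have hi1 : i + 1 ≠ i := by fin_cases i <;> decide
  have hi2 : i + 2 ≠ i := by fin_cases i <;> decide
  have hi3 : i + 2 ≠ i + 1 := by fin_cases i <;> decide
  have hQP : ∀ j, j ≠ i → P' i i ≠ P j := fun j hj h => by
    have h1 : P' i j = P j := by rw [hup i, Function.update_of_ne hj]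
    exact hj ((hP' i).injective (h1.trans h.symm))
  have hlast : ∀ j k, j ≠ i → k ≠ j → P j ∉ convexHull ℝ {P' i i, P i, P k} :=
    fun j k hj hk hmem => by
      refine hXc (P j) (hPX j) (convexHull_mono ?_ hmem)
      rintro v (rfl | rfl | rfl)
      · exact ⟨hQX i, hQP j hj⟩
      · exact ⟨hPX i, fun h => hj (hPinj h).symm⟩
      · exact ⟨hPX k, fun h => hk (hPinj h)⟩
  refine exists_outer_of_convex hP (hup i ▸ hP' i) hfP (hfP' i i) hp hT₀' ?_ (h.inter i)
    (hlast _ _ hi1 hi3) (hlast _ _ hi2 hi3.symm)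
  rw [hT' i, hq]

/-- What remains is a question of signs. Negating all the lifts makes the determinant positive. The
conditions on vertices determine images up to nonzero factors: the factor at `P i` is an eigenvalue,
hence positive, and the other two have its sign because `γ i` sends `T (i + 1)` to `T (i + 2)` and
not to another triangle with the same vertices. -/
theorem exists_hexagonLift {δ γ : Fin 3 → SL3} {T₀ : Set P2} {T : Fin 3 → Set P2}
    {p q : Fin 3 → P2} (hδ : ∀ i, IsHyperbolic (δ i) ∨ IsQuasiHyperbolic (δ i) ∨ IsParabolic (δ i))
    (h : IsHexagonGluing δ T₀ T γ p q) :
    ∃ P Q : Fin 3 → V3, HexagonLift γ P Q ∧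
      T₀ = projCone P \ Set.range (fun i => toP (P i)) ∧
      ∀ i, T i = projCone (Function.update P i (Q i)) \
        Set.range fun j => toP (Function.update P i (Q i) j) := by
  obtain ⟨P, Q, hP, hQ, hp, hq, hT₀, hT, hout⟩ : ∃ P Q : Fin 3 → V3,
      0 < det3 (P 0) (P 1) (P 2) ∧
      (∀ i, LinearIndependent ℝ (Function.update P i (Q i))) ∧
      (∀ i, p i = toP (P i)) ∧ (∀ i, q i = toP (Q i)) ∧ T₀ = projCone P \ Set.range p ∧
      (∀ i, T i = projCone (Function.update P i (Q i)) \
        Set.range (Function.update p i (q i))) ∧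
      ∀ i, ∃ x y z : ℝ, 0 < x ∧ 0 < y ∧ 0 < z ∧
        Q i = -(x • P i) + y • P (i + 1) + z • P (i + 2) := by
    obtain ⟨P, Q, hP, hQ, hp, hq, hT₀, hT, hout⟩ := exists_lift h
    by_cases hpos : 0 < det3 (P 0) (P 1) (P 2)
    · exact ⟨P, Q, hpos, hQ, hp, hq, hT₀, hT, hout⟩
    have hneg := lt_of_le_of_ne (not_lt.1 hpos) (det3_ne_zero_iff.2 hP)
    have hupd : ∀ i, Function.update (fun i => -P i) i (-Q i) =
        fun j => -Function.update P i (Q i) j := fun i => by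
      funext j
      by_cases hj : j = i
      · subst hj; simp
      · simp [hj]
    have htoP : ∀ v, toP (-v) = toP v := fun v => by
      rw [← neg_one_smul ℝ, toP_smul (by norm_num)]
    refine ⟨fun i => -P i, fun i => -Q i, ?_, fun i => ?_, fun i => ?_, fun i => ?_, ?_,
      fun i => ?_, fun i => ?_⟩
    · have : det3 (-P 0) (-P 1) (-P 2) = -det3 (P 0) (P 1) (P 2) := by simp [det3]; ring
      linarith
    · rw [hupd]
      have := (hQ i).units_smul fun _ => (-1 : ℝˣ)
      convert this using 1
      funext j
      simp
    · rw [htoP, hp]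
    · rw [htoP, hq]
    · rw [projCone_neg]; exact hT₀
    · rw [hupd, projCone_neg]; exact hT i
    · obtain ⟨x, y, z, hx, hy, hz, hQi⟩ := hout i
      exact ⟨x, y, z, hx, hy, hz, by dsimp only; rw [hQi]; module⟩
  have hPli : LinearIndependent ℝ P := det3_ne_zero_iff.1 hP.ne'
  have hP0 := hPli.ne_zero
  have hQ0 : ∀ i, Q i ≠ 0 := fun i => by
    have := (hQ i).ne_zero i
    rwa [Function.update_self] at this
  have lift_eq : ∀ (g : SL3) {u v : V3}, u ≠ 0 → v ≠ 0 → g • toP u = toP v →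
      ∃ l : ℝ, l ≠ 0 ∧ g • u = l • v := fun g u v hu hv he => by
    rw [smul_toP g hu] at he
    exact (toP_eq_iff ((smul_ne_zero_iff' g).2 hu) hv).1 he
  have hrange : ∀ i, (fun j => toP (Function.update P i (Q i) j)) =
      Function.update p i (q i) := fun i => by
    funext j
    by_cases hj : j = i
    · subst hj; simp [hq]
    · simp [hj, hp]
  have hpp : (fun i => toP (P i)) = p := funext fun i => (hp i).symm
  have hdyn : ∀ i, (∃ l : ℝ, 0 < l ∧ γ i • P i = l • P i) ∧
      (∃ l : ℝ, 0 < l ∧ γ i • Q (i + 1) = l • P (i + 1)) ∧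
      ∃ l : ℝ, 0 < l ∧ γ i • P (i + 2) = l • Q (i + 2) := fun i => by
    have h1 := h.map_fixed i
    have h2 := h.map_outer i
    have h3 := h.map_inner i
    have h4 := h.map_triangle i
    rw [hp] at h1
    rw [hp, hq] at h2 h3
    obtain ⟨l, hl, hl'⟩ := lift_eq _ (hP0 _) (hP0 _) h1
    obtain ⟨a, ha, ha'⟩ := lift_eq _ (hQ0 _) (hP0 _) h2
    obtain ⟨b, hb, hb'⟩ := lift_eq _ (hP0 _) (hQ0 _) h3
    have hγ : HasPosEigenvalues (γ i) := (hasPosEigenvalues_of_type (hδ i)).of_isConj (h.conj i)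
    have hlpos := (hγ.eigenvalue (hP0 i) hl').1
    -- The image of a point with all coordinates equal to `1` has the three unknown factors as
    -- coordinates; its membership in `T (i + 2)` forces them to have one sign.
    have hmem : toP (Q (i + 1) + P (i + 2) + P i) ∈ T (i + 1) := by
      have hs := sum_update P (Q (i + 1)) (i + 1) (fun _ => 1)
      simp only [one_smul, fin3_add_one_add_one, fin3_add_one_add_two] at hs
      rw [hT, ← hs]
      refine ⟨mem_projCone.2 ⟨fun _ => 1, fun _ => zero_le_one, ?_, ?_⟩, ?_⟩
      · simpa using sum_ne_zero (hQ (i + 1)) (a := fun _ => 1) (i := 0) one_ne_zero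
      · simp
      · rintro ⟨j, hj⟩
        have : j + 1 ≠ j := by fin_cases j <;> decide
        refine toP_sum_eq_vertex (hQ (i + 1)) (a := fun _ => 1) this one_ne_zero ?_
        simp only [one_smul]
        rw [← hj, ← hrange]
    have hne : Q (i + 1) + P (i + 2) + P i ≠ 0 := by
      have hs := sum_update P (Q (i + 1)) (i + 1) (fun _ => 1)
      simp only [one_smul, fin3_add_one_add_one, fin3_add_one_add_two] at hs
      rw [← hs]
      simpa using sum_ne_zero (hQ (i + 1)) (a := fun _ => 1) (i := 0) one_ne_zero
    have hmem' : γ i • toP (Q (i + 1) + P (i + 2) + P i) ∈ T (i + 2) := by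
      rw [← h4]; exact Set.smul_mem_smul_set hmem
    rw [smul_toP _ hne, hT] at hmem'
    have hne' := (smul_ne_zero_iff' (γ i)).2 hne
    have hcone := (toP_mem_projCone_iff (hQ (i + 2)) hne').1 hmem'.1
    set c : Fin 3 → ℝ := fun j => if j = i + 2 then b else if j = i then l else a with hc
    have hci : c i = l := by
      have : i ≠ i + 2 := by fin_cases i <;> decide
      simp [hc, this]
    have hc1 : c (i + 1) = a := by
      have : i + 1 ≠ i + 2 := by fin_cases i <;> decide
      simp [hc, this]
    have hc2 : c (i + 2) = b := by simp [hc]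
    have hs := sum_update P (Q (i + 2)) (i + 2) c
    simp only [fin3_add_two_add_one, fin3_add_two_add_two, hci, hc1, hc2] at hs
    have hsm : γ i • (Q (i + 1) + P (i + 2) + P i) = ∑ j, c j • Function.update P (i + 2) (Q (i + 2)) j := by
      rw [hs, smul_add, smul_add, hl', ha', hb']; abel
    rw [hsm] at hcone
    simp only [coord_sum] at hcone
    set D := det3 (Function.update P (i + 2) (Q (i + 2)) 0) (Function.update P (i + 2) (Q (i + 2)) 1)
      (Function.update P (i + 2) (Q (i + 2)) 2)
    have hD : D ≠ 0 := det3_ne_zero_iff.2 (hQ (i + 2))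
    have hpos : ∀ j, c j ≠ 0 → 0 < c j := fun j hj => by
      rcases hcone with hh | hh
      · have hli := hh i
        rw [hci] at hli
        have hDp : 0 < D := lt_of_le_of_ne (nonneg_of_mul_nonneg_left hli hlpos) hD.symm
        exact lt_of_le_of_ne (nonneg_of_mul_nonneg_right (hh j) hDp) hj.symm
      · have hli := hh i
        rw [hci] at hli
        have hDn : D < 0 := lt_of_le_of_ne (nonpos_of_mul_nonpos_left hli hlpos) hD
        by_contra hneg
        have := mul_pos_of_neg_of_neg hDn (lt_of_le_of_ne (not_lt.1 hneg) hj)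
        linarith [hh j]
    exact ⟨⟨l, hlpos, hl'⟩, ⟨a, by rw [← hc1]; exact hpos _ (by rwa [hc1]), ha'⟩,
      ⟨b, by rw [← hc2]; exact hpos _ (by rwa [hc2]), hb'⟩⟩
  refine ⟨P, Q, ⟨hP, hout, fun i => (hdyn i).1, fun i => (hdyn i).2.1, fun i => (hdyn i).2.2,
    h.prod_eq_one, fun i => ?_⟩, by rw [hpp]; exact hT₀, fun i => by rw [hrange]; exact hT i⟩
  have hγ : HasPosEigenvalues (γ i) := (hasPosEigenvalues_of_type (hδ i)).of_isConj (h.conj i)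
  obtain ⟨l, hl, hl'⟩ := (hdyn i).1
  obtain ⟨a, ha, ha'⟩ := (hdyn i).2.1
  obtain ⟨x, y, z, hx, hy, hz, hQi⟩ := hout (i + 1)
  rw [fin3_add_one_add_one, fin3_add_one_add_two] at hQi
  exact exists_support hγ (by rw [det3_cyclic]; exact hP) hx hy hQi hl' ha ha'

/-! ### Cones over pointed triangles, and the concrete tiling -/

section

/-- The cone spanned by `x`, `y`, `z`, without the three extreme rays. -/
def pointedCone (x y z : V3) : Set V3 :=
  {v | ∃ a b c : ℝ, 0 ≤ a ∧ 0 ≤ b ∧ 0 ≤ c ∧ 0 < a + b ∧ 0 < b + c ∧ 0 < c + a ∧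
    v = a • x + b • y + c • z}

theorem pointedCone_rotate (x y z : V3) : pointedCone x y z = pointedCone y z x := by
  ext v
  constructor
  · rintro ⟨a, b, c, h₁, h₂, h₃, h₄, h₅, h₆, rfl⟩
    exact ⟨b, c, a, h₂, h₃, h₁, h₅, h₆, h₄, by abel⟩
  · rintro ⟨a, b, c, h₁, h₂, h₃, h₄, h₅, h₆, rfl⟩
    exact ⟨c, a, b, h₃, h₁, h₂, h₆, h₄, h₅, by abel⟩

theorem pointedCone_swap (x y z : V3) : pointedCone x y z = pointedCone y x z := by
  ext v
  constructor
  · rintro ⟨a, b, c, h₁, h₂, h₃, h₄, h₅, h₆, rfl⟩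
    exact ⟨b, a, c, h₂, h₁, h₃, by linarith, by linarith, by linarith, by abel⟩
  · rintro ⟨a, b, c, h₁, h₂, h₃, h₄, h₅, h₆, rfl⟩
    exact ⟨b, a, c, h₂, h₁, h₃, by linarith, by linarith, by linarith, by abel⟩

theorem pointedCone_smul_subset (x y z : V3) {r : ℝ} (hr : 0 < r) :
    pointedCone (r • x) y z ⊆ pointedCone x y z := by
  rintro v ⟨a, b, c, h₁, h₂, h₃, h₄, h₅, h₆, rfl⟩
  have key : ∀ b, 0 ≤ b → 0 < a + b → 0 < a * r + b := fun b hb h => by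
    rcases h₁.eq_or_lt with h0 | h0
    · rw [← h0] at h ⊢; linarith
    · positivity
  exact ⟨a * r, b, c, by positivity, h₂, h₃, key b h₂ h₄, h₅,
    by rw [add_comm]; exact key c h₃ (by linarith), by rw [smul_smul]⟩

theorem pointedCone_smul (x y z : V3) {r : ℝ} (hr : 0 < r) :
    pointedCone (r • x) y z = pointedCone x y z := by
  refine (pointedCone_smul_subset x y z hr).antisymm ?_
  have := pointedCone_smul_subset (r • x) y z (inv_pos.2 hr)
  rwa [smul_smul, inv_mul_cancel₀ hr.ne', one_smul] at this

theorem smul_pointedCone (g : SL3) (x y z : V3) :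
    g • pointedCone x y z = pointedCone (g • x) (g • y) (g • z) := by
  ext v
  constructor
  · rintro ⟨_, ⟨a, b, c, h₁, h₂, h₃, h₄, h₅, h₆, rfl⟩, rfl⟩
    exact ⟨a, b, c, h₁, h₂, h₃, h₄, h₅, h₆, by simp only [smul_add, sl_smul_smul]⟩
  · rintro ⟨a, b, c, h₁, h₂, h₃, h₄, h₅, h₆, rfl⟩
    exact ⟨_, ⟨a, b, c, h₁, h₂, h₃, h₄, h₅, h₆, rfl⟩, by simp only [smul_add, sl_smul_smul]⟩

theorem projCone_sdiff_vertices {e : Fin 3 → V3} (he : LinearIndependent ℝ e) :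
    projCone e \ Set.range (fun i => toP (e i)) = toP '' pointedCone (e 0) (e 1) (e 2) := by
  ext x
  constructor
  · rintro ⟨hx, hxe⟩
    obtain ⟨a, ha, h0, rfl⟩ := mem_projCone.1 hx
    have key : ∀ i, 0 < a i + a (i + 1) := fun i => by
      by_contra hle
      have h1 : a i = 0 := by have := ha i; have := ha (i + 1); linarith
      have h2 : a (i + 1) = 0 := by have := ha i; have := ha (i + 1); linarith
      have hs := fin3_sum i fun j => a j • e j
      rw [h1, h2, zero_smul, zero_smul, zero_add, zero_add] at hs
      refine hxe ⟨i + 2, ?_⟩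
      rw [hs] at h0 ⊢
      have h3 : a (i + 2) ≠ 0 := by rintro h; simp [h] at h0
      exact (toP_smul h3 _).symm
    exact ⟨_, ⟨a 0, a 1, a 2, ha _, ha _, ha _, key 0, key 1, key 2, rfl⟩,
      by rw [Fin.sum_univ_three]⟩
  · rintro ⟨v, ⟨a, b, c, h₁, h₂, h₃, h₄, h₅, h₆, rfl⟩, rfl⟩
    have hs : a • e 0 + b • e 1 + c • e 2 = ∑ j, ![a, b, c] j • e j := by
      rw [Fin.sum_univ_three]; rfl
    have hpos : ∀ i, 0 < ![a, b, c] i + ![a, b, c] (i + 1) := by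
      intro i; fin_cases i <;> assumption
    have hnn : ∀ i, 0 ≤ ![a, b, c] i := by
      intro i; fin_cases i <;> assumption
    rw [hs]
    constructor
    · obtain ⟨i, hi⟩ : ∃ i, ![a, b, c] i ≠ 0 := by
        by_contra hall
        push Not at hall
        have := hpos 0
        rw [hall, hall, add_zero] at this
        exact lt_irrefl _ this
      exact mem_projCone.2 ⟨_, hnn, sum_ne_zero he hi, rfl⟩
    · rintro ⟨j, hj⟩
      have h1 : j + 1 ≠ j := by fin_cases j <;> decide
      have h2 : j + 2 ≠ j := by fin_cases j <;> decide
      by_cases h : ![a, b, c] (j + 1) = 0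
      · have := hpos (j + 1)
        rw [h, zero_add, fin3_add_one_add_one] at this
        exact toP_sum_eq_vertex he h2 this.ne' hj.symm
      · exact toP_sum_eq_vertex he h1 h hj.symm

namespace ConvexTiling

variable {E : Type*} (t : ConvexTiling E)

theorem cone_eq_pointedCone (e : E) :
    t.cone e = pointedCone (t.vtx e) (t.vtx (t.rot (t.rot e))) (t.vtx (t.rot e)) := by
  have hD := t.det_pos e
  set D := det3 (t.vtx e) (t.vtx (t.rot (t.rot e))) (t.vtx (t.rot e)) with hDdef
  ext v
  constructor
  · rintro ⟨h₁, h₂, h₃, h₄, h₅, h₆⟩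
    refine ⟨D⁻¹ * t.side (t.rot (t.rot e)) v, D⁻¹ * t.side (t.rot e) v, D⁻¹ * t.side e v,
      by positivity, by positivity, by positivity, ?_, ?_, ?_, ?_⟩
    · rw [← mul_add, add_comm]; positivity
    · rw [← mul_add, add_comm]; positivity
    · rw [← mul_add, add_comm]; positivity
    · rw [mul_smul, mul_smul, mul_smul, ← smul_add, ← smul_add]
      have := det3_cramer (t.vtx e) (t.vtx (t.rot (t.rot e))) (t.vtx (t.rot e)) v
      simp only [side, t.rot_rot_rot]
      rw [← this, smul_smul, inv_mul_cancel₀ hD.ne', one_smul]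
  · rintro ⟨a, b, c, h₁, h₂, h₃, h₄, h₅, h₆, rfl⟩
    have e₁ : t.side e (a • t.vtx e + b • t.vtx (t.rot (t.rot e)) + c • t.vtx (t.rot e)) =
        D * c := by simp [side, hDdef, det3]; ring
    have e₂ : t.side (t.rot e) (a • t.vtx e + b • t.vtx (t.rot (t.rot e)) + c • t.vtx (t.rot e)) =
        D * b := by simp [side, hDdef, det3, t.rot_rot_rot]; ring
    have e₃ : t.side (t.rot (t.rot e))
        (a • t.vtx e + b • t.vtx (t.rot (t.rot e)) + c • t.vtx (t.rot e)) =
        D * a := by simp [side, hDdef, det3, t.rot_rot_rot]; ring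
    simp only [cone, Set.mem_ofPred_eq, e₁, e₂, e₃, ← mul_add]
    refine ⟨by positivity, by positivity, by positivity, ?_, ?_, ?_⟩
    · rw [add_comm]; positivity
    · rw [add_comm]; positivity
    · rw [add_comm]; positivity

end ConvexTiling

/-! ### The tiling of a gluing -/

variable {γ : Fin 3 → SL3} {P Q : Fin 3 → V3}

/-- The generators, as elements of the group they generate. -/
def gen (γ : Fin 3 → SL3) (i : Fin 3) : holGroup γ := ⟨γ i, Subgroup.subset_closure ⟨i, rfl⟩⟩

theorem gen_prod (hγ : γ 2 * γ 1 * γ 0 = 1) (i : Fin 3) :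
    gen γ (i + 1) * gen γ i * gen γ (i + 2) = 1 := by
  have h : gen γ 2 * gen γ 1 * gen γ 0 = 1 := Subtype.ext hγ
  fin_cases i
  · change gen γ 1 * gen γ 0 * gen γ 2 = 1
    rw [mul_assoc] at h
    exact mul_eq_one_iff_eq_inv.2 (eq_inv_of_mul_eq_one_right h)
  · exact h
  · change gen γ 0 * gen γ 2 * gen γ 1 = 1
    have := eq_inv_of_mul_eq_one_right h
    rw [this]; group

theorem gen_inv_mul_inv (hγ : γ 2 * γ 1 * γ 0 = 1) (i : Fin 3) :
    (gen γ (i + 2))⁻¹ * (gen γ i)⁻¹ = gen γ (i + 1) := by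
  have := gen_prod hγ i
  rw [mul_assoc] at this
  rw [← mul_inv_rev, eq_comm]
  exact eq_inv_of_mul_eq_one_left this

/-- Multiplication is on the right because the tiles around those labelled `g` carry labels `g`
times a generator or its inverse. -/
theorem holGroup_induction {S : Set (holGroup γ)} {g₀ : holGroup γ} (h₀ : g₀ ∈ S)
    (hS : ∀ g ∈ S, ∀ i, g * gen γ i ∈ S ∧ g * (gen γ i)⁻¹ ∈ S) (g : holGroup γ) : g ∈ S := by
  suffices ∀ x (hx : x ∈ holGroup γ), g₀ * ⟨x, hx⟩ ∈ S by
    have := this (g₀⁻¹ * g) (g₀⁻¹ * g).2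
    have e : g₀ * (g₀⁻¹ * g) = g := by group
    rw [← e]
    exact this
  intro x hx
  refine Subgroup.closure_induction_right (p := fun x hx => g₀ * ⟨x, hx⟩ ∈ S) ?_ ?_ ?_ hx
  · convert! h₀; exact mul_one g₀
  · rintro x hx y ⟨i, rfl⟩ h
    have := (hS _ h i).1
    rwa [mul_assoc] at this
  · rintro x hx y ⟨i, rfl⟩ h
    have := (hS _ h i).2
    rwa [mul_assoc] at this

/-- The oriented edges of the tiling: `(g, i, true)` enters `g T₀` through its edge opposite to
`g p i`, and `(g, i, false)` is the same edge with the opposite orientation. -/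
abbrev TileEdge (γ : Fin 3 → SL3) : Type := holGroup γ × Fin 3 × Bool

theorem HexagonLift.det_cyclic (h : HexagonLift γ P Q) (i : Fin 3) :
    0 < det3 (P i) (P (i + 1)) (P (i + 2)) := by
  rw [det3_cyclic]; exact h.det_pos

theorem HexagonLift.inv_smul_P (h : HexagonLift γ P Q) (i : Fin 3) :
    ∃ l : ℝ, 0 < l ∧ (γ (i + 2))⁻¹ • P i = l • Q i := by
  obtain ⟨l, hl, hl'⟩ := h.map_outer (i + 2)
  rw [fin3_add_two_add_one] at hl'
  refine ⟨l⁻¹, inv_pos.2 hl, ?_⟩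
  rw [inv_smul_eq_iff, sl_smul_smul, hl', smul_smul, inv_mul_cancel₀ hl.ne', one_smul]

namespace HexagonLift

variable (h : HexagonLift γ P Q)

/-- The reversal of the edges. -/
def rev (e : TileEdge γ) : TileEdge γ := (e.1, e.2.1, !e.2.2)

/-- The rotation of the edges of a triangle. -/
def rot : TileEdge γ → TileEdge γ
  | (g, i, true) => (g, i + 2, true)
  -- As `γ (i + 2)` sends `T i` to `T (i + 1)`, the tile `g T i` is also the translate of `T (i +
  -- 1)` by `g * γ (i + 2)⁻¹`; rotating inside an outer tile changes its label in this way.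
  | (g, i, false) => (g * (gen γ (i + 2))⁻¹, i + 1, false)

/-- The index of the origin of an edge. -/
def origin : TileEdge γ → Fin 3
  | (_, i, true) => i + 1
  | (_, i, false) => i + 2

/-- The origin of an edge. -/
def vertex (P : Fin 3 → V3) (e : TileEdge γ) : V3 := (e.1 : SL3) • P (origin e)

/-- The relation between the generators is what makes the three labels of an outer tile close up
after three rotations. -/
theorem rot_rot_false (hγ : γ 2 * γ 1 * γ 0 = 1) (g : holGroup γ) (i : Fin 3) :
    rot (rot (g, i, false)) = (g * gen γ (i + 1), i + 2, false) := by
  simp only [rot, fin3_add_one_add_two, fin3_add_one_add_one, mul_assoc, gen_inv_mul_inv hγ]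

/-- A supporting linear form at `P i`. -/
def suppForm (h : HexagonLift γ P Q) (i : Fin 3) : V3 →ₗ[ℝ] ℝ := (h.support i).choose

theorem suppForm_spec (h : HexagonLift γ P Q) (i : Fin 3) :
    h.suppForm i (P i) = 0 ∧ 0 < h.suppForm i (P (i + 1)) ∧ 0 < h.suppForm i (P (i + 2)) ∧
    ∃ μ : ℝ, 0 < μ ∧ ∀ v, h.suppForm i (γ i • v) = μ * h.suppForm i v :=
  (h.support i).choose_spec

/-- The tiling of `Ω`. -/
def tiling : ConvexTiling (TileEdge γ) where
  rev := rev
  rot := rot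
  vtx := vertex P
  supp e := h.suppForm (origin e) ∘ₗ actₗ (e.1 : SL3)⁻¹
  rev_rev e := by simp [rev]
  rot_rot_rot := by
    rintro ⟨g, i, _ | _⟩
    · rw [rot_rot_false h.prod_eq_one]
      simp [rot, fin3_add_two_add_two, fin3_add_two_add_one]
    · simp only [rot, fin3_add_two_add_two, fin3_add_one_add_two]
  vtx_rev := by
    rintro ⟨g, i, _ | _⟩
    · obtain ⟨l, hl, hl'⟩ := h.fixed (i + 1)
      refine ⟨l⁻¹, inv_pos.2 hl, ?_⟩
      rw [rot_rot_false h.prod_eq_one]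
      change (g : SL3) • P (i + 1) = l⁻¹ • ((g : SL3) * γ (i + 1)) • P (i + 2 + 2)
      rw [fin3_add_two_add_two, mul_smul, hl', sl_smul_smul, smul_smul, inv_mul_cancel₀ hl.ne',
        one_smul]
    · refine ⟨1, one_pos, ?_⟩
      rw [one_smul]
      simp only [vertex, rev, rot, origin, fin3_add_two_add_two, fin3_add_one_add_one, Bool.not_true]
  det_pos := by
    rintro ⟨g, i, _ | _⟩
    · rw [rot_rot_false h.prod_eq_one]
      obtain ⟨l, hl, hl'⟩ := h.fixed (i + 1)
      obtain ⟨k, hk, hk'⟩ := h.inv_smul_P i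
      change 0 < det3 ((g : SL3) • P (i + 2)) (((g : SL3) * γ (i + 1)) • P (i + 2 + 2))
        (((g : SL3) * (γ (i + 2))⁻¹) • P (i + 1 + 2))
      rw [fin3_add_two_add_two, fin3_add_one_add_two, mul_smul, mul_smul, det3_sl_smul, hl', hk',
        det3_smul_mid, det3_smul_right]
      obtain ⟨x, y, z, hx, hy, hz, hQ⟩ := h.outer i
      have : det3 (P (i + 2)) (P (i + 1)) (Q i) = x * det3 (P i) (P (i + 1)) (P (i + 2)) := by
        rw [hQ]; simp [det3]; ring
      rw [this]
      have := h.det_cyclic i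
      positivity
    · change 0 < det3 ((g : SL3) • P (i + 1)) ((g : SL3) • P (i + 2 + 2 + 1))
        ((g : SL3) • P (i + 2 + 1))
      rw [fin3_add_two_add_two, fin3_add_two_add_one, fin3_add_one_add_one, det3_sl_smul,
        ← det3_rotate]
      exact h.det_cyclic i
  supp_vtx e := by
    have := (h.suppForm_spec (origin e)).1
    simp [vertex, actₗ_apply, this]
  supp_pos := by
    rintro ⟨g, i, _ | _⟩
    · have := (h.suppForm_spec (i + 2)).2.2.1
      obtain ⟨l, hl, hl'⟩ := h.fixed (i + 1)
      rw [rot_rot_false h.prod_eq_one]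
      change 0 < h.suppForm (i + 2) ((g : SL3)⁻¹ • ((g : SL3) * γ (i + 1)) • P (i + 2 + 2))
      rw [fin3_add_two_add_two] at this ⊢
      rw [mul_smul, inv_smul_smul, hl', map_smul, smul_eq_mul]
      positivity
    · have := (h.suppForm_spec (i + 1)).2.1
      change 0 < h.suppForm (i + 1) ((g : SL3)⁻¹ • (g : SL3) • P (i + 2 + 2 + 1))
      rw [inv_smul_smul, fin3_add_two_add_two]
      exact this
  supp_rev_rot := by
    rintro ⟨g, i, _ | _⟩
    · obtain ⟨μ, hμ, hη⟩ := (h.suppForm_spec (i + 2)).2.2.2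
      refine ⟨μ, hμ, LinearMap.ext fun v => ?_⟩
      change h.suppForm (i + 1 + 1) (((g : SL3) * (γ (i + 2))⁻¹)⁻¹ • v) =
        μ * h.suppForm (i + 2) ((g : SL3)⁻¹ • v)
      rw [← hη, mul_inv_rev, inv_inv, mul_smul]
      simp only [fin3_add_one_add_one]
    · refine ⟨1, one_pos, ?_⟩
      rw [one_smul]
      simp only [rev, rot, origin, fin3_add_two_add_two, Bool.not_true]
  -- All labels with the same group element are linked through the tile `g T₀`; rotating in the
  -- outer tiles then links `g` to `g` times any generator or its inverse.
  connected S hS hrev hrot := by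
    obtain ⟨⟨g₀, i₀, b₀⟩, h₀⟩ := hS
    have hin : ∀ g i b, (g, i, b) ∈ S → ∀ j b', (g, j, b') ∈ S := by
      intro g i b hi
      have hi' : (g, i, true) ∈ S := by
        cases b
        · exact hrev _ hi
        · exact hi
      have hall : ∀ j, (g, j, true) ∈ S := fun j => by
        have h2 := hrot _ hi'
        have h3 := hrot _ h2
        simp only [rot, fin3_add_two_add_two] at h2 h3
        rcases fin3_cases i j with rfl | rfl | rfl <;> assumption
      rintro j (_ | _)
      · exact hrev _ (hall j)
      · exact hall j
    rintro ⟨g, i, b⟩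
    refine hin g 0 true ?_ i b
    refine holGroup_induction (S := {g | (g, (0 : Fin 3), true) ∈ S}) (hin _ _ _ h₀ 0 true) ?_ g
    intro g hg k
    constructor
    · have h2 := hrot _ (hrot _ (hin _ _ _ hg (k + 2) false))
      rw [rot_rot_false h.prod_eq_one, fin3_add_two_add_one] at h2
      exact hin _ _ _ h2 0 true
    · have h2 := hrot _ (hin _ _ _ hg (k + 1) false)
      simp only [rot, fin3_add_one_add_two] at h2
      exact hin _ _ _ h2 0 true

/-- The action of the group on the edges. -/
def translate (g : holGroup γ) (e : TileEdge γ) : TileEdge γ := (g * e.1, e.2)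

theorem rot_translate (g : holGroup γ) (e : TileEdge γ) :
    rot (translate g e) = translate g (rot e) := by
  obtain ⟨k, i, _ | _⟩ := e
  · simp [rot, translate, mul_assoc]
  · rfl

theorem vertex_translate (g : holGroup γ) (e : TileEdge γ) :
    vertex P (translate g e) = (g : SL3) • vertex P e := by
  obtain ⟨k, i, _ | _⟩ := e <;> exact mul_smul (g : SL3) (k : SL3) _

theorem side_translate (g : holGroup γ) (e : TileEdge γ) (v : V3) :
    h.tiling.side (translate g e) ((g : SL3) • v) = h.tiling.side e v := by
  change det3 (vertex P (translate g e)) (vertex P (rot (rot (translate g e)))) _ = _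
  rw [rot_translate, rot_translate, vertex_translate, vertex_translate, det3_sl_smul]
  rfl

theorem smul_mem_cone_translate (g : holGroup γ) (e : TileEdge γ) {v : V3} :
    (g : SL3) • v ∈ h.tiling.cone (translate g e) ↔ v ∈ h.tiling.cone e := by
  have hr : h.tiling.rot (translate g e) = translate g (h.tiling.rot e) := rot_translate g e
  have hr2 : h.tiling.rot (translate g (h.tiling.rot e)) =
    translate g (h.tiling.rot (h.tiling.rot e)) := rot_translate g _
  simp only [ConvexTiling.cone, Set.mem_ofPred_eq, hr, hr2, side_translate]

theorem smul_mem_dom_iff {g : SL3} (hg : g ∈ holGroup γ) {v : V3} :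
    g • v ∈ h.tiling.dom ↔ v ∈ h.tiling.dom := by
  have key : ∀ (g : holGroup γ) v, v ∈ h.tiling.dom → (g : SL3) • v ∈ h.tiling.dom := by
    intro g v hv
    obtain ⟨e, he⟩ := Set.mem_iUnion.1 hv
    exact Set.mem_iUnion.2 ⟨translate g e, (h.smul_mem_cone_translate g e).2 he⟩
  refine ⟨fun hv => ?_, key ⟨g, hg⟩ v⟩
  have := key (⟨g, hg⟩⁻¹) _ hv
  simpa using this

theorem cone_true (g : holGroup γ) (i : Fin 3) :
    h.tiling.cone (g, i, true) = (g : SL3) • pointedCone (P 0) (P 1) (P 2) := by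
  have : pointedCone (P (i + 1)) (P (i + 2)) (P i) = pointedCone (P 0) (P 1) (P 2) := by
    fin_cases i
    · exact (pointedCone_rotate _ _ _).symm
    · exact pointedCone_rotate _ _ _
    · rfl
  rw [ConvexTiling.cone_eq_pointedCone, ← this, smul_pointedCone]
  change pointedCone ((g : SL3) • P (i + 1)) ((g : SL3) • P (i + 2 + 2 + 1))
    ((g : SL3) • P (i + 2 + 1)) = _
  rw [fin3_add_two_add_two, fin3_add_two_add_one, fin3_add_one_add_one]

theorem cone_false (g : holGroup γ) (i : Fin 3) :
    h.tiling.cone (g, i, false) = (g : SL3) • pointedCone (Q i) (P (i + 1)) (P (i + 2)) := by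
  obtain ⟨l, hl, hl'⟩ := h.fixed (i + 1)
  obtain ⟨k, hk, hk'⟩ := h.inv_smul_P i
  rw [ConvexTiling.cone_eq_pointedCone, smul_pointedCone]
  change pointedCone ((g : SL3) • P (i + 2)) (vertex P (rot (rot (g, i, false))))
    (((g : SL3) * (γ (i + 2))⁻¹) • P (i + 1 + 2)) = _
  rw [rot_rot_false h.prod_eq_one]
  change pointedCone ((g : SL3) • P (i + 2)) (((g : SL3) * γ (i + 1)) • P (i + 2 + 2))
    (((g : SL3) * (γ (i + 2))⁻¹) • P (i + 1 + 2)) = _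
  rw [fin3_add_two_add_two, fin3_add_one_add_two, mul_smul, mul_smul, hl', hk', sl_smul_smul,
    sl_smul_smul, pointedCone_swap, pointedCone_smul _ _ _ hl, pointedCone_rotate,
    pointedCone_rotate, pointedCone_smul _ _ _ hk]

theorem linearIndependent (h : HexagonLift γ P Q) : LinearIndependent ℝ P :=
  det3_ne_zero_iff.1 h.det_pos.ne'

theorem linearIndependent_update (h : HexagonLift γ P Q) (i : Fin 3) :
    LinearIndependent ℝ (Function.update P i (Q i)) := by
  obtain ⟨x, y, z, hx, -, -, hQ⟩ := h.outer i
  refine det3_ne_zero_iff.1 ?_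
  rw [det3_update (x := -x) (y := y) (z := z) (by rw [hQ]; module)]
  exact mul_ne_zero (by linarith) h.det_pos.ne'

/-- The tiled set is the image of the domain of the tiling. -/
theorem tiledSet_eq {T₀ : Set P2} {T : Fin 3 → Set P2}
    (hT₀ : T₀ = projCone P \ Set.range (fun i => toP (P i)))
    (hT : ∀ i, T i = projCone (Function.update P i (Q i)) \
        Set.range fun j => toP (Function.update P i (Q i) j)) :
    tiledSet T₀ T γ = toP '' h.tiling.dom := by
  have e₀ : T₀ = toP '' h.tiling.cone (1, 0, true) := by
    rw [hT₀, projCone_sdiff_vertices h.linearIndependent, cone_true]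
    simp
  have e₁ : ∀ i, T i = toP '' h.tiling.cone (1, i, false) := fun i => by
    rw [hT i, projCone_sdiff_vertices (h.linearIndependent_update i), cone_false]
    have : pointedCone (Function.update P i (Q i) 0) (Function.update P i (Q i) 1)
        (Function.update P i (Q i) 2) = pointedCone (Q i) (P (i + 1)) (P (i + 2)) := by
      fin_cases i
      · rfl
      · exact pointedCone_rotate _ _ _
      · exact (pointedCone_rotate _ _ _).symm
    rw [this]
    simp
  have hg : ∀ (g : holGroup γ) e, (g : SL3) • toP '' h.tiling.cone e =
      toP '' h.tiling.cone (translate g e) := fun g e => by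
    ext x
    constructor
    · rintro ⟨_, ⟨v, hv, rfl⟩, rfl⟩
      have hv0 : v ≠ 0 := by rintro rfl; exact h.tiling.zero_notMem_cone e hv
      exact ⟨_, (h.smul_mem_cone_translate g e).2 hv, (smul_toP _ hv0).symm⟩
    · rintro ⟨v, hv, rfl⟩
      have hv0 : v ≠ 0 := by rintro rfl; exact h.tiling.zero_notMem_cone _ hv
      refine ⟨toP ((g : SL3)⁻¹ • v), ⟨_, ?_, rfl⟩, ?_⟩
      · rw [← h.smul_mem_cone_translate g, smul_inv_smul]; exact hv
      · change (g : SL3) • _ = _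
        rw [smul_toP _ ((smul_ne_zero_iff' _).2 hv0), smul_inv_smul]
  ext x
  simp only [tiledSet, Set.mem_iUnion]
  constructor
  · rintro ⟨g, hgG, hx⟩
    rw [Set.smul_set_union, Set.smul_set_iUnion] at hx
    rcases hx with hx | hx
    · rw [e₀, hg ⟨g, hgG⟩] at hx
      exact Set.image_mono (Set.subset_iUnion _ _) hx
    · obtain ⟨i, hx⟩ := Set.mem_iUnion.1 hx
      rw [e₁, hg ⟨g, hgG⟩] at hx
      exact Set.image_mono (Set.subset_iUnion _ _) hx
  · rintro ⟨v, hv, rfl⟩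
    obtain ⟨⟨g, i, b⟩, he⟩ := Set.mem_iUnion.1 hv
    refine ⟨g, g.2, ?_⟩
    rw [Set.smul_set_union, Set.smul_set_iUnion]
    cases b with
    | true =>
      left
      rw [e₀, hg]
      refine ⟨v, ?_, rfl⟩
      rw [cone_true] at he
      simp only [translate, cone_true, mul_one]
      exact he
    | false =>
      right
      refine Set.mem_iUnion.2 ⟨i, ?_⟩
      rw [e₁, hg]
      exact ⟨v, by simpa [translate] using he, rfl⟩

end HexagonLift

end

/-! ### The domain in the projective plane and the action of the group -/

section

namespace ConvexTiling

variable {E : Type*} (t : ConvexTiling E)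

theorem ne_zero_of_mem_dom {v : V3} (hv : v ∈ t.dom) : v ≠ 0 := by
  rintro rfl; exact t.zero_notMem_dom hv

theorem toP_mem_image {S : Set V3} (hS : ∀ c : ℝ, 0 < c → ∀ v ∈ S, c • v ∈ S) (h0 : (0 : V3) ∉ S)
    {v : V3} (hv : v ≠ 0) : toP v ∈ toP '' S ↔ v ∈ S ∨ -v ∈ S := by
  constructor
  · rintro ⟨w, hw, h⟩
    obtain ⟨c, hc, rfl⟩ := (toP_eq_iff hv (by rintro rfl; exact h0 hw)).1 h.symm
    rcases hc.lt_or_gt with hc | hc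
    · right; rw [← neg_smul]; exact hS _ (by linarith) _ hw
    · exact Or.inl (hS _ hc _ hw)
  · rintro (h | h)
    · exact ⟨v, h, rfl⟩
    · exact ⟨-v, h, by rw [← neg_one_smul ℝ, toP_smul (by norm_num)]⟩

theorem isOpen_toP_image {S : Set V3} (hS : ∀ c : ℝ, 0 < c → ∀ v ∈ S, c • v ∈ S)
    (h0 : (0 : V3) ∉ S) (ho : IsOpen S) : IsOpen (toP '' S) := by
  rw [isOpen_P2_iff]
  have : {v : V3 | v ≠ 0 ∧ toP v ∈ toP '' S} = S ∪ Neg.neg ⁻¹' S := by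
    ext v
    constructor
    · rintro ⟨hv, h⟩
      exact (toP_mem_image hS h0 hv).1 h
    · rintro h
      have hv : v ≠ 0 := by
        rintro rfl
        rcases h with h | h
        · exact h0 h
        · exact h0 (by simpa using h)
      exact ⟨hv, (toP_mem_image hS h0 hv).2 h⟩
  rw [this]
  exact ho.union (ho.preimage continuous_neg)

theorem isOpen_image_dom : IsOpen (toP '' t.dom) :=
  isOpen_toP_image (fun _ hc _ hv => t.smul_mem_dom hc hv) t.zero_notMem_dom t.isOpen_dom

/-- A section by a line is the continuous image of the convex cone `dom` cut by a linear plane. -/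
theorem isConvexSet_image_dom : IsConvexSet (toP '' t.dom) := by
  intro f _
  have : toP '' t.dom ∩ projLine f = toP '' (t.dom ∩ {v | f v = 0}) := by
    ext x
    constructor
    · rintro ⟨⟨v, hv, rfl⟩, h⟩
      exact ⟨v, ⟨hv, (mem_projLine_toP (t.ne_zero_of_mem_dom hv)).1 h⟩, rfl⟩
    · rintro ⟨v, ⟨hv, h⟩, rfl⟩
      exact ⟨⟨v, hv, rfl⟩, (mem_projLine_toP (t.ne_zero_of_mem_dom hv)).2 h⟩
  rw [this]
  refine IsPreconnected.image ?_ _ (continuousOn_toP.mono fun v hv => t.ne_zero_of_mem_dom hv.1)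
  refine (t.convex_dom.inter ?_).isPreconnected
  exact (LinearMap.ker f).convex

theorem star_smul {e : E} {c : ℝ} (hc : 0 < c) {v : V3} (hv : v ∈ t.star e) :
    c • v ∈ t.star e := by
  obtain ⟨h₁, h₂, h₃, h₄⟩ := hv
  refine ⟨?_, ?_, ?_, ?_⟩ <;> rw [side_smul] <;> positivity

theorem zero_notMem_star (e : E) : (0 : V3) ∉ t.star e := fun h => by
  rcases t.star_subset e h with h | h
  · exact t.zero_notMem_cone _ h
  · exact t.zero_notMem_cone _ h

theorem star_subset_dom (e : E) : t.star e ⊆ t.dom :=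
  (t.star_subset e).trans (Set.union_subset (Set.subset_iUnion _ _) (Set.subset_iUnion _ _))

theorem exists_mem_star_of_mem_dom {v : V3} (hv : v ∈ t.dom) : ∃ e, v ∈ t.star e := by
  obtain ⟨e, he⟩ := Set.mem_iUnion.1 hv
  obtain ⟨i, -, hi⟩ := t.exists_mem_star he
  exact ⟨i, hi⟩

theorem isOpen_image_star (e : E) : IsOpen (toP '' t.star e) :=
  isOpen_toP_image (fun _ hc _ hv => t.star_smul hc hv) (t.zero_notMem_star e) (t.isOpen_star e)

/-- A point on the left of `s` is in a triangle beyond `s`. -/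
theorem exists_beyond_of_side_pos {s : E} {v : V3} (hv : v ∈ t.dom) (h : 0 < t.side s v) :
    ∃ d, t.Beyond s d ∧ v ∈ t.cone d := by
  obtain ⟨e, he⟩ := Set.mem_iUnion.1 hv
  rcases t.tile_cases s e with hs | ⟨i, hi, d, hd, hde⟩
  · exact ⟨s, t.beyond_refl s, by rwa [SameTile.cone_eq t hs] at he⟩
  · rw [SameTile.cone_eq t hde] at he
    rcases hi with rfl | rfl | rfl
    · have := t.side_nonneg_of_beyond hd he
      rw [side_rev_nonneg] at this
      linarith
    · exact ⟨d, ((t.beyond_refl s).left).trans t hd, he⟩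
    · exact ⟨d, ((t.beyond_refl s).right).trans t hd, he⟩

/-- The part of the domain to the left of `s` is tiled by triangles beyond `s`, all of them beyond
`rev s'`. This gives the disjointness required by ping-pong. -/
theorem side_nonpos_of_side_pos {s s' : E} (hs : t.Beyond (t.rev s') s) {v : V3} (hv : v ∈ t.dom)
    (h : 0 < t.side s v) : t.side s' v ≤ 0 := by
  obtain ⟨d, hd, hvd⟩ := t.exists_beyond_of_side_pos hv h
  rw [← side_rev_nonneg]
  exact t.side_nonneg_of_beyond (hs.trans t hd) hvd

/-- The line of an edge does not enter the interior of a tile, since each tile is entirely on one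
side of it. -/
theorem side_ne_zero {e e' : E} {v : V3} (hv : ∀ i, t.SameTile e' i → 0 < t.side i v) :
    t.side e v ≠ 0 := by
  have hve' : v ∈ t.cone e' := by
    have h₁ := hv _ (t.sameTile_refl e')
    have h₂ := hv _ (t.sameTile_rot e')
    have h₃ := hv _ (t.sameTile_rot_rot e')
    exact ⟨h₁.le, h₂.le, h₃.le, by linarith, by linarith, by linarith⟩
  rcases t.tile_cases e e' with hs | ⟨i, hi, d, hd, hde⟩
  · exact (hv e (SameTile.symm t hs)).ne'
  · rw [SameTile.cone_eq t hde] at hve'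
    rcases hi with rfl | rfl | rfl
    · have : 0 < t.side (t.rev i) v := by
        rcases eq_or_ne d (t.rev i) with rfl | hne
        · exact hv _ (SameTile.symm t hde)
        · exact t.side_pos_of_beyond hd hne hve'
      rw [side_rev_pos] at this
      exact this.ne
    · exact (t.side_pos_of_beyond_left hd hve').ne'
    · exact (t.side_pos_of_beyond_right hd hve').ne'

end ConvexTiling

variable {γ : Fin 3 → SL3} {P Q : Fin 3 → V3}

namespace HexagonLift

/-- The tiled domain in the projective plane. -/
def Omega (h : HexagonLift γ P Q) : Set P2 := toP '' h.tiling.dom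

theorem isOpen_Omega (h : HexagonLift γ P Q) : IsOpen h.Omega := h.tiling.isOpen_image_dom

theorem supp_pos (h : HexagonLift γ P Q) {v : V3} (hv : v ∈ h.tiling.dom) (i : Fin 3) :
    0 < h.suppForm i v := by
  have := h.tiling.supp_pos_of_mem_dom (1, i + 2, true) hv
  change 0 < h.suppForm (i + 2 + 1) ((1 : SL3)⁻¹ • v) at this
  rwa [fin3_add_two_add_one, inv_one, one_smul] at this

/-- The form at `P i` has only two coefficients in the basis `P`, both positive. Its vanishing makes
the coordinates `i + 1` and `i + 2` either zero or of opposite signs, and signs cannot alternate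
around a cycle of length three. -/
theorem eq_zero_of_suppForm (h : HexagonLift γ P Q) {v : V3} (hv : ∀ i, h.suppForm i v = 0) :
    v = 0 := by
  obtain ⟨a, rfl⟩ := exists_sum_eq h.linearIndependent v
  have key : ∀ i, a (i + 1) * h.suppForm i (P (i + 1)) +
      a (i + 2) * h.suppForm i (P (i + 2)) = 0 := fun i => by
    have := hv i
    rw [fin3_sum i] at this
    simpa [(h.suppForm_spec i).1] using this
  have sgn : ∀ i, 0 < a (i + 1) → a (i + 2) < 0 := fun i hi => by
    have h1 := (h.suppForm_spec i).2.1
    have h2 := (h.suppForm_spec i).2.2.1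
    have h3 := key i
    by_contra hn
    have := mul_pos hi h1
    have := mul_nonneg (not_lt.1 hn) h2.le
    linarith
  have sgn' : ∀ i, a (i + 1) < 0 → 0 < a (i + 2) := fun i hi => by
    have h1 := (h.suppForm_spec i).2.1
    have h2 := (h.suppForm_spec i).2.2.1
    have h3 := key i
    by_contra hn
    have := mul_neg_of_neg_of_pos hi h1
    have := mul_nonpos_of_nonpos_of_nonneg (not_lt.1 hn) h2.le
    linarith
  have h01 := sgn 2
  have h12 := sgn 0
  have h20 := sgn 1
  have h01' := sgn' 2
  have h12' := sgn' 0
  have h20' := sgn' 1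
  simp only [Fin.isValue, Fin.reduceAdd] at h01 h12 h20 h01' h12' h20'
  have hz : ∀ i, a i = 0 := by
    intro i
    by_contra hne
    fin_cases i <;> rcases lt_or_gt_of_ne hne with h' | h'
    · exact lt_asymm h' (h20' (h12 (h01' h')))
    · exact lt_asymm h' (h20 (h12' (h01 h')))
    · exact lt_asymm h' (h01' (h20 (h12' h')))
    · exact lt_asymm h' (h01 (h20' (h12 h')))
    · exact lt_asymm h' (h12' (h01 (h20' h')))
    · exact lt_asymm h' (h12 (h01' (h20 h')))
  simp [hz]

/-- The line avoided by the closure is the zero set of the sum of the three supporting forms. On a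
representative of a point of the closure the three forms have the same weak sign, so a zero of the
sum is a common zero. -/
theorem isProperlyConvex_Omega (h : HexagonLift γ P Q) : IsProperlyConvex h.Omega := by
  refine ⟨h.tiling.isConvexSet_image_dom, ∑ i, h.suppForm i, ?_, ?_⟩
  · intro h0
    have hv : P 0 + P 1 + P 2 ∈ h.tiling.dom := by
      refine Set.mem_iUnion.2 ⟨(1, 0, true), ?_⟩
      rw [cone_true]
      simp only [OneMemClass.coe_one, one_smul]
      exact ⟨1, 1, 1, by norm_num, by norm_num, by norm_num, by norm_num, by norm_num,
        by norm_num, by simp⟩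
    have := congrArg (fun f : V3 →ₗ[ℝ] ℝ => f (P 0 + P 1 + P 2)) h0
    simp only [LinearMap.sum_apply, LinearMap.zero_apply] at this
    exact (Finset.sum_pos (fun i _ => h.supp_pos hv i) Finset.univ_nonempty).ne' this
  · set B : Set V3 := {v | ∀ i, 0 ≤ h.suppForm i v} ∪ {v | ∀ i, h.suppForm i v ≤ 0} with hB
    have hcont : ∀ i, Continuous (h.suppForm i) := fun i =>
      (h.suppForm i).continuous_of_finiteDimensional
    have hBc : IsClosed B := by
      refine IsClosed.union ?_ ?_
      · simp only [Set.ofPred_forall]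
        exact isClosed_iInter fun i => isClosed_le continuous_const (hcont i)
      · simp only [Set.ofPred_forall]
        exact isClosed_iInter fun i => isClosed_le (hcont i) continuous_const
    have hBs : ∀ c : ℝ, ∀ v ∈ B, c • v ∈ B := by
      rintro c v (hv | hv) <;> rcases le_total 0 c with hc | hc
      · exact Or.inl fun i => by rw [map_smul]; exact mul_nonneg hc (hv i)
      · exact Or.inr fun i => by rw [map_smul]; exact mul_nonpos_of_nonpos_of_nonneg hc (hv i)
      · exact Or.inr fun i => by rw [map_smul]; exact mul_nonpos_of_nonneg_of_nonpos hc (hv i)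
      · exact Or.inl fun i => by rw [map_smul]; exact mul_nonneg_of_nonpos_of_nonpos hc (hv i)
    have hA : IsClosed {x : P2 | x.rep ∈ B} := by
      refine isClosed_P2 hBc fun v hv => ?_
      obtain ⟨c, hc, hcv⟩ := (toP_eq_iff (toP v).rep_nonzero hv).1 (toP_rep (toP v))
      change (toP v).rep ∈ B ↔ _
      rw [hcv]
      refine ⟨fun h => ?_, hBs c v⟩
      have := hBs c⁻¹ _ h
      rwa [smul_smul, inv_mul_cancel₀ hc, one_smul] at this
    have hsub : h.Omega ⊆ {x : P2 | x.rep ∈ B} := by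
      rintro _ ⟨v, hv, rfl⟩
      obtain ⟨c, hc, hcv⟩ := (toP_eq_iff (toP v).rep_nonzero
        (h.tiling.ne_zero_of_mem_dom hv)).1 (toP_rep (toP v))
      change (toP v).rep ∈ B
      rw [hcv]
      exact hBs c v (Or.inl fun i => (h.supp_pos hv i).le)
    rw [Set.disjoint_left]
    intro x hx hxf
    have hxB : x.rep ∈ B := (hA.closure_subset_iff.2 hsub) hx
    have hxf : (∑ i, h.suppForm i) x.rep = 0 := hxf
    rw [LinearMap.sum_apply] at hxf
    refine x.rep_nonzero (h.eq_zero_of_suppForm fun i => ?_)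
    rcases hxB with hxB | hxB
    · exact (Finset.sum_eq_zero_iff_of_nonneg fun i _ => hxB i).1 hxf i (Finset.mem_univ i)
    · exact (Finset.sum_eq_zero_iff_of_nonpos fun i _ => hxB i).1 hxf i (Finset.mem_univ i)

theorem Omega_nonempty (h : HexagonLift γ P Q) : h.Omega.Nonempty := by
  refine ⟨toP (P 0 + P 1 + P 2), _, Set.mem_iUnion.2 ⟨(1, 0, true), ?_⟩, rfl⟩
  rw [cone_true]
  simp only [OneMemClass.coe_one, one_smul]
  exact ⟨1, 1, 1, by norm_num, by norm_num, by norm_num, by norm_num, by norm_num,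
    by norm_num, by simp⟩

theorem smul_mem_Omega (h : HexagonLift γ P Q) {g : SL3} (hg : g ∈ holGroup γ) {x : P2}
    (hx : x ∈ h.Omega) : g • x ∈ h.Omega := by
  obtain ⟨v, hv, rfl⟩ := hx
  rw [smul_toP _ (h.tiling.ne_zero_of_mem_dom hv)]
  exact ⟨_, (h.smul_mem_dom_iff hg).2 hv, rfl⟩

theorem smul_Omega (h : HexagonLift γ P Q) {g : SL3} (hg : g ∈ holGroup γ) :
    g • h.Omega = h.Omega := by
  refine Set.Subset.antisymm ?_ fun x hx =>
    ⟨g⁻¹ • x, h.smul_mem_Omega (inv_mem hg) hx, by simp⟩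
  rintro _ ⟨_, hx, rfl⟩
  exact h.smul_mem_Omega hg hx

instance instMulActionOmega (h : HexagonLift γ P Q) : MulAction (holGroup γ) h.Omega where
  smul g x := ⟨(g : SL3) • (x : P2), h.smul_mem_Omega g.2 x.2⟩
  one_smul _ := Subtype.ext (one_smul _ _)
  mul_smul g k x := Subtype.ext (mul_smul (g : SL3) (k : SL3) (x : P2))

/-- The elements of the domain over a point and its image are related with a positive factor. -/
theorem smul_eq_of_smul_toP (h : HexagonLift γ P Q) {g : SL3} (hg : g ∈ holGroup γ) {v w : V3}
    (hv : v ∈ h.tiling.dom) (hw : w ∈ h.tiling.dom) (hvw : g • toP v = toP w) :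
    ∃ c : ℝ, 0 < c ∧ g • v = c • w := by
  have hv0 := h.tiling.ne_zero_of_mem_dom hv
  rw [smul_toP _ hv0] at hvw
  obtain ⟨c, -, hc⟩ := (toP_eq_iff ((smul_ne_zero_iff' g).2 hv0)
    (h.tiling.ne_zero_of_mem_dom hw)).1 hvw
  refine ⟨c, ?_, hc⟩
  have h1 := h.supp_pos ((h.smul_mem_dom_iff hg).2 hv) 0
  have h2 := h.supp_pos hw 0
  rw [hc, map_smul, smul_eq_mul] at h1
  exact pos_of_mul_pos_left h1 h2.le

theorem sameTile_kind {h : HexagonLift γ P Q} {e e' : TileEdge γ} (he : h.tiling.SameTile e e') :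
    e'.2.2 = e.2.2 := by
  have key : ∀ e : TileEdge γ, (h.tiling.rot e).2.2 = e.2.2 := by
    rintro ⟨g, i, _ | _⟩ <;> rfl
  rcases he with rfl | rfl | rfl <;> simp [key]

/-- Translation changes only the group element of a label. The three labels of a tile `k T₀` have
equal group elements, and the three labels of an outer tile have distinct indices; so a translate
within the same tile is trivial. -/
theorem eq_one_of_sameTile {h : HexagonLift γ P Q} {e : TileEdge γ} {g : holGroup γ}
    (he : h.tiling.SameTile e (translate g e)) : g = 1 := by
  obtain ⟨k, i, _ | _⟩ := e
  · rcases he with he | he | he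
    · exact mul_eq_right.1 (congrArg Prod.fst he)
    · have : i = i + 1 := congrArg (fun e => e.2.1) he
      have hne : i ≠ i + 1 := by fin_cases i <;> decide
      exact absurd this hne
    · have : i = i + 1 + 1 := congrArg (fun e => e.2.1) he
      have hne : i ≠ i + 1 + 1 := by fin_cases i <;> decide
      exact absurd this hne
  · rcases he with he | he | he <;> exact mul_eq_right.1 (congrArg Prod.fst he)

/-- The star of an edge meets one translate of `T₀` and one outer tile. As `g` preserves the kind of
a tile, it must map the tile of `v` to itself. -/
theorem eq_one_of_mem_star (h : HexagonLift γ P Q) {e : TileEdge γ} {g : SL3}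
    (hg : g ∈ holGroup γ) {v : V3} (hv : v ∈ h.tiling.star e) (hgv : g • v ∈ h.tiling.star e) :
    g = 1 := by
  have key : ∀ e', (e' = e ∨ e' = h.tiling.rev e) → v ∈ h.tiling.cone e' → g = 1 := by
    intro e' he' hve'
    have h1 : g • v ∈ h.tiling.cone (translate ⟨g, hg⟩ e') :=
      (h.smul_mem_cone_translate ⟨g, hg⟩ e').2 hve'
    have hk : (translate ⟨g, hg⟩ e').2.2 = e'.2.2 := rfl
    have hr : (h.tiling.rev e).2.2 = !e.2.2 := rfl
    have h2 : h.tiling.SameTile e' (translate ⟨g, hg⟩ e') := by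
      rcases h.tiling.sameTile_of_mem_star hgv h1 with h3 | h3 <;> rcases he' with rfl | rfl
      · exact h3
      · have := sameTile_kind h3
        rw [hk, hr] at this
        simp at this
      · have := sameTile_kind h3
        rw [hk, hr] at this
        simp at this
      · exact h3
    exact congrArg Subtype.val (eq_one_of_sameTile h2)
  rcases h.tiling.star_subset e hv with hc | hc
  · exact key e (Or.inl rfl) hc
  · exact key _ (Or.inr rfl) hc

theorem free_Omega (h : HexagonLift γ P Q) {g : SL3} (hg : g ∈ holGroup γ) {x : P2}
    (hx : x ∈ h.Omega) (hgx : g • x = x) : g = 1 := by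
  obtain ⟨v, hv, rfl⟩ := hx
  obtain ⟨c, hc, hgv⟩ := h.smul_eq_of_smul_toP hg hv hv hgx
  obtain ⟨e, he⟩ := h.tiling.exists_mem_star_of_mem_dom hv
  exact h.eq_one_of_mem_star hg he (hgv ▸ h.tiling.star_smul hc he)

/-- The orbit map at a point of a star pulls this open star back to the identity alone. -/
theorem discreteTopology (h : HexagonLift γ P Q) : DiscreteTopology (holGroup γ) := by
  obtain ⟨x, v, hv, -⟩ := h.Omega_nonempty
  obtain ⟨e, he⟩ := h.tiling.exists_mem_star_of_mem_dom hv
  refine discreteTopology_of_isOpen_singleton_one ?_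
  have hcont : Continuous fun g : holGroup γ => (g : SL3) • v := by
    refine continuous_pi fun i => ?_
    simp only [sl_smul_apply]
    have : ∀ i j, Continuous fun g : holGroup γ => (g : SL3).1 i j := fun i j =>
      (continuous_apply_apply i j).comp
        ((continuous_induced_dom : Continuous fun g : SL3 => g.1).comp continuous_subtype_val)
    fun_prop
  convert! (h.tiling.isOpen_star e).preimage hcont using 1
  ext g
  constructor
  · rintro rfl
    simpa using he
  · intro hg
    exact Subtype.ext (h.eq_one_of_mem_star g.2 he hg)

/-- Finitely many stars cover `K`. They meet finitely many tiles, with three labels each, and `g` is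
recovered from a label together with its translate. -/
theorem properlyDiscontinuous (h : HexagonLift γ P Q) {K : Set P2} (hK : K ⊆ h.Omega)
    (hKc : IsCompact K) : {g | g ∈ holGroup γ ∧ (g • K ∩ K).Nonempty}.Finite := by
  have hcover : K ⊆ ⋃ e, toP '' h.tiling.star e := by
    intro x hx
    obtain ⟨v, hv, rfl⟩ := hK hx
    obtain ⟨e, he⟩ := h.tiling.exists_mem_star_of_mem_dom hv
    exact Set.mem_iUnion.2 ⟨e, v, he, rfl⟩
  obtain ⟨I, hI⟩ := hKc.elim_finite_subcover _ (fun e => h.tiling.isOpen_image_star e) hcover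
  let J : Set (TileEdge γ) := ⋃ e ∈ I, ({e, h.tiling.rev e} : Set (TileEdge γ))
  have hJ : J.Finite := I.finite_toSet.biUnion fun _ _ => Set.toFinite _
  let L : Set (TileEdge γ) :=
    ⋃ e ∈ J, ({e, h.tiling.rot e, h.tiling.rot (h.tiling.rot e)} : Set (TileEdge γ))
  have hL : L.Finite := hJ.biUnion fun _ _ => Set.toFinite _
  refine ((hL.prod hJ).image fun p => (p.1.1 : SL3) * (p.2.1 : SL3)⁻¹).subset ?_
  rintro g ⟨hg, y, ⟨x, hx, rfl⟩, hy⟩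
  obtain ⟨e, heI, v, hv, rfl⟩ := Set.mem_iUnion₂.1 (hI hx)
  obtain ⟨e', heI', w, hw, hvw⟩ := Set.mem_iUnion₂.1 (hI hy)
  obtain ⟨c, hc, hgv⟩ := h.smul_eq_of_smul_toP hg (h.tiling.star_subset_dom _ hv)
    (h.tiling.star_subset_dom _ hw) hvw.symm
  obtain ⟨d, hdJ, hvd⟩ : ∃ d ∈ J, v ∈ h.tiling.cone d := by
    rcases h.tiling.star_subset e hv with hc | hc
    · exact ⟨e, Set.mem_iUnion₂.2 ⟨e, heI, by simp⟩, hc⟩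
    · exact ⟨_, Set.mem_iUnion₂.2 ⟨e, heI, by simp⟩, hc⟩
  have h1 : g • v ∈ h.tiling.cone (translate ⟨g, hg⟩ d) :=
    (h.smul_mem_cone_translate ⟨g, hg⟩ d).2 hvd
  have h2 : g • v ∈ h.tiling.star e' := hgv ▸ h.tiling.star_smul hc hw
  have h3 : translate ⟨g, hg⟩ d ∈ L := by
    rcases h.tiling.sameTile_of_mem_star h2 h1 with h4 | h4
    · exact Set.mem_iUnion₂.2 ⟨e', Set.mem_iUnion₂.2 ⟨e', heI', by simp⟩, h4⟩
    · exact Set.mem_iUnion₂.2 ⟨_, Set.mem_iUnion₂.2 ⟨e', heI', by simp⟩, h4⟩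
  exact ⟨(_, d), ⟨h3, hdJ⟩, mul_inv_cancel_right _ _⟩

theorem isProperlyConvexSurface (h : HexagonLift γ P Q) :
    IsProperlyConvexSurface (holGroup γ) h.Omega where
  nonempty := h.Omega_nonempty
  isOpen := h.isOpen_Omega
  properlyConvex := h.isProperlyConvex_Omega
  discrete := h.discreteTopology
  preserves _ hg := h.smul_Omega hg
  free _ hg _ hx := h.free_Omega hg hx
  properlyDiscontinuous _ := h.properlyDiscontinuous

/-! ### The group is free -/

theorem tiling_left_true (h : HexagonLift γ P Q) (g : holGroup γ) (i : Fin 3) :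
    h.tiling.left (g, i, true) = (g, i + 2, false) := rfl

theorem tiling_right_true (h : HexagonLift γ P Q) (g : holGroup γ) (i : Fin 3) :
    h.tiling.right (g, i, true) = (g, i + 1, false) := by
  change (g, i + 2 + 2, false) = _
  rw [fin3_add_two_add_two]

theorem tiling_left_false (h : HexagonLift γ P Q) (g : holGroup γ) (i : Fin 3) :
    h.tiling.left (g, i, false) = (g * (gen γ (i + 2))⁻¹, i + 1, true) := rfl

theorem tiling_right_false (h : HexagonLift γ P Q) (g : holGroup γ) (i : Fin 3) :
    h.tiling.right (g, i, false) = (g * gen γ (i + 1), i + 2, true) := by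
  change rev (rot (rot (g, i, false))) = _
  rw [rot_rot_false h.prod_eq_one]
  rfl

theorem side_center (h : HexagonLift γ P Q) (g : holGroup γ) (e : TileEdge γ) :
    h.tiling.side e ((g : SL3) • (P 0 + P 1 + P 2)) ≠ 0 := by
  refine h.tiling.side_ne_zero (e' := (g, 0, true)) fun i hi => ?_
  obtain ⟨j, rfl⟩ : ∃ j, i = (g, j, true) := by
    rcases hi with rfl | rfl | rfl <;> exact ⟨_, rfl⟩
  change 0 < det3 ((g : SL3) • P (j + 1)) ((g : SL3) • P (j + 2 + 2 + 1)) _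
  rw [fin3_add_two_add_two, det3_sl_smul, fin3_add_one_add_one]
  have h1 := h.det_cyclic j
  have : P 0 + P 1 + P 2 = P j + P (j + 1) + P (j + 2) := by
    rw [← fin3_sum j, Fin.sum_univ_three]
  rw [this]
  have : det3 (P (j + 1)) (P (j + 2)) (P j + P (j + 1) + P (j + 2)) =
    det3 (P j) (P (j + 1)) (P (j + 2)) := by simp [det3]; ring
  rwa [this]

/-- The group elements that move the central triangle beyond a given edge. -/
def beyondSet (h : HexagonLift γ P Q) (e : TileEdge γ) : Set (holGroup γ) :=
  {g | 0 < h.tiling.side e ((g : SL3) • (P 0 + P 1 + P 2))}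

theorem disjoint_beyondSet (h : HexagonLift γ P Q) {s s' : TileEdge γ}
    (hs : h.tiling.Beyond (h.tiling.rev s') s) : Disjoint (h.beyondSet s) (h.beyondSet s') := by
  rw [Set.disjoint_left]
  intro g hg hg'
  have hv : P 0 + P 1 + P 2 ∈ h.tiling.dom := by
    refine Set.mem_iUnion.2 ⟨(1, 0, true), ?_⟩
    rw [cone_true]
    simp only [OneMemClass.coe_one, one_smul]
    exact ⟨1, 1, 1, by norm_num, by norm_num, by norm_num, by norm_num, by norm_num,
      by norm_num, by simp⟩
  exact not_lt.2 (h.tiling.side_nonpos_of_side_pos hs ((h.smul_mem_dom_iff g.2).2 hv) hg) hg'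

/-- By `side_center` the centre of a tile is never on the line of an edge, so not being on the left
means being strictly on the right. -/
theorem smul_compl_beyondSet (h : HexagonLift γ P Q) (g : holGroup γ) (e : TileEdge γ) :
    g • (h.beyondSet e)ᶜ ⊆ h.beyondSet (translate g (h.tiling.rev e)) := by
  rintro _ ⟨k, hk, rfl⟩
  have hk1 : h.tiling.side e ((k : SL3) • (P 0 + P 1 + P 2)) < 0 :=
    lt_of_le_of_ne (not_lt.1 hk) (h.side_center k e)
  rw [← ConvexTiling.side_rev_pos, ← h.side_translate g, ← mul_smul] at hk1
  exact hk1

theorem beyondSet_nonempty (h : HexagonLift γ P Q) (g : holGroup γ) (i : Fin 3) :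
    (h.beyondSet (g, i, true)).Nonempty := by
  refine ⟨g, ?_⟩
  have hv : (g : SL3) • (P 0 + P 1 + P 2) ∈ h.tiling.cone (g, i, true) := by
    rw [cone_true]
    exact Set.smul_mem_smul_set ⟨1, 1, 1, by norm_num, by norm_num, by norm_num, by norm_num,
      by norm_num, by norm_num, by simp⟩
  exact lt_of_le_of_ne hv.1 (h.side_center _ _).symm

/-- Two free generators of the group. -/
def freeGen (γ : Fin 3 → SL3) : Fin 2 → holGroup γ := ![gen γ 1, gen γ 2]

/-- Ping-pong on the quadrilateral `T₀ ∪ T 0`: the four sets are the parts of the group beyond its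
sides. The first generator takes the outside of `s₁` beyond `s₁'`, the second takes the outside of
`s₂'` beyond `s₂`, and the inverses do the converse. -/
theorem freeGen_injective (h : HexagonLift γ P Q) :
    Function.Injective (FreeGroup.lift (freeGen γ)) := by
  let s₁ : TileEdge γ := (1, 2, false)
  let s₂ : TileEdge γ := (1, 1, false)
  let s₁' : TileEdge γ := (gen γ 1, 2, true)
  let s₂' : TileEdge γ := ((gen γ 2)⁻¹, 1, true)
  have hr : h.tiling.right (1, 0, false) = s₁' := by rw [tiling_right_false]; simp [s₁']
  have hl : h.tiling.left (1, 0, false) = s₂' := by rw [tiling_left_false]; simp [s₂']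
  have b₁ : h.tiling.Beyond (h.tiling.rev s₁) (1, 0, false) := by
    have := (h.tiling.beyond_refl (1, 2, true)).right
    rwa [tiling_right_true] at this
  have b₂ : h.tiling.Beyond (h.tiling.rev s₂) (1, 0, false) := by
    have := (h.tiling.beyond_refl (1, 1, true)).left
    rwa [tiling_left_true] at this
  have d₁₂ : Disjoint (h.beyondSet s₂) (h.beyondSet s₁) := h.disjoint_beyondSet (by
    have := (h.tiling.beyond_refl (1, 2, true)).left
    rwa [tiling_left_true] at this)
  have d₁₁ : Disjoint (h.beyondSet s₁') (h.beyondSet s₁) := h.disjoint_beyondSet (hr ▸ b₁.right)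
  have d₁₃ : Disjoint (h.beyondSet s₂') (h.beyondSet s₁) := h.disjoint_beyondSet (hl ▸ b₁.left)
  have d₂₁ : Disjoint (h.beyondSet s₁') (h.beyondSet s₂) := h.disjoint_beyondSet (hr ▸ b₂.right)
  have d₂₂ : Disjoint (h.beyondSet s₂') (h.beyondSet s₂) := h.disjoint_beyondSet (hl ▸ b₂.left)
  have d₃₄ : Disjoint (h.beyondSet s₂') (h.beyondSet s₁') := h.disjoint_beyondSet (by
    rw [← hr, ← hl, ConvexTiling.right, h.tiling.rev_rev, ← ConvexTiling.right_rot_rot]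
    exact (h.tiling.beyond_refl _).right)
  have m₁ : h.tiling.rev s₁ = (1, 2, true) := rfl
  have m₂ : h.tiling.rev s₂' = ((gen γ 2)⁻¹, 1, false) := rfl
  have m₃ : h.tiling.rev s₁' = (gen γ 1, 2, false) := rfl
  have m₄ : h.tiling.rev s₂ = (1, 1, true) := rfl
  have c₁ := h.smul_compl_beyondSet (gen γ 1) s₁
  have c₂ := h.smul_compl_beyondSet (gen γ 2) s₂'
  have c₃ := h.smul_compl_beyondSet (gen γ 1)⁻¹ s₁'
  have c₄ := h.smul_compl_beyondSet (gen γ 2)⁻¹ s₂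
  rw [m₁] at c₁
  rw [m₂] at c₂
  rw [m₃] at c₃
  rw [m₄] at c₄
  simp only [translate, mul_one, mul_inv_cancel, inv_mul_cancel] at c₁ c₂ c₃ c₄
  refine FreeGroup.injective_lift_of_ping_pong (freeGen γ) ![h.beyondSet s₁', h.beyondSet s₂]
    ![h.beyondSet s₁, h.beyondSet s₂'] ?_ ?_ ?_ ?_ ?_ ?_
  · intro i
    fin_cases i
    · exact h.beyondSet_nonempty _ _
    · obtain ⟨g, hg⟩ := h.beyondSet_nonempty (gen γ 1) 2
      have : ((h.beyondSet s₂')ᶜ).Nonempty := ⟨g, fun hg' => Set.disjoint_left.1 d₃₄ hg' hg⟩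
      exact (this.smul_set (a := gen γ 2)).mono c₂
  · intro i j hij
    fin_cases i <;> fin_cases j <;> first | exact absurd rfl hij | skip
    · exact d₂₁
    · exact d₂₁.symm
  · intro i j hij
    fin_cases i <;> fin_cases j <;> first | exact absurd rfl hij | skip
    · exact d₁₃.symm
    · exact d₁₃
  · intro i j
    fin_cases i <;> fin_cases j
    · exact d₁₁
    · exact d₃₄.symm
    · exact d₁₂
    · exact d₂₂.symm
  · intro i
    fin_cases i
    · exact c₁
    · exact c₂
  · intro i
    fin_cases i
    · exact c₃
    · exact c₄

theorem freeGen_surjective (h : HexagonLift γ P Q) :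
    Function.Surjective (FreeGroup.lift (freeGen γ)) := by
  intro g
  have h1 : gen γ 1 ∈ (FreeGroup.lift (freeGen γ)).range := ⟨FreeGroup.of 0, by simp [freeGen]⟩
  have h2 : gen γ 2 ∈ (FreeGroup.lift (freeGen γ)).range := ⟨FreeGroup.of 1, by simp [freeGen]⟩
  have h0 : gen γ 0 ∈ (FreeGroup.lift (freeGen γ)).range := by
    have : gen γ 0 = (gen γ 2 * gen γ 1)⁻¹ := eq_inv_of_mul_eq_one_right (Subtype.ext h.prod_eq_one)
    rw [this]
    exact inv_mem (mul_mem h2 h1)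
  have hall : ∀ i, gen γ i ∈ (FreeGroup.lift (freeGen γ)).range := by
    intro i; fin_cases i <;> assumption
  refine holGroup_induction (S := ((FreeGroup.lift (freeGen γ)).range : Set (holGroup γ)))
    (one_mem _) (fun g hg i => ⟨mul_mem hg (hall i), mul_mem hg (inv_mem (hall i))⟩) g

/-- The group is free on two generators. -/
def freeEquiv (h : HexagonLift γ P Q) : FreeGroup (Fin 2) ≃* holGroup γ :=
  MulEquiv.ofBijective _ ⟨h.freeGen_injective, h.freeGen_surjective⟩

theorem freeEquiv_of (h : HexagonLift γ P Q) (i : Fin 2) :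
    h.freeEquiv.symm (freeGen γ i) = FreeGroup.of i := by
  rw [MulEquiv.symm_apply_eq]
  exact (FreeGroup.lift_apply_of ..).symm

/-- The generators are not proper powers, even up to conjugation. -/
theorem zpow_eq_gen (h : HexagonLift γ P Q) {i : Fin 3} {u g : holGroup γ} {k : ℤ}
    (hk : gen γ i = u * g ^ k * u⁻¹) : k = 1 ∨ k = -1 := by
  -- By freeness, some homomorphism to `ℤ` takes the value `1` or `-1` at the generator; its value
  -- is also a multiple of `k`, so `k` is a unit.
  obtain ⟨φ, hφ⟩ : ∃ φ : holGroup γ →* Multiplicative ℤ,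
      φ (gen γ i) = Multiplicative.ofAdd 1 ∨ φ (gen γ i) = Multiplicative.ofAdd (-1) := by
    have key : ∀ f : Fin 2 → Multiplicative ℤ, ∃ φ : holGroup γ →* Multiplicative ℤ,
        φ (gen γ 1) = f 0 ∧ φ (gen γ 2) = f 1 := fun f => by
      refine ⟨(FreeGroup.lift f).comp h.freeEquiv.symm.toMonoidHom, ?_, ?_⟩
      · have := h.freeEquiv_of 0
        change FreeGroup.lift f (h.freeEquiv.symm (freeGen γ 0)) = _
        rw [this, FreeGroup.lift_apply_of]
      · have := h.freeEquiv_of 1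
        change FreeGroup.lift f (h.freeEquiv.symm (freeGen γ 1)) = _
        rw [this, FreeGroup.lift_apply_of]
    fin_cases i
    · obtain ⟨φ, h1, h2⟩ := key ![Multiplicative.ofAdd 1, 1]
      have : gen γ 0 = (gen γ 2 * gen γ 1)⁻¹ :=
        eq_inv_of_mul_eq_one_right (Subtype.ext h.prod_eq_one)
      refine ⟨φ, Or.inr ?_⟩
      change φ (gen γ 0) = _
      rw [this, map_inv, map_mul, h1, h2]
      rfl
    · obtain ⟨φ, h1, h2⟩ := key ![Multiplicative.ofAdd 1, 1]
      exact ⟨φ, Or.inl h1⟩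
    · obtain ⟨φ, h1, h2⟩ := key ![1, Multiplicative.ofAdd 1]
      exact ⟨φ, Or.inl h2⟩
  have hφk : φ (gen γ i) = φ g ^ k := by
    rw [hk, map_mul, map_mul, map_inv, map_zpow, mul_comm, inv_mul_cancel_left]
  have h1 : Multiplicative.toAdd (φ (gen γ i)) = k * Multiplicative.toAdd (φ g) := by
    rw [hφk, toAdd_zpow, smul_eq_mul]
  have hu : IsUnit k := by
    rcases hφ with hφ | hφ
    · rw [hφ, toAdd_ofAdd] at h1
      exact IsUnit.of_mul_eq_one _ h1.symm
    · rw [hφ, toAdd_ofAdd] at h1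
      exact IsUnit.of_mul_eq_one (-Multiplicative.toAdd (φ g)) (by linarith)
  exact Int.isUnit_iff.1 hu

end HexagonLift

end

section

/-! ### Cylinders in the base of a covering -/

section Cylinder

variable {E X : Type*} [TopologicalSpace E] [TopologicalSpace X] {G : Type*} [Group G]
  [MulAction G E] {q : E → X}

/-- Two lifts of the same map differ by an element of the group. -/
theorem exists_smul_of_lifts (hq : IsQuotientCoveringMap q G) {A : Type*} [TopologicalSpace A]
    [PreconnectedSpace A] {f₁ f₂ : A → E} (h₁ : Continuous f₁) (h₂ : Continuous f₂)
    (h : ∀ a, q (f₁ a) = q (f₂ a)) (a₀ : A) : ∃ u : G, ∀ a, f₁ a = u • f₂ a := by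
  obtain ⟨u, hu⟩ := hq.apply_eq_iff_mem_orbit.1 (h a₀)
  have := hq.toContinuousConstSMul
  have key := hq.isCoveringMap.eq_of_comp_eq h₁ (h₂.const_smul u)
    (funext fun a => by simp [h a, hq.map_smul]) a₀ hu.symm
  exact ⟨u, fun a => congrFun key a⟩

/-- The parametrisation of a cylinder by the plane. -/
def cylinderMap (x : ℝ × ℝ) : Circle × Set.Ici (0 : ℝ) :=
  -- Truncating the height at `0` defines the parametrisation on the whole plane, which is simply
  -- connected, so that lifts to the covering exist.
  (Circle.exp (2 * Real.pi * x.1), ⟨max x.2 0, Set.mem_Ici.2 (le_max_right _ _)⟩)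

theorem continuous_cylinderMap : Continuous cylinderMap := by
  unfold cylinderMap
  refine Continuous.prodMk ?_ ?_
  · exact Circle.exp.continuous.comp (by fun_prop)
  · exact Continuous.subtype_mk (by fun_prop) _

/-- A cylinder in the base lifts to a plane, with a deck transformation `g`. -/
theorem exists_cylinder_lift (hq : IsQuotientCoveringMap q G) {c : Circle × Set.Ici (0 : ℝ) → X}
    (hc : Continuous c) : ∃ (H : ℝ × ℝ → E) (g : G), Continuous H ∧
      (∀ x, q (H x) = c (cylinderMap x)) ∧ ∀ (n : ℤ) t r, H (t + n, r) = g ^ n • H (t, r) := by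
  obtain ⟨e₀, he₀⟩ := hq.surjective (c (cylinderMap (0, 0)))
  obtain ⟨H, ⟨-, hH⟩, -⟩ := hq.isCoveringMap.existsUnique_continuousMap_lifts
    (⟨fun x => c (cylinderMap x), hc.comp continuous_cylinderMap⟩ : C(ℝ × ℝ, X)) (0, 0) e₀ he₀
  have hH' : ∀ x, q (H x) = c (cylinderMap x) := fun x => congrFun hH x
  have hper : ∀ t r, cylinderMap (t + 1, r) = cylinderMap (t, r) := fun t r => by
    simp only [cylinderMap, mul_add, mul_one]
    rw [Circle.exp_add, Circle.exp_two_pi, mul_one]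
  obtain ⟨g, hg⟩ := exists_smul_of_lifts hq (f₁ := fun x : ℝ × ℝ => H (x.1 + 1, x.2)) (f₂ := H)
    (by fun_prop) H.continuous (fun x => by rw [hH', hH', hper]) (0, 0)
  refine ⟨H, g, H.continuous, hH', fun n t r => ?_⟩
  induction n using Int.induction_on with
  | zero => simp
  | succ n ih =>
    have := hg (t + n, r)
    push_cast at ih ⊢
    rw [← add_assoc, this, ih, smul_smul, add_comm, zpow_add, zpow_one]
  | pred n ih =>
    have := hg (t + (-n - 1 : ℝ), r)
    push_cast at ih ⊢
    simp only [add_assoc, sub_add_cancel] at this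
    rw [ih] at this
    rw [← inv_smul_eq_iff.2 this, smul_smul, sub_eq_add_neg, add_comm (-(n : ℤ)), zpow_add,
      zpow_neg_one]

/-- A path in a cylinder lifts to a path in the plane. -/
theorem exists_plane_lift (p : C(unitInterval, Circle × Set.Ici (0 : ℝ))) :
    ∃ s : C(unitInterval, ℝ × ℝ), ∀ t, cylinderMap (s t) = p t := by
  obtain ⟨θ₀, hθ₀⟩ := Circle.exp_surjective (p 0).1
  obtain ⟨θ, hθ, -⟩ := Circle.isCoveringMap_exp.exists_path_lifts
    (⟨fun t => (p t).1, by fun_prop⟩ : C(unitInterval, Circle)) θ₀ hθ₀.symm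
  refine ⟨⟨fun t => (θ t / (2 * Real.pi), (p t).2), by fun_prop⟩, fun t => ?_⟩
  refine Prod.ext ?_ (Subtype.ext ?_)
  · have h1 : 2 * Real.pi * (θ t / (2 * Real.pi)) = θ t := by
      field_simp
    have h2 : Circle.exp (θ t) = (p t).1 := congrFun hθ t
    simp only [cylinderMap, ContinuousMap.coe_mk, h1, h2]
  · exact max_eq_left (p t).2.2

theorem cylinderMap_eq_iff {x y : ℝ × ℝ} (h : cylinderMap x = cylinderMap y) :
    (∃ n : ℤ, x.1 = y.1 + n) ∧ max x.2 0 = max y.2 0 := by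
  refine ⟨?_, congrArg (fun z => (z.2 : ℝ)) h⟩
  obtain ⟨n, hn⟩ := Circle.exp_eq_exp.1 (congrArg Prod.fst h)
  refine ⟨n, ?_⟩
  have := Real.pi_pos
  have h2 : 2 * Real.pi * (x.1 - (y.1 + n)) = 0 := by linarith
  rcases mul_eq_zero.1 h2 with h2 | h2 <;> linarith

/-- The holonomy of a loop inside an embedded cylinder is conjugate to a power of the holonomy of
the cylinder. -/
theorem exists_eq_conj_zpow (hq : IsQuotientCoveringMap q G) {c : Circle × Set.Ici (0 : ℝ) → X}
    (hc : Topology.IsEmbedding c) {H : ℝ × ℝ → E} {g : G} (hH : Continuous H)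
    (hHc : ∀ x, q (H x) = c (cylinderMap x)) (hg : ∀ (n : ℤ) t r, H (t + n, r) = g ^ n • H (t, r))
    {p : C(unitInterval, E)} (hp : ∀ t, q (p t) ∈ Set.range c) {k : G} (hk : p 1 = k • p 0) :
    ∃ (u : G) (n : ℤ), k = u * g ^ n * u⁻¹ := by
  choose σ hσ using hp
  have hσc : Continuous σ := by
    rw [hc.continuous_iff]
    have : c ∘ σ = fun t => q (p t) := funext hσ
    rw [this]
    exact hq.continuous.comp p.continuous
  obtain ⟨s, hs⟩ := exists_plane_lift ⟨σ, hσc⟩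
  obtain ⟨u, hu⟩ := exists_smul_of_lifts hq (f₁ := p)
    (f₂ := fun t => H ((s t).1, max (s t).2 0)) p.continuous (by fun_prop) (fun t => by
      rw [hHc, ← hσ t, ← ContinuousMap.coe_mk σ hσc, ← hs t]; simp [cylinderMap]) 0
  -- The path closes up in the cylinder because the cylinder is embedded; its lift to the plane
  -- therefore ends at the same height, with the angle shifted by an integer `n`.
  have h01 : σ 1 = σ 0 := hc.injective (by rw [hσ, hσ, hk, hq.map_smul])
  obtain ⟨⟨n, hn⟩, hr⟩ := cylinderMap_eq_iff (show cylinderMap (s 1) = cylinderMap (s 0) by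
    rw [hs, hs]; exact h01)
  refine ⟨u, n, ?_⟩
  have h1 := hu 1
  rw [hk, hu 0, hn, hr, hg, smul_smul, smul_smul] at h1
  have := hq.isCancelSMul
  have := IsCancelSMul.right_cancel _ _ _ h1
  rw [← this, mul_inv_cancel_right]

/-- The holonomies of the boundary of a cylinder are conjugate to the holonomy of the cylinder. -/
theorem exists_eq_conj (hq : IsQuotientCoveringMap q G) {c : Circle × Set.Ici (0 : ℝ) → X}
    {H : ℝ × ℝ → E} {g : G} (hH : Continuous H)
    (hHc : ∀ x, q (H x) = c (cylinderMap x)) (hg : ∀ (n : ℤ) t r, H (t + n, r) = g ^ n • H (t, r))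
    {l : C(unitInterval, E)}
    (hl : ∀ t, q (l t) = c (Circle.exp (2 * Real.pi * (t : ℝ)), ⟨0, Set.self_mem_Ici⟩))
    {k : G} (hk : l 1 = k • l 0) : ∃ u : G, k = u * g * u⁻¹ := by
  obtain ⟨u, hu⟩ := exists_smul_of_lifts hq (f₁ := l)
    (f₂ := fun t => H ((t : ℝ), 0)) l.continuous (by fun_prop) (fun t => by
      rw [hHc, hl]; simp [cylinderMap]) 0
  refine ⟨u, ?_⟩
  have h1 := hu 1
  have h2 := hg 1 0 0
  simp only [Int.cast_one, zpow_one] at h2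
  have h3 := hu 0
  simp only [Set.Icc.coe_one, Set.Icc.coe_zero] at h1 h3
  rw [hk, h3, ← zero_add (1 : ℝ), h2, smul_smul, smul_smul] at h1
  have := hq.isCancelSMul
  have := IsCancelSMul.right_cancel _ _ _ h1
  rw [← this, mul_inv_cancel_right]

end Cylinder

/-! ### The quotient of the domain -/

theorem continuous_smul_P2 (g : SL3) : Continuous fun x : P2 => g • x := by
  refine continuous_def.2 fun A hA => ?_
  rw [isOpen_P2_iff] at hA ⊢
  convert! hA.preimage (continuous_smul_sl g) using 1
  ext v
  constructor
  · rintro ⟨hv, h⟩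
    refine ⟨(smul_ne_zero_iff' g).2 hv, ?_⟩
    rw [← smul_toP g hv]; exact h
  · rintro ⟨hv, h⟩
    have hv := (smul_ne_zero_iff' g).1 hv
    refine ⟨hv, ?_⟩
    rw [← smul_toP g hv] at h; exact h

variable {γ : Fin 3 → SL3} {P Q : Fin 3 → V3}

namespace HexagonLift

/-- Stars serve as the neighbourhoods required of a covering: by `eq_one_of_mem_star`, a nontrivial
translate of a star is disjoint from it. -/
theorem isQuotientCoveringMap (h : HexagonLift γ P Q) :
    IsQuotientCoveringMap (Quotient.mk (orbitSetoid (holGroup γ) h.Omega)) (holGroup γ) where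
  toIsQuotientMap := isQuotientMap_quot_mk
  continuous_const_smul g :=
    ((continuous_smul_P2 (g : SL3)).comp continuous_subtype_val).subtype_mk _
  apply_eq_iff_mem_orbit {x y} := by
    rw [Quotient.eq]
    constructor
    · rintro ⟨g, hg, hxy⟩
      refine ⟨⟨g⁻¹, inv_mem hg⟩, Subtype.ext ?_⟩
      change g⁻¹ • (y : P2) = x
      rw [← hxy, inv_smul_smul]
    · rintro ⟨g, hxy⟩
      refine ⟨(g : SL3)⁻¹, inv_mem g.2, ?_⟩
      rw [← hxy]
      exact inv_smul_smul (g : SL3) (y : P2)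
  disjoint x := by
    obtain ⟨v, hv, hvx⟩ := x.2
    obtain ⟨e, he⟩ := h.tiling.exists_mem_star_of_mem_dom hv
    refine ⟨Subtype.val ⁻¹' (toP '' h.tiling.star e),
      ((h.tiling.isOpen_image_star e).preimage continuous_subtype_val).mem_nhds ⟨v, he, hvx⟩, ?_⟩
    rintro g ⟨_, ⟨y, ⟨a, ha, hay⟩, rfl⟩, ⟨b, hb, hby⟩⟩
    change toP b = (g : SL3) • (y : P2) at hby
    rw [← hay] at hby
    obtain ⟨c, hc, hgc⟩ := h.smul_eq_of_smul_toP g.2 (h.tiling.star_subset_dom e ha)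
      (h.tiling.star_subset_dom e hb) hby.symm
    exact Subtype.ext (h.eq_one_of_mem_star g.2 ha (hgc ▸ h.tiling.star_smul hc hb))

end HexagonLift

end

/-! ### Two triangles glued along their boundaries -/

/-- The smallest coordinate. -/
def minc (x : V3) : ℝ := min (x 0) (min (x 1) (x 2))

/-- The mean of the coordinates. -/
def mean (x : V3) : ℝ := (x 0 + x 1 + x 2) / 3

theorem minc_le (x : V3) (i : Fin 3) : minc x ≤ x i := by
  fin_cases i <;> simp [minc]

theorem exists_minc_eq (x : V3) : ∃ i, x i = minc x := by
  rcases min_choice (x 0) (min (x 1) (x 2)) with h | h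
  · exact ⟨0, h.symm⟩
  · rcases min_choice (x 1) (x 2) with h' | h'
    · exact ⟨1, (h.trans h').symm⟩
    · exact ⟨2, (h.trans h').symm⟩

theorem minc_eq_iff {x : V3} {c : ℝ} : minc x = c ↔ (∀ i, c ≤ x i) ∧ ∃ i, x i = c := by
  constructor
  · rintro rfl
    exact ⟨minc_le x, exists_minc_eq x⟩
  · rintro ⟨h, i, rfl⟩
    refine le_antisymm (minc_le x i) ?_
    obtain ⟨j, hj⟩ := exists_minc_eq x
    rw [← hj]; exact h j

theorem minc_smul {c : ℝ} (hc : 0 ≤ c) (x : V3) : minc (c • x) = c * minc x := by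
  obtain ⟨i, hi⟩ := exists_minc_eq x
  exact minc_eq_iff.2 ⟨fun j => mul_le_mul_of_nonneg_left (minc_le x j) hc, i, by simp [hi]⟩

theorem mean_smul (c : ℝ) (x : V3) : mean (c • x) = c * mean x := by
  simp [mean]; ring

theorem continuous_minc : Continuous minc := by unfold minc; fun_prop

theorem continuous_mean : Continuous mean := by unfold mean; fun_prop

/-- The two embeddings of the cone of nonnegative vectors, for `s = 1` and `s = -1`: together they
identify `ℝ³` with two copies of the cone glued along their boundaries. -/
def fold (s : ℝ) (x : V3) : V3 := fun i => x i - mean x + s * minc x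

/-- The coordinates of a point in one of the two cones. -/
def unfold (u : V3) : V3 := fun i => u i - minc u + |mean u|

theorem continuous_fold (s : ℝ) : Continuous (fold s) := by
  have := continuous_minc
  have := continuous_mean
  unfold fold
  fun_prop

theorem continuous_unfold : Continuous unfold := by
  have := continuous_minc
  have := continuous_mean
  unfold unfold
  fun_prop

theorem fold_smul (s : ℝ) {c : ℝ} (hc : 0 ≤ c) (x : V3) : fold s (c • x) = c • fold s x := by
  ext i
  simp only [fold, mean_smul, minc_smul hc, Pi.smul_apply, smul_eq_mul]
  ring

theorem unfold_smul {c : ℝ} (hc : 0 ≤ c) (u : V3) : unfold (c • u) = c • unfold u := by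
  ext i
  simp only [unfold, mean_smul, minc_smul hc, Pi.smul_apply, smul_eq_mul, abs_mul, abs_of_nonneg hc]
  ring

/-- The sign of the mean tells which copy a vector comes from, and the plane where the mean vanishes
is the common boundary. -/
theorem mean_fold (s : ℝ) (x : V3) : mean (fold s x) = s * minc x := by
  simp only [mean, fold]; ring

theorem minc_unfold (u : V3) : minc (unfold u) = |mean u| := by
  obtain ⟨i, hi⟩ := exists_minc_eq u
  refine minc_eq_iff.2 ⟨fun j => ?_, i, ?_⟩
  · have := minc_le u j
    simp only [unfold]; linarith
  · simp only [unfold, hi]; ring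

theorem unfold_nonneg (u : V3) (i : Fin 3) : 0 ≤ unfold u i :=
  (abs_nonneg _).trans ((minc_unfold u).symm.le.trans (minc_le _ i))

theorem fold_unfold {s : ℝ} {u : V3} (hs : s * |mean u| = mean u) : fold s (unfold u) = u := by
  ext i
  simp only [fold, minc_unfold, hs]
  simp only [unfold, mean]
  ring

/-- A nonnegative vector is determined by its class modulo `(1, 1, 1)` and its smallest coordinate;
the first survives in `fold`, and the second is the absolute value of the mean. -/
theorem unfold_fold {s : ℝ} (hs : |s| = 1) {x : V3} (hx : ∀ i, 0 ≤ x i) : unfold (fold s x) = x := by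
  have h0 : 0 ≤ minc x := by
    obtain ⟨i, hi⟩ := exists_minc_eq x
    rw [← hi]; exact hx i
  have h1 : minc (fold s x) = minc x - mean x + s * minc x := by
    obtain ⟨i, hi⟩ := exists_minc_eq x
    refine minc_eq_iff.2 ⟨fun j => ?_, i, ?_⟩
    · have := minc_le x j
      simp only [fold]; linarith
    · simp only [fold, hi]
  ext i
  have h2 : fold s x i = x i - mean x + s * minc x := rfl
  rw [unfold, mean_fold, h1, abs_mul, hs, abs_of_nonneg h0, h2]
  ring

theorem fold_eq_of_minc_eq_zero {x : V3} (hx : minc x = 0) (s s' : ℝ) : fold s x = fold s' x := by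
  ext i
  simp [fold, hx]

/-! ### Directions -/

/-- The direction of a nonzero vector. -/
def dir (u : V3) : Sphere2 :=
  if h : WithLp.toLp 2 u ≠ 0 then
    ⟨‖WithLp.toLp 2 u‖⁻¹ • WithLp.toLp 2 u, by
      rw [mem_sphere_zero_iff_norm, norm_smul, norm_inv, norm_norm,
        inv_mul_cancel₀ (norm_ne_zero_iff.2 h)]⟩
  else ⟨EuclideanSpace.single 0 1, by simp⟩

theorem toLp_ne_zero {u : V3} : WithLp.toLp 2 u ≠ (0 : EuclideanSpace ℝ (Fin 3)) ↔ u ≠ 0 :=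
  (WithLp.toLp_eq_zero 2).not

theorem coe_dir {u : V3} (hu : u ≠ 0) :
    (dir u : EuclideanSpace ℝ (Fin 3)) = ‖WithLp.toLp 2 u‖⁻¹ • WithLp.toLp 2 u := by
  rw [dir, dif_pos (toLp_ne_zero.2 hu)]

theorem norm_toLp_pos {u : V3} (hu : u ≠ 0) : 0 < ‖(WithLp.toLp 2 u : EuclideanSpace ℝ (Fin 3))‖ :=
  norm_pos_iff.2 (toLp_ne_zero.2 hu)

theorem dir_eq_iff {u v : V3} (hu : u ≠ 0) (hv : v ≠ 0) :
    dir u = dir v ↔ ∃ c : ℝ, 0 < c ∧ u = c • v := by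
  constructor
  · intro h
    have h := congrArg Subtype.val h
    rw [coe_dir hu, coe_dir hv, inv_smul_eq_iff₀ (norm_toLp_pos hu).ne'] at h
    refine ⟨‖(WithLp.toLp 2 u : EuclideanSpace ℝ (Fin 3))‖ *
      ‖(WithLp.toLp 2 v : EuclideanSpace ℝ (Fin 3))‖⁻¹,
      mul_pos (norm_toLp_pos hu) (inv_pos.2 (norm_toLp_pos hv)), ?_⟩
    rw [smul_smul] at h
    exact congrArg WithLp.ofLp h
  · rintro ⟨c, hc, rfl⟩
    refine Subtype.ext ?_
    rw [coe_dir hu, coe_dir hv, WithLp.toLp_smul, norm_smul, Real.norm_of_nonneg hc.le, smul_smul]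
    congr 1
    have := (norm_toLp_pos hv).ne'
    field_simp

theorem dir_smul {c : ℝ} (hc : 0 < c) (u : V3) : dir (c • u) = dir u := by
  by_cases hu : u = 0
  · simp [hu]
  · exact (dir_eq_iff (smul_ne_zero hc.ne' hu) hu).2 ⟨c, hc, rfl⟩

theorem ofLp_ne_zero (s : Sphere2) : (s : EuclideanSpace ℝ (Fin 3)).ofLp ≠ 0 := by
  intro h
  have : (s : EuclideanSpace ℝ (Fin 3)) = 0 := (WithLp.ofLp_eq_zero 2).1 h
  have hs := norm_eq_of_mem_sphere s
  rw [this, norm_zero] at hs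
  exact zero_ne_one hs

theorem dir_ofLp (s : Sphere2) : dir (s : EuclideanSpace ℝ (Fin 3)).ofLp = s := by
  refine Subtype.ext ?_
  rw [coe_dir (ofLp_ne_zero s), WithLp.toLp_ofLp, norm_eq_of_mem_sphere s, inv_one, one_smul]

theorem continuousAt_dir {u : V3} (hu : u ≠ 0) : ContinuousAt dir u := by
  rw [Topology.IsInducing.subtypeVal.continuousAt_iff]
  have h1 : ContinuousAt (fun u : V3 => ‖(WithLp.toLp 2 u : EuclideanSpace ℝ (Fin 3))‖⁻¹ •
      (WithLp.toLp 2 u : EuclideanSpace ℝ (Fin 3))) u := by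
    have h2 : Continuous fun u : V3 => (WithLp.toLp 2 u : EuclideanSpace ℝ (Fin 3)) :=
      PiLp.continuous_toLp 2 _
    exact (h2.norm.continuousAt.inv₀ (norm_toLp_pos hu).ne').smul h2.continuousAt
  refine h1.congr ?_
  filter_upwards [isOpen_compl_singleton.mem_nhds hu] with v hv
  exact (coe_dir hv).symm

/-! ### The three ends -/

/-- The nonnegative vectors with at most one zero coordinate. -/
def quadrant : Set V3 := {x | (∀ i, 0 ≤ x i) ∧ ∀ i, 0 < x (i + 1) + x (i + 2)}

theorem ne_zero_of_mem_quadrant {x : V3} (hx : x ∈ quadrant) : x ≠ 0 := by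
  rintro rfl
  have := hx.2 0
  simp at this

theorem smul_mem_quadrant {c : ℝ} (hc : 0 < c) {x : V3} (hx : x ∈ quadrant) : c • x ∈ quadrant := by
  refine ⟨fun i => mul_nonneg hc.le (hx.1 i), fun i => ?_⟩
  have := mul_pos hc (hx.2 i)
  simpa [mul_add] using this

theorem fold_ne_zero {s : ℝ} (hs : |s| = 1) {x : V3} (hx : ∀ i, 0 ≤ x i) (h0 : x ≠ 0) :
    fold s x ≠ 0 := by
  intro h
  have := unfold_fold hs hx
  rw [h] at this
  apply h0
  rw [← this]
  ext i
  simp [unfold, minc, mean]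

/-- The three points of the sphere that correspond to the vertices of the triangle. -/
def endPoint (i : Fin 3) : Sphere2 := dir (fold 1 (Pi.single i 1))

theorem single_nonneg (i j : Fin 3) : 0 ≤ (Pi.single i 1 : V3) j := by
  by_cases h : j = i
  · subst h; simp
  · simp [h]

theorem single_ne_zero (i : Fin 3) : (Pi.single i 1 : V3) ≠ 0 := by simp

theorem minc_single (i : Fin 3) : minc (Pi.single i 1) = 0 :=
  minc_eq_iff.2 ⟨single_nonneg i, i + 1, by
    have : i + 1 ≠ i := by fin_cases i <;> decide
    simp [this]⟩

theorem endPoint_injective : Function.Injective endPoint := by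
  intro i j h
  obtain ⟨c, hc, h⟩ := (dir_eq_iff (fold_ne_zero (by simp) (single_nonneg i) (single_ne_zero i))
    (fold_ne_zero (by simp) (single_nonneg j) (single_ne_zero j))).1 h
  have h := congrArg unfold h
  rw [unfold_smul hc.le, unfold_fold (by simp) (single_nonneg i),
    unfold_fold (by simp) (single_nonneg j)] at h
  by_contra hij
  have := congrFun h i
  simp [hij] at this

/-- The points of the sphere distinct from the three ends. -/
theorem dir_notMem_range_endPoint {u : V3} (hu : u ≠ 0) :
    dir u ∉ Set.range endPoint ↔ unfold u ∈ quadrant := by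
  constructor
  · intro h
    refine ⟨unfold_nonneg u, fun i => ?_⟩
    by_contra hn
    apply h
    have h1 := unfold_nonneg u (i + 1)
    have h2 := unfold_nonneg u (i + 2)
    have h1 : unfold u (i + 1) = 0 := by linarith
    have h2 : unfold u (i + 2) = 0 := by linarith
    have hx : unfold u = unfold u i • Pi.single i 1 := by
      have n1 : i + 1 ≠ i := by fin_cases i <;> decide
      have n2 : i + 2 ≠ i := by fin_cases i <;> decide
      ext j
      rcases fin3_cases i j with rfl | rfl | rfl
      · simp
      · simp [h1, n1]
      · simp [h2, n2]
    have hm : mean u = 0 := by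
      rw [← abs_eq_zero, ← minc_unfold]
      exact minc_eq_iff.2 ⟨unfold_nonneg u, i + 1, h1⟩
    have hu' : u = unfold u i • fold 1 (Pi.single i 1) := by
      rw [← fold_smul 1 (unfold_nonneg u i), ← hx, fold_unfold (by simp [hm])]
    refine ⟨i, ?_⟩
    have hpos : 0 < unfold u i := (unfold_nonneg u i).lt_of_ne fun h0 => by
      rw [← h0, zero_smul] at hu'
      exact hu hu'
    rw [hu', dir_smul hpos]
    rfl
  · rintro h ⟨i, hi⟩
    obtain ⟨c, hc, hu'⟩ := (dir_eq_iff hu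
      (fold_ne_zero (by simp) (single_nonneg i) (single_ne_zero i))).1 hi.symm
    rw [hu', unfold_smul hc.le, unfold_fold (by simp) (single_nonneg i)] at h
    have := h.2 i
    have n1 : i + 1 ≠ i := by fin_cases i <;> decide
    have n2 : i + 2 ≠ i := by fin_cases i <;> decide
    simp [n1, n2] at this

/-! ### Compatible parametrisations of `T₀` and `T 0` -/

section

variable {γ : Fin 3 → SL3} {P Q : Fin 3 → V3}

/-- The sign of one of the two triangles. -/
def sgn (ε : Bool) : ℝ := if ε then 1 else -1

theorem abs_sgn (ε : Bool) : |sgn ε| = 1 := by cases ε <;> simp [sgn]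

namespace HexagonLift

/-- The scalings of `Q 0` at its two edges that are compatible with the gluings. -/
theorem exists_weights (h : HexagonLift γ P Q) : ∃ A B : ℝ, 0 < A ∧ 0 < B ∧
    (∃ c : ℝ, 0 < c ∧ γ 1 • P 0 = (c * A) • Q 0 ∧ γ 1 • P 1 = c • P 1) ∧
    ∃ c : ℝ, 0 < c ∧ γ 2 • B • Q 0 = c • P 0 ∧ γ 2 • P 2 = c • P 2 := by
  obtain ⟨l, hl, hl'⟩ := h.fixed 1
  obtain ⟨k, hk, hk'⟩ := h.fixed 2
  obtain ⟨a, ha, ha'⟩ := h.map_inner 1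
  obtain ⟨b, hb, hb'⟩ := h.map_outer 2
  refine ⟨a / l, k / b, by positivity, by positivity, ⟨l, hl, ?_, hl'⟩, k, hk, ?_, hk'⟩
  · rw [mul_div_cancel₀ _ hl.ne']; exact ha'
  · rw [sl_smul_smul, show γ 2 • Q 0 = b • P 0 from hb', smul_smul, div_mul_cancel₀ _ hb.ne']

/-- An interpolation of the two scalings of `Q 0`. -/
def weight (h : HexagonLift γ P Q) (x : V3) : ℝ :=
  -- It takes the first scaling on `x 2 = 0` and the second on `x 1 = 0`. As it does not involve `x
  -- 0`, multiplying coordinate `0` by it is invertible.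
  (x 1 * h.exists_weights.choose + x 2 * h.exists_weights.choose_spec.choose) / (x 1 + x 2)

theorem weight_pos (h : HexagonLift γ P Q) {x : V3} (h1 : 0 ≤ x 1) (h2 : 0 ≤ x 2)
    (h12 : 0 < x 1 + x 2) : 0 < h.weight x := by
  obtain ⟨hA, hB, -⟩ := h.exists_weights.choose_spec.choose_spec
  refine div_pos ?_ h12
  rcases h1.eq_or_lt with h0 | h0
  · rw [← h0] at h12 ⊢
    have : 0 < x 2 := by linarith
    positivity
  · positivity

theorem weight_pos_of_mem (h : HexagonLift γ P Q) {x : V3} (hx : x ∈ quadrant) : 0 < h.weight x :=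
  h.weight_pos (hx.1 1) (hx.1 2) (hx.2 0)

theorem weight_congr (h : HexagonLift γ P Q) {x y : V3} (h1 : x 1 = y 1) (h2 : x 2 = y 2) :
    h.weight x = h.weight y := by
  simp only [weight, h1, h2]

theorem weight_smul (h : HexagonLift γ P Q) {c : ℝ} (hc : c ≠ 0) (x : V3) :
    h.weight (c • x) = h.weight x := by
  simp only [weight, Pi.smul_apply, smul_eq_mul]
  rw [← mul_add, mul_assoc, mul_assoc, ← mul_add, mul_div_mul_left _ _ hc]

theorem continuousAt_weight (h : HexagonLift γ P Q) {x : V3} (hx : x ∈ quadrant) :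
    ContinuousAt h.weight x := by
  unfold weight
  exact ContinuousAt.div (by fun_prop) (by fun_prop) (hx.2 0).ne'

/-- The frames of the triangles `T₀` and `T 0`. -/
def frame (P Q : Fin 3 → V3) : Bool → Fin 3 → V3
  | true => P
  | false => Function.update P 0 (Q 0)

theorem linearIndependent_frame (h : HexagonLift γ P Q) (ε : Bool) :
    LinearIndependent ℝ (frame P Q ε) := by
  cases ε
  · exact h.linearIndependent_update 0
  · exact h.linearIndependent

/-- The scaling of the coordinates. -/
def scale (h : HexagonLift γ P Q) : Bool → V3 → ℝ
  | true, _ => 1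
  | false, x => h.weight x

theorem scale_pos (h : HexagonLift γ P Q) (ε : Bool) {x : V3} (hx : x ∈ quadrant) :
    0 < h.scale ε x := by
  cases ε
  · exact h.weight_pos_of_mem hx
  · exact one_pos

theorem scale_congr (h : HexagonLift γ P Q) (ε : Bool) {x y : V3} (h1 : x 1 = y 1)
    (h2 : x 2 = y 2) : h.scale ε x = h.scale ε y := by
  cases ε
  · exact h.weight_congr h1 h2
  · rfl

theorem scale_smul (h : HexagonLift γ P Q) (ε : Bool) {c : ℝ} (hc : c ≠ 0) (x : V3) :
    h.scale ε (c • x) = h.scale ε x := by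
  cases ε
  · exact h.weight_smul hc x
  · rfl

theorem continuousAt_scale (h : HexagonLift γ P Q) (ε : Bool) {x : V3} (hx : x ∈ quadrant) :
    ContinuousAt (h.scale ε) x := by
  cases ε
  · exact h.continuousAt_weight hx
  · exact continuousAt_const

/-- The parametrisation of the triangles `T₀` and `T 0`. -/
def sect (h : HexagonLift γ P Q) (ε : Bool) (x : V3) : V3 :=
  ∑ i, Function.update x 0 (h.scale ε x * x 0) i • frame P Q ε i

/-- The coordinates of a vector in the frame of a triangle. -/
def frameCoord (P Q : Fin 3 → V3) (ε : Bool) (v : V3) : V3 := fun i =>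
  (det3 (frame P Q ε 0) (frame P Q ε 1) (frame P Q ε 2))⁻¹ * coord (frame P Q ε) i v

/-- The inverse of the parametrisation. -/
def tileCoord (h : HexagonLift γ P Q) (ε : Bool) (v : V3) : V3 :=
  Function.update (frameCoord P Q ε v) 0
    ((h.scale ε (frameCoord P Q ε v))⁻¹ * frameCoord P Q ε v 0)

theorem frameCoord_sum (h : HexagonLift γ P Q) (ε : Bool) (a : V3) :
    frameCoord P Q ε (∑ i, a i • frame P Q ε i) = a := by
  have hD := det3_ne_zero_iff.2 (h.linearIndependent_frame ε)
  ext i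
  simp only [frameCoord]
  rw [coord_sum, inv_mul_cancel_left₀ hD]

theorem update_mem_quadrant {x : V3} (hx : x ∈ quadrant) {c : ℝ} (hc : 0 < c) :
    Function.update x 0 (c * x 0) ∈ quadrant := by
  have h0 := hx.1 0
  have h1 := hx.1 1
  have h2 := hx.1 2
  have h01 := hx.2 2
  have h12 := hx.2 0
  have h20 := hx.2 1
  simp only [Fin.isValue, Fin.reduceAdd, zero_add] at h01 h12 h20
  have key : ∀ y : ℝ, 0 ≤ y → 0 < x 0 + y → 0 < c * x 0 + y := fun y hy h => by
    rcases h0.eq_or_lt with h' | h'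
    · rw [← h'] at h ⊢; linarith
    · positivity
  refine ⟨fun i => ?_, fun i => ?_⟩
  · fin_cases i
    · simpa using mul_nonneg hc.le h0
    · simpa using h1
    · simpa using h2
  · fin_cases i
    · simpa using h12
    · have := key (x 2) h2 (by linarith)
      simp; linarith
    · have := key (x 1) h1 h01
      simpa using this

theorem cone_base (h : HexagonLift γ P Q) (ε : Bool) :
    h.tiling.cone (1, 0, ε) = {v | ∃ a ∈ quadrant, v = ∑ i, a i • frame P Q ε i} := by
  have key : ∀ e : Fin 3 → V3, pointedCone (e 0) (e 1) (e 2) =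
      {v | ∃ a ∈ quadrant, v = ∑ i, a i • e i} := fun e => by
    ext v
    constructor
    · rintro ⟨a, b, c, ha, hb, hc, hab, hbc, hca, rfl⟩
      refine ⟨![a, b, c], ⟨fun i => ?_, fun i => ?_⟩, ?_⟩
      · fin_cases i <;> assumption
      · fin_cases i <;> assumption
      · rw [Fin.sum_univ_three]; rfl
    · rintro ⟨a, ⟨ha, hab⟩, rfl⟩
      refine ⟨a 0, a 1, a 2, ha 0, ha 1, ha 2, hab 2, hab 0, hab 1, ?_⟩
      rw [Fin.sum_univ_three]
  cases ε
  · rw [cone_false, OneMemClass.coe_one, one_smul, ← key]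
    rfl
  · rw [cone_true, OneMemClass.coe_one, one_smul, ← key]
    rfl

theorem sect_mem (h : HexagonLift γ P Q) (ε : Bool) {x : V3} (hx : x ∈ quadrant) :
    h.sect ε x ∈ h.tiling.cone (1, 0, ε) := by
  rw [cone_base]
  exact ⟨_, update_mem_quadrant hx (h.scale_pos ε hx), rfl⟩

theorem frameCoord_sect (h : HexagonLift γ P Q) (ε : Bool) (x : V3) :
    frameCoord P Q ε (h.sect ε x) = Function.update x 0 (h.scale ε x * x 0) :=
  h.frameCoord_sum ε _

theorem tileCoord_sect (h : HexagonLift γ P Q) (ε : Bool) {x : V3} (hx : x ∈ quadrant) :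
    h.tileCoord ε (h.sect ε x) = x := by
  have hs := (h.scale_pos ε hx).ne'
  rw [tileCoord, frameCoord_sect,
    h.scale_congr ε (x := Function.update x 0 _) (y := x) (by simp) (by simp)]
  simp [inv_mul_cancel_left₀ hs]

theorem frameCoord_mem_quadrant (h : HexagonLift γ P Q) {ε : Bool} {v : V3}
    (hv : v ∈ h.tiling.cone (1, 0, ε)) : frameCoord P Q ε v ∈ quadrant := by
  rw [cone_base] at hv
  obtain ⟨a, ha, rfl⟩ := hv
  rwa [h.frameCoord_sum]

theorem tileCoord_mem_quadrant (h : HexagonLift γ P Q) {ε : Bool} {v : V3}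
    (hv : v ∈ h.tiling.cone (1, 0, ε)) : h.tileCoord ε v ∈ quadrant :=
  update_mem_quadrant (h.frameCoord_mem_quadrant hv)
    (inv_pos.2 (h.scale_pos ε (h.frameCoord_mem_quadrant hv)))

theorem sect_tileCoord (h : HexagonLift γ P Q) {ε : Bool} {v : V3}
    (hv : v ∈ h.tiling.cone (1, 0, ε)) : h.sect ε (h.tileCoord ε v) = v := by
  have hq := h.frameCoord_mem_quadrant hv
  have hs := (h.scale_pos ε hq).ne'
  rw [sect, h.scale_congr ε (y := frameCoord P Q ε v) (by simp [tileCoord]) (by simp [tileCoord])]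
  simp only [tileCoord, Function.update_self, mul_inv_cancel_left₀ hs, Function.update_idem,
    Function.update_eq_self]
  rw [cone_base] at hv
  obtain ⟨a, ha, rfl⟩ := hv
  rw [h.frameCoord_sum]

theorem tileCoord_smul (h : HexagonLift γ P Q) (ε : Bool) {c : ℝ} (hc : c ≠ 0) (v : V3) :
    h.tileCoord ε (c • v) = c • h.tileCoord ε v := by
  have h1 : frameCoord P Q ε (c • v) = c • frameCoord P Q ε v := by
    ext i
    simp only [frameCoord, coord_smul, Pi.smul_apply, smul_eq_mul]
    ring
  rw [tileCoord, tileCoord, h1, h.scale_smul ε hc]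
  ext i
  fin_cases i
  · simp; ring
  · simp
  · simp

theorem continuous_frameCoord (ε : Bool) : Continuous (frameCoord P Q ε) := by
  unfold frameCoord
  exact continuous_pi fun i => continuous_const.mul (continuous_coord _ i)

theorem continuousAt_tileCoord (h : HexagonLift γ P Q) {ε : Bool} {v : V3}
    (hv : v ∈ h.tiling.cone (1, 0, ε)) : ContinuousAt (h.tileCoord ε) v := by
  have hq := h.frameCoord_mem_quadrant hv
  have h1 : ContinuousAt (frameCoord P Q ε) v := (continuous_frameCoord ε).continuousAt
  have h2 : ContinuousAt (fun v => h.scale ε (frameCoord P Q ε v)) v :=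
    (h.continuousAt_scale ε hq).comp h1
  exact h1.update 0 ((h2.inv₀ (h.scale_pos ε hq).ne').mul
    ((continuous_apply 0).continuousAt.comp h1))

theorem continuousAt_sect (h : HexagonLift γ P Q) (ε : Bool) {x : V3} (hx : x ∈ quadrant) :
    ContinuousAt (h.sect ε) x := by
  have h1 : ContinuousAt (fun x => Function.update x 0 (h.scale ε x * x 0)) x :=
    continuousAt_id.update 0 ((h.continuousAt_scale ε hx).mul (continuous_apply 0).continuousAt)
  have h2 : Continuous fun a : V3 => ∑ i, a i • frame P Q ε i := by fun_prop
  exact h2.continuousAt.comp h1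

/-- The elements that move `T 0` to the triangles adjacent to `T₀`. -/
def glue (γ : Fin 3 → SL3) : Fin 3 → holGroup γ := ![1, gen γ 2, (gen γ 1)⁻¹]

/-- The product of the gluings met when turning once around the vertex `i`; it becomes the holonomy
of the end `i`. -/
theorem glue_mul_inv (h : HexagonLift γ P Q) (i : Fin 3) :
    glue γ (i + 1) * (glue γ (i + 2))⁻¹ = (gen γ i)⁻¹ := by
  fin_cases i
  · change gen γ 2 * (gen γ 1)⁻¹⁻¹ = (gen γ 0)⁻¹
    rw [inv_inv]
    exact eq_inv_of_mul_eq_one_left (Subtype.ext h.prod_eq_one)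
  · change (gen γ 1)⁻¹ * 1⁻¹ = (gen γ 1)⁻¹
    simp
  · change 1 * (gen γ 2)⁻¹ = (gen γ 2)⁻¹
    simp

/-- The two parametrisations agree on the edges, up to the gluings. -/
theorem sect_true_eq (h : HexagonLift γ P Q) {x : V3} (hx : x ∈ quadrant) {i : Fin 3}
    (hi : x i = 0) : ∃ c : ℝ, 0 < c ∧ h.sect true x = c • (glue γ i : SL3) • h.sect false x := by
  have e1 : h.sect true x = x 0 • P 0 + x 1 • P 1 + x 2 • P 2 := by
    simp [sect, Fin.sum_univ_three, scale, frame]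
  have e2 : h.sect false x = (h.weight x * x 0) • Q 0 + x 1 • P 1 + x 2 • P 2 := by
    simp [sect, Fin.sum_univ_three, scale, frame]
  obtain ⟨-, -, ⟨c, hc, h0, h1⟩, d, hd, h0', h2⟩ := h.exists_weights.choose_spec.choose_spec
  rw [e1, e2]
  fin_cases i
  · refine ⟨1, one_pos, ?_⟩
    have hi : x 0 = 0 := hi
    simp [glue, hi]
  · have hi : x 1 = 0 := hi
    have hx2 : x 2 ≠ 0 := by
      have := hx.2 0
      simp only [Fin.isValue, zero_add, hi] at this
      exact this.ne'
    refine ⟨d⁻¹, inv_pos.2 hd, ?_⟩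
    have hw : h.weight x = h.exists_weights.choose_spec.choose := by
      simp [weight, hi, hx2]
    change _ = d⁻¹ • γ 2 • _
    rw [sl_smul_smul] at h0'
    rw [hw, hi, zero_smul, add_zero, add_zero, smul_add, mul_comm, mul_smul,
      sl_smul_smul, sl_smul_smul, sl_smul_smul, h0', h2, smul_comm _ d, smul_comm _ d, ← smul_add,
      inv_smul_smul₀ hd.ne']
  · have hi : x 2 = 0 := hi
    have hx1 : x 1 ≠ 0 := by
      have := hx.2 0
      simp only [Fin.isValue, zero_add] at this
      change 0 < x 1 + x 2 at this
      rw [hi, add_zero] at this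
      exact this.ne'
    refine ⟨c, hc, ?_⟩
    obtain ⟨w, hw, h0⟩ : ∃ w, h.weight x = w ∧ γ 1 • P 0 = (c * w) • Q 0 :=
      ⟨_, by simp [weight, hi, hx1], h0⟩
    change _ = c • (γ 1)⁻¹ • _
    rw [← sl_smul_smul, eq_inv_smul_iff, hw, hi, zero_smul, add_zero, add_zero,
      smul_add, sl_smul_smul, sl_smul_smul, h0, h1]
    module

end HexagonLift

end

section

namespace ConvexTiling

variable {E : Type*} (t : ConvexTiling E)

theorem mem_cone_of_mem_star {e : E} {v : V3} (hv : v ∈ t.star e) (h : 0 ≤ t.side e v) :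
    v ∈ t.cone e := by
  obtain ⟨h₁, h₂, -, -⟩ := hv
  exact ⟨h, h₁.le, h₂.le, by linarith, by linarith, by linarith⟩

theorem star_rev (e : E) : t.star (t.rev e) = t.star e := by
  ext v
  simp only [star, t.rev_rev, Set.mem_ofPred_eq]
  tauto

end ConvexTiling

variable {γ : Fin 3 → SL3} {P Q : Fin 3 → V3}

namespace HexagonLift

/-! ### The map to the sphere -/

/-- The point of the sphere that corresponds to a vector of the triangle `(g, 0, ε)`. -/
def tileDir (h : HexagonLift γ P Q) (g : holGroup γ) (ε : Bool) (v : V3) : Sphere2 :=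
  dir (fold (sgn ε) (h.tileCoord ε ((g : SL3)⁻¹ • v)))

theorem mem_cone_iff (h : HexagonLift γ P Q) {g : holGroup γ} {ε : Bool} {v : V3} :
    v ∈ h.tiling.cone (g, 0, ε) ↔ (g : SL3)⁻¹ • v ∈ h.tiling.cone (1, 0, ε) := by
  have := h.smul_mem_cone_translate g (1, 0, ε) (v := (g : SL3)⁻¹ • v)
  rwa [smul_inv_smul, translate, mul_one] at this

/-- Since the `T i` are translates of `T 0`, every tile has a label of index `0`. With
`eq_of_sameTile`, tiles correspond to pairs of a group element and a kind. -/
theorem exists_base_tile (h : HexagonLift γ P Q) (e : TileEdge γ) :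
    ∃ g, h.tiling.SameTile e (g, 0, e.2.2) := by
  obtain ⟨g, i, _ | _⟩ := e
  · fin_cases i
    · exact ⟨g, Or.inl rfl⟩
    · exact ⟨g * gen γ 2, Or.inr (Or.inr (rot_rot_false h.prod_eq_one g 1).symm)⟩
    · exact ⟨g * (gen γ 1)⁻¹, Or.inr (Or.inl rfl)⟩
  · fin_cases i
    · exact ⟨g, Or.inl rfl⟩
    · exact ⟨g, Or.inr (Or.inl rfl)⟩
    · exact ⟨g, Or.inr (Or.inr rfl)⟩

theorem sameTile_glue (h : HexagonLift γ P Q) (g : holGroup γ) (i : Fin 3) :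
    h.tiling.SameTile (g, i, false) (g * glue γ i, 0, false) := by
  fin_cases i
  · exact Or.inl (by simp [glue])
  · exact Or.inr (Or.inr (rot_rot_false h.prod_eq_one g 1).symm)
  · exact Or.inr (Or.inl rfl)

theorem eq_of_sameTile {h : HexagonLift γ P Q} {g g' : holGroup γ} {ε ε' : Bool}
    (hs : h.tiling.SameTile (g, 0, ε) (g', 0, ε')) : g' = g ∧ ε' = ε := by
  have hk : ε' = ε := sameTile_kind hs
  subst hk
  refine ⟨?_, rfl⟩
  have := eq_one_of_sameTile (h := h) (e := (g, 0, ε')) (g := g' * g⁻¹)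
    (by rwa [translate, inv_mul_cancel_right])
  exact mul_inv_eq_one.1 this

theorem exists_mem_cone (h : HexagonLift γ P Q) {v : V3} (hv : v ∈ h.tiling.dom) :
    ∃ p : holGroup γ × Bool, v ∈ h.tiling.cone (p.1, 0, p.2) := by
  obtain ⟨e, he⟩ := Set.mem_iUnion.1 hv
  obtain ⟨g, hg⟩ := h.exists_base_tile e
  exact ⟨(g, e.2.2), by rwa [ConvexTiling.SameTile.cone_eq _ hg]⟩

/-- On the edge a coordinate vanishes, hence the smallest one is `0` and the two folds agree there;
`sect_true_eq` ensures that both tiles give the point the same coordinates up to a positive factor.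
-/
theorem tileDir_eq_of_edge (h : HexagonLift γ P Q) {g g' : holGroup γ} {i : Fin 3} {v : V3}
    (hv : v ∈ h.tiling.cone (g, 0, true))
    (hs : h.tiling.SameTile (g, i, false) (g', 0, false)) (hi : h.tiling.side (g, i, true) v = 0) :
    h.tileDir g' false v = h.tileDir g true v := by
  have hg' : g' = g * glue γ i :=
    (eq_of_sameTile ((ConvexTiling.SameTile.symm _ (h.sameTile_glue g i)).trans _ hs)).1
  set w := (g : SL3)⁻¹ • v with hw
  have hvw : v = (g : SL3) • w := by rw [hw, smul_inv_smul]
  have hwc : w ∈ h.tiling.cone (1, 0, true) := h.mem_cone_iff.1 hv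
  set x := h.tileCoord true w with hx
  have hxq : x ∈ quadrant := h.tileCoord_mem_quadrant hwc
  have hxi : x i = 0 := by
    have h1 : h.tiling.side (1, i, true) w = 0 := by
      rw [← h.side_translate g, ← hvw, translate, mul_one]; exact hi
    have h2 : coord P i w = 0 := by
      rw [← h1]
      change det3 _ _ w = det3 ((1 : SL3) • P (i + 1)) ((1 : SL3) • P (i + 2 + 2 + 1)) w
      rw [one_smul, one_smul, fin3_add_two_add_two, fin3_add_one_add_one]
    have h3 : frameCoord P Q true w i = 0 := by
      simp only [frameCoord, frame, h2, mul_zero]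
    rw [hx, tileCoord]
    by_cases h0 : i = 0
    · subst h0; simp [h3]
    · simp [h0, h3]
  obtain ⟨c, hc, hxc⟩ := h.sect_true_eq hxq hxi
  rw [hx, h.sect_tileCoord hwc, ← hx] at hxc
  have h4 : (g' : SL3)⁻¹ • v = c • h.sect false x := by
    rw [hvw, hg', Subgroup.coe_mul, mul_inv_rev, mul_smul, inv_smul_smul, inv_smul_eq_iff,
      sl_smul_smul]
    exact hxc
  have hm : minc x = 0 := minc_eq_iff.2 ⟨hxq.1, i, hxi⟩
  rw [tileDir, tileDir, h4, h.tileCoord_smul _ hc.ne', h.tileCoord_sect _ hxq, fold_smul _ hc.le,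
    dir_smul hc, fold_eq_of_minc_eq_zero hm]

theorem tileDir_eq (h : HexagonLift γ P Q) {g g' : holGroup γ} {ε ε' : Bool} {v : V3}
    (hv : v ∈ h.tiling.cone (g, 0, ε)) (hv' : v ∈ h.tiling.cone (g', 0, ε')) :
    h.tileDir g' ε' v = h.tileDir g ε v := by
  rcases h.tiling.sameTile_or_edge hv hv' with hs | ⟨⟨k, i, ε₁⟩, hi, hi', h0⟩
  · obtain ⟨rfl, rfl⟩ := eq_of_sameTile hs
    rfl
  · have hk₁ : ε₁ = ε := sameTile_kind hi
    have hk₂ : ε' = !ε₁ := sameTile_kind hi'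
    subst hk₁
    cases ε₁
    · obtain rfl : ε' = true := hk₂
      have hkg : k = g' := by
        have h1 : h.tiling.SameTile (k, i, true) (g', 0, true) := hi'
        have h2 : h.tiling.SameTile (k, i, true) (k, 0, true) := by
          obtain ⟨g'', hg''⟩ := h.exists_base_tile (k, i, true)
          rcases hg'' with hg | hg | hg <;>
          · have := congrArg Prod.fst hg
            obtain rfl : g'' = k := this
            first | exact Or.inl hg | exact Or.inr (Or.inl hg) | exact Or.inr (Or.inr hg)
        exact ((eq_of_sameTile ((ConvexTiling.SameTile.symm _ h2).trans _ h1)).1).symm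
      subst hkg
      refine (h.tileDir_eq_of_edge hv' (ConvexTiling.SameTile.symm _ hi) ?_).symm
      have h1 : h.tiling.side (h.tiling.rev (k, i, false)) v = 0 := by
        refine le_antisymm (not_lt.1 fun h2 => ?_) ?_
        · rw [ConvexTiling.side_rev_pos] at h2; linarith
        · rw [ConvexTiling.side_rev_nonneg]; linarith
      exact h1
    · obtain rfl : ε' = false := hk₂
      have hkg : k = g := by
        rcases hi with hg | hg | hg <;> exact congrArg Prod.fst hg
      subst hkg
      exact h.tileDir_eq_of_edge hv hi' h0

open Classical in
/-- The map from the cone over the domain to the sphere. -/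
def domDir (h : HexagonLift γ P Q) (v : V3) : Sphere2 :=
  if hv : v ∈ h.tiling.dom then
    h.tileDir (h.exists_mem_cone hv).choose.1 (h.exists_mem_cone hv).choose.2 v
  else endPoint 0

theorem domDir_eq (h : HexagonLift γ P Q) {g : holGroup γ} {ε : Bool} {v : V3}
    (hv : v ∈ h.tiling.cone (g, 0, ε)) : h.domDir v = h.tileDir g ε v := by
  have hd : v ∈ h.tiling.dom := Set.mem_iUnion.2 ⟨_, hv⟩
  rw [domDir, dif_pos hd]
  exact h.tileDir_eq hv (h.exists_mem_cone hd).choose_spec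

theorem domDir_smul (h : HexagonLift γ P Q) {c : ℝ} (hc : 0 < c) {v : V3}
    (hv : v ∈ h.tiling.dom) : h.domDir (c • v) = h.domDir v := by
  obtain ⟨⟨g, ε⟩, hg⟩ := h.exists_mem_cone hv
  rw [h.domDir_eq hg, h.domDir_eq (h.tiling.smul_mem_cone hc hg), tileDir, sl_smul_smul,
    h.tileCoord_smul _ hc.ne', fold_smul _ hc.le, dir_smul hc, tileDir]

theorem domDir_smul_group (h : HexagonLift γ P Q) (k : holGroup γ) {v : V3}
    (hv : v ∈ h.tiling.dom) : h.domDir ((k : SL3) • v) = h.domDir v := by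
  obtain ⟨⟨g, ε⟩, hg⟩ := h.exists_mem_cone hv
  have hk : (k : SL3) • v ∈ h.tiling.cone (k * g, 0, ε) :=
    (h.smul_mem_cone_translate k (g, 0, ε)).2 hg
  rw [h.domDir_eq hg, h.domDir_eq hk, tileDir, Subgroup.coe_mul, mul_inv_rev, mul_smul,
    inv_smul_smul, tileDir]

theorem domDir_sect (h : HexagonLift γ P Q) (ε : Bool) {x : V3} (hx : x ∈ quadrant) :
    h.domDir (h.sect ε x) = dir (fold (sgn ε) x) := by
  rw [h.domDir_eq (h.sect_mem ε hx), tileDir]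
  simp only [OneMemClass.coe_one, inv_one, one_smul]
  rw [h.tileCoord_sect ε hx]

theorem continuousAt_tileDir (h : HexagonLift γ P Q) {g : holGroup γ} {ε : Bool} {v : V3}
    (hv : v ∈ h.tiling.cone (g, 0, ε)) : ContinuousAt (h.tileDir g ε) v := by
  have hv := h.mem_cone_iff.1 hv
  have hq := h.tileCoord_mem_quadrant hv
  refine ContinuousAt.comp (g := dir)
    (continuousAt_dir (fold_ne_zero (abs_sgn ε) hq.1 (ne_zero_of_mem_quadrant hq))) ?_
  refine (continuous_fold _).continuousAt.comp ?_
  exact ContinuousAt.comp (g := h.tileCoord ε) (h.continuousAt_tileCoord hv)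
    (continuous_smul_sl _).continuousAt

/-- The star of an edge is cut by the line of the edge into two relatively closed pieces, each
within a single tile where the map is a continuous `tileDir`; the two pieces are pasted. -/
theorem continuousAt_domDir (h : HexagonLift γ P Q) {v : V3} (hv : v ∈ h.tiling.dom) :
    ContinuousAt h.domDir v := by
  obtain ⟨e, he⟩ := h.tiling.exists_mem_star_of_mem_dom hv
  have key : ∀ e : TileEdge γ, v ∈ h.tiling.star e →
      ContinuousWithinAt h.domDir {w | 0 ≤ h.tiling.side e w} v := by
    intro e he
    by_cases hs : 0 ≤ h.tiling.side e v
    · obtain ⟨g, hg⟩ := h.exists_base_tile e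
      have hcone : ∀ w ∈ h.tiling.star e, 0 ≤ h.tiling.side e w →
          w ∈ h.tiling.cone (g, 0, e.2.2) := fun w hw hw' => by
        rw [ConvexTiling.SameTile.cone_eq _ hg]
        exact h.tiling.mem_cone_of_mem_star hw hw'
      refine ((h.continuousAt_tileDir (hcone v he hs)).continuousWithinAt
        (s := {w | 0 ≤ h.tiling.side e w})).congr_of_eventuallyEq ?_ (h.domDir_eq (hcone v he hs))
      filter_upwards [self_mem_nhdsWithin,
        mem_nhdsWithin_of_mem_nhds ((h.tiling.isOpen_star e).mem_nhds he)] with w hw hw'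
      exact h.domDir_eq (hcone w hw' hw)
    · refine continuousWithinAt_of_notMem_closure ?_
      rwa [(isClosed_le continuous_const (h.tiling.continuous_side e)).closure_eq]
  have h2 := key (h.tiling.rev e) (by rwa [ConvexTiling.star_rev])
  rw [← continuousWithinAt_univ]
  refine ((key e he).union h2).mono fun w _ => ?_
  rcases le_total 0 (h.tiling.side e w) with hw | hw
  · exact Or.inl hw
  · exact Or.inr ((h.tiling.side_rev_nonneg).2 hw)

/-! ### The quotient surface -/

/-- The quotient of the domain. -/
abbrev Surface (h : HexagonLift γ P Q) : Type := OrbitSpace (holGroup γ) h.Omega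

/-- The point of the domain defined by a vector. -/
def toOmega (h : HexagonLift γ P Q) (v : h.tiling.dom) : h.Omega := ⟨toP v, v, v.2, rfl⟩

/-- The projection to the surface. -/
def proj (h : HexagonLift γ P Q) (x : h.Omega) : h.Surface :=
  Quotient.mk (orbitSetoid (holGroup γ) h.Omega) x

theorem continuous_toOmega (h : HexagonLift γ P Q) : Continuous h.toOmega :=
  Continuous.subtype_mk (continuous_iff_continuousAt.2 fun v =>
    (continuousAt_toP (h.tiling.ne_zero_of_mem_dom v.2)).comp continuous_subtype_val.continuousAt) _

theorem exists_toOmega (h : HexagonLift γ P Q) (x : h.Omega) : ∃ v, h.toOmega v = x := by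
  obtain ⟨_, v, hv, rfl⟩ := x
  exact ⟨⟨v, hv⟩, rfl⟩

theorem isOpenMap_toOmega (h : HexagonLift γ P Q) : IsOpenMap h.toOmega := by
  intro U hU
  -- `U` is saturated under positive scaling, which does not change its image, so that
  -- `isOpen_toP_image` applies.
  let S : Set V3 := ⋃ c : {c : ℝ // 0 < c}, (fun v : V3 => (c : ℝ) • v) ⁻¹' (Subtype.val '' U)
  have hUo : IsOpen (Subtype.val '' U) := h.tiling.isOpen_dom.isOpenMap_subtype_val U hU
  have hS : IsOpen S := isOpen_iUnion fun c => hUo.preimage (continuous_const_smul _)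
  have hcone : ∀ c : ℝ, 0 < c → ∀ v ∈ S, c • v ∈ S := fun c hc v hv => by
    obtain ⟨d, hd⟩ := Set.mem_iUnion.1 hv
    refine Set.mem_iUnion.2 ⟨⟨d * c⁻¹, mul_pos d.2 (inv_pos.2 hc)⟩, ?_⟩
    change (d * c⁻¹ : ℝ) • c • v ∈ (Subtype.val '' U : Set V3)
    rwa [smul_smul, inv_mul_cancel_right₀ hc.ne']
  have h0 : (0 : V3) ∉ S := fun h0 => by
    obtain ⟨d, v, -, hv⟩ := Set.mem_iUnion.1 h0
    exact h.tiling.ne_zero_of_mem_dom v.2 (by rw [hv]; exact smul_zero _)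
  convert! (ConvexTiling.isOpen_toP_image hcone h0 hS).preimage
    (continuous_subtype_val (p := fun x => x ∈ h.Omega)) using 1
  ext x
  constructor
  · rintro ⟨v, hv, rfl⟩
    exact ⟨v, Set.mem_iUnion.2 ⟨⟨1, one_pos⟩, v, hv, (one_smul ℝ _).symm⟩, rfl⟩
  · rintro ⟨v, hv, hvx⟩
    obtain ⟨d, w, hw, hd⟩ := Set.mem_iUnion.1 hv
    refine ⟨w, hw, Subtype.ext ?_⟩
    rw [← hvx, ← toP_smul d.2.ne']
    exact congrArg toP hd

theorem proj_toOmega_eq_iff (h : HexagonLift γ P Q) {v w : h.tiling.dom} :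
    h.proj (h.toOmega v) = h.proj (h.toOmega w) ↔
      ∃ g : holGroup γ, ∃ c : ℝ, 0 < c ∧ (g : SL3) • (v : V3) = c • (w : V3) := by
  rw [proj, proj, Quotient.eq]
  constructor
  · rintro ⟨g, hg, hvw⟩
    exact ⟨⟨g, hg⟩, h.smul_eq_of_smul_toP hg v.2 w.2 hvw⟩
  · rintro ⟨g, c, hc, hvw⟩
    refine ⟨g, g.2, ?_⟩
    change (g : SL3) • toP v = toP w
    rw [smul_toP _ (h.tiling.ne_zero_of_mem_dom v.2), hvw, toP_smul hc.ne']

/-- The map from the surface to the sphere. -/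
def toSphere (h : HexagonLift γ P Q) (z : h.Surface) : Sphere2 :=
  h.domDir (h.exists_toOmega z.out).choose

theorem toSphere_proj (h : HexagonLift γ P Q) (v : h.tiling.dom) :
    h.toSphere (h.proj (h.toOmega v)) = h.domDir v := by
  set z := h.proj (h.toOmega v)
  have h1 : h.proj (h.toOmega (h.exists_toOmega z.out).choose) = z := by
    rw [(h.exists_toOmega z.out).choose_spec]
    exact Quotient.out_eq z
  obtain ⟨g, c, hc, hg⟩ := h.proj_toOmega_eq_iff.1 h1
  rw [toSphere, ← h.domDir_smul hc v.2, ← hg, h.domDir_smul_group g (Subtype.prop _)]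

theorem isQuotientMap_proj_toOmega (h : HexagonLift γ P Q) :
    Topology.IsQuotientMap fun v => h.proj (h.toOmega v) :=
  h.isQuotientCoveringMap.toIsQuotientMap.comp
    (h.isOpenMap_toOmega.isQuotientMap h.continuous_toOmega h.exists_toOmega)

theorem continuous_toSphere (h : HexagonLift γ P Q) : Continuous h.toSphere := by
  rw [h.isQuotientMap_proj_toOmega.continuous_iff]
  have : h.toSphere ∘ (fun v => h.proj (h.toOmega v)) = fun v : h.tiling.dom => h.domDir v :=
    funext h.toSphere_proj
  rw [this]
  exact continuous_iff_continuousAt.2 fun v =>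
    (h.continuousAt_domDir v.2).comp continuous_subtype_val.continuousAt

/-- The parametrisation of the surface by one of the two triangles. -/
def tilePoint (h : HexagonLift γ P Q) (ε : Bool) (x : quadrant) : h.Surface :=
  h.proj (h.toOmega ⟨h.sect ε x, Set.mem_iUnion.2 ⟨_, h.sect_mem ε x.2⟩⟩)

theorem toSphere_tilePoint (h : HexagonLift γ P Q) (ε : Bool) (x : quadrant) :
    h.toSphere (h.tilePoint ε x) = dir (fold (sgn ε) x) := by
  rw [tilePoint, toSphere_proj, h.domDir_sect ε x.2]

theorem continuous_tilePoint (h : HexagonLift γ P Q) (ε : Bool) : Continuous (h.tilePoint ε) := by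
  refine h.isQuotientMap_proj_toOmega.continuous.comp (Continuous.subtype_mk ?_ _)
  exact continuous_iff_continuousAt.2 fun x =>
    (h.continuousAt_sect ε x.2).comp continuous_subtype_val.continuousAt

theorem exists_tilePoint_eq (h : HexagonLift γ P Q) (z : h.Surface) :
    ∃ ε x, z = h.tilePoint ε x := by
  obtain ⟨v, rfl⟩ := h.isQuotientMap_proj_toOmega.surjective z
  obtain ⟨⟨g, ε⟩, hg⟩ := h.exists_mem_cone v.2
  have hg := h.mem_cone_iff.1 hg
  refine ⟨ε, ⟨_, h.tileCoord_mem_quadrant hg⟩, ?_⟩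
  refine h.proj_toOmega_eq_iff.2 ⟨g⁻¹, 1, one_pos, ?_⟩
  rw [one_smul]
  exact (h.sect_tileCoord hg).symm

theorem tilePoint_eq_of_boundary (h : HexagonLift γ P Q) {x : quadrant} (hx : minc x = 0)
    (ε ε' : Bool) : h.tilePoint ε x = h.tilePoint ε' x := by
  have key : h.tilePoint true x = h.tilePoint false x := by
    obtain ⟨i, hi⟩ := exists_minc_eq x
    obtain ⟨c, hc, hs⟩ := h.sect_true_eq x.2 (hi.trans hx)
    refine h.proj_toOmega_eq_iff.2 ⟨(glue γ i)⁻¹, c, hc, ?_⟩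
    simp only [hs, Subgroup.coe_inv, sl_smul_smul, inv_smul_smul]
  cases ε <;> cases ε' <;> first | rfl | exact key | exact key.symm

theorem tilePoint_smul (h : HexagonLift γ P Q) (ε : Bool) {c : ℝ} (hc : 0 < c) (x : quadrant) :
    h.tilePoint ε ⟨c • x, smul_mem_quadrant hc x.2⟩ = h.tilePoint ε x := by
  refine h.proj_toOmega_eq_iff.2 ⟨1, c, hc, ?_⟩
  have h1 := h.sect_tileCoord (ε := ε) (h.tiling.smul_mem_cone hc (h.sect_mem ε x.2))
  rw [h.tileCoord_smul _ hc.ne', h.tileCoord_sect _ x.2] at h1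
  simpa using h1

open Classical in
/-- The inverse map. -/
def ofVector (h : HexagonLift γ P Q) (u : {u : V3 // unfold u ∈ quadrant}) : h.Surface :=
  h.tilePoint (decide (0 ≤ mean u)) ⟨unfold u, u.2⟩

theorem ofVector_eq (h : HexagonLift γ P Q) {u : {u : V3 // unfold u ∈ quadrant}} {ε : Bool}
    (hu : sgn ε * |mean u| = mean u) : h.ofVector u = h.tilePoint ε ⟨unfold u, u.2⟩ := by
  rcases eq_or_ne (mean u) 0 with h0 | h0
  · exact h.tilePoint_eq_of_boundary (by rw [minc_unfold, h0, abs_zero]) _ _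
  · rw [ofVector]
    congr 1
    cases ε
    · simp only [sgn, Bool.false_eq_true, if_false, neg_mul, one_mul] at hu
      have := abs_pos.2 h0
      simp; linarith
    · simp only [sgn, if_true, one_mul] at hu
      have := abs_pos.2 h0
      simp; linarith

theorem continuous_ofVector (h : HexagonLift γ P Q) : Continuous h.ofVector := by
  have hc : ∀ ε, Continuous fun u : {u : V3 // unfold u ∈ quadrant} =>
      h.tilePoint ε ⟨unfold u, u.2⟩ := fun ε =>
    (h.continuous_tilePoint ε).comp
      ((continuous_unfold.comp continuous_subtype_val).subtype_mk fun u => u.2)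
  have h1 : ContinuousOn h.ofVector {u | 0 ≤ mean u} := (hc true).continuousOn.congr fun u hu =>
    h.ofVector_eq (by simp [sgn, abs_of_nonneg (show 0 ≤ mean u from hu)])
  have h2 : ContinuousOn h.ofVector {u | mean u ≤ 0} := (hc false).continuousOn.congr fun u hu =>
    h.ofVector_eq (by simp [sgn, abs_of_nonpos (show mean u ≤ 0 from hu)])
  have hm : Continuous fun u : {u : V3 // unfold u ∈ quadrant} => mean u :=
    continuous_mean.comp continuous_subtype_val
  have h3 := h1.union_of_isClosed h2 (isClosed_le continuous_const hm)
    (isClosed_le hm continuous_const)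
  rw [← continuousOn_univ]
  exact h3.mono fun u _ => le_total (0 : ℝ) (mean u)

theorem toSphere_ofVector (h : HexagonLift γ P Q) (u : {u : V3 // unfold u ∈ quadrant}) :
    h.toSphere (h.ofVector u) = dir u := by
  obtain ⟨ε, hε⟩ : ∃ ε, sgn ε * |mean u| = mean u := by
    rcases le_total 0 (mean u) with h0 | h0
    · exact ⟨true, by simp [sgn, abs_of_nonneg h0]⟩
    · exact ⟨false, by simp [sgn, abs_of_nonpos h0]⟩
  rw [h.ofVector_eq hε, toSphere_tilePoint, fold_unfold hε]

theorem ofVector_smul (h : HexagonLift γ P Q) {c : ℝ} (hc : 0 < c)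
    {u v : {u : V3 // unfold u ∈ quadrant}} (huv : (u : V3) = c • (v : V3)) :
    h.ofVector u = h.ofVector v := by
  have h1 : mean u = c * mean v := by rw [huv, mean_smul]
  obtain ⟨ε, hε⟩ : ∃ ε, sgn ε * |mean v| = mean v := by
    rcases le_total 0 (mean v) with h0 | h0
    · exact ⟨true, by simp [sgn, abs_of_nonneg h0]⟩
    · exact ⟨false, by simp [sgn, abs_of_nonpos h0]⟩
  have h2 : sgn ε * |mean u| = mean u := by
    rw [h1, abs_mul, abs_of_pos hc]
    linear_combination c * hε
  rw [h.ofVector_eq hε, h.ofVector_eq h2]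
  refine Eq.trans (congrArg (h.tilePoint ε) (Subtype.ext ?_)) (h.tilePoint_smul ε hc _)
  change unfold u = c • unfold v
  rw [huv, unfold_smul hc.le]

theorem unfold_fold_tile {ε : Bool} {x : V3} (hx : x ∈ quadrant) :
    unfold (fold (sgn ε) x) ∈ quadrant := by
  rwa [unfold_fold (abs_sgn ε) hx.1]

theorem ofVector_fold (h : HexagonLift γ P Q) (ε : Bool) (x : quadrant) :
    h.ofVector ⟨fold (sgn ε) x, unfold_fold_tile x.2⟩ = h.tilePoint ε x := by
  have hm : 0 ≤ minc (x : V3) := by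
    obtain ⟨i, hi⟩ := exists_minc_eq (x : V3)
    rw [← hi]; exact x.2.1 i
  rw [h.ofVector_eq (ε := ε) (by simp only [mean_fold, abs_mul, abs_sgn, one_mul, abs_of_nonneg hm])]
  congr 1
  exact Subtype.ext (unfold_fold (abs_sgn ε) x.2.1)

theorem toSphere_notMem (h : HexagonLift γ P Q) (z : h.Surface) :
    h.toSphere z ∉ Set.range endPoint := by
  obtain ⟨ε, x, rfl⟩ := h.exists_tilePoint_eq z
  rw [toSphere_tilePoint, dir_notMem_range_endPoint
    (fold_ne_zero (abs_sgn ε) x.2.1 (ne_zero_of_mem_quadrant x.2))]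
  exact unfold_fold_tile x.2

theorem unfold_mem_quadrant (s : {x : Sphere2 // x ∉ Set.range endPoint}) :
    unfold (s.1 : EuclideanSpace ℝ (Fin 3)).ofLp ∈ quadrant := by
  rw [← dir_notMem_range_endPoint (ofLp_ne_zero s.1), dir_ofLp]
  exact s.2

/-- The surface is homeomorphic to the sphere minus three points. -/
def homeo (h : HexagonLift γ P Q) : h.Surface ≃ₜ {x : Sphere2 // x ∉ Set.range endPoint} where
  toFun z := ⟨h.toSphere z, h.toSphere_notMem z⟩
  invFun s := h.ofVector ⟨(s.1 : EuclideanSpace ℝ (Fin 3)).ofLp, unfold_mem_quadrant s⟩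
  left_inv z := by
    obtain ⟨ε, x, rfl⟩ := h.exists_tilePoint_eq z
    have h0 := fold_ne_zero (abs_sgn ε) x.2.1 (ne_zero_of_mem_quadrant x.2)
    rw [← h.ofVector_fold ε x]
    -- The point of the sphere is the folded vector divided by its norm, and `ofVector` is
    -- insensitive to positive factors.
    refine h.ofVector_smul (inv_pos.2 (norm_toLp_pos h0)) ?_
    change ((h.toSphere _ : Sphere2) : EuclideanSpace ℝ (Fin 3)).ofLp = _
    rw [h.toSphere_ofVector, coe_dir h0]
    rfl
  right_inv s := Subtype.ext (by
    change h.toSphere (h.ofVector _) = _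
    rw [h.toSphere_ofVector, dir_ofLp])
  continuous_toFun := h.continuous_toSphere.subtype_mk _
  continuous_invFun := h.continuous_ofVector.comp (Continuous.subtype_mk
    ((PiLp.continuous_ofLp 2 _).comp (continuous_subtype_val.comp continuous_subtype_val)) _)

end HexagonLift

end

section

/-! ### Elementary components in punctured surfaces -/

/-- Stereographic projection from the antipode of `p`, translated so that `p` corresponds to `0`. -/
theorem exists_chart (p : Sphere2) : ∃ κ : ℂ → Sphere2, Topology.IsOpenEmbedding κ ∧ κ 0 = p := by
  have : Fact (Module.finrank ℝ (EuclideanSpace ℝ (Fin 3)) = 2 + 1) := ⟨by simp⟩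
  set e := stereographic' 2 (-p) with he
  have hp : p ∈ e.source := by
    rw [he, stereographic'_source]
    exact ne_neg_of_mem_unit_sphere ℝ p
  have h1 : Topology.IsOpenEmbedding e.symm := e.symm.isOpenEmbedding (by
    rw [OpenPartialHomeomorph.symm_source, he, stereographic'_target])
  let L := Complex.orthonormalBasisOneI.repr.toHomeomorph.trans (Homeomorph.addLeft (e p))
  refine ⟨e.symm ∘ L, h1.comp L.isOpenEmbedding, ?_⟩
  have : L 0 = e p := by
    change e p + Complex.orthonormalBasisOneI.repr 0 = e p
    rw [map_zero, add_zero]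
  rw [Function.comp_apply, this, e.left_inv hp]

theorem exists_punctured_chart {U : Set Sphere2} {p : Sphere2} (hU : insert p U ∈ 𝓝 p) :
    ∃ κ : ℂ → Sphere2, Topology.IsOpenEmbedding κ ∧ κ 0 = p ∧ ∀ z, ‖z‖ ≤ 1 → z ≠ 0 → κ z ∈ U := by
  obtain ⟨κ, hκ, h0⟩ := exists_chart p
  have h1 : κ ⁻¹' (insert p U) ∈ 𝓝 0 := hκ.continuous.continuousAt (by rwa [h0])
  obtain ⟨ρ, hρ, hball⟩ := Metric.nhds_basis_closedBall.mem_iff.1 h1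
  have hρ' : (ρ : ℂ) ≠ 0 := by exact_mod_cast hρ.ne'
  refine ⟨κ ∘ Homeomorph.mulLeft₀ (ρ : ℂ) hρ', hκ.comp (Homeomorph.isOpenEmbedding _),
    by simp [h0], fun z hz hz0 => ?_⟩
  have h2 : (ρ : ℂ) * z ∈ Metric.closedBall (0 : ℂ) ρ := by
    rw [mem_closedBall_zero_iff, norm_mul, Complex.norm_real, Real.norm_of_nonneg hρ.le]
    exact mul_le_of_le_one_right hρ.le hz
  rcases hball h2 with h3 | h3
  · rw [← h0] at h3
    exact absurd (hκ.injective h3) (mul_ne_zero hρ' hz0)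
  · exact h3

/-- The polar parametrisation of the punctured unit disc. -/
def polar (x : Circle × Set.Ici (0 : ℝ)) : ℂ := ((1 + x.2 : ℝ)⁻¹ : ℝ) * (x.1 : ℂ)

theorem one_add_pos (x : Set.Ici (0 : ℝ)) : 0 < 1 + (x : ℝ) := by
  have := x.2
  rw [Set.mem_Ici] at this
  linarith

theorem norm_polar (x : Circle × Set.Ici (0 : ℝ)) : ‖polar x‖ = (1 + x.2 : ℝ)⁻¹ := by
  rw [polar, norm_mul, Circle.norm_coe, mul_one, Complex.norm_real,
    Real.norm_of_nonneg (inv_nonneg.2 (one_add_pos x.2).le)]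

theorem polar_ne_zero (x : Circle × Set.Ici (0 : ℝ)) : polar x ≠ 0 := by
  rw [← norm_pos_iff, norm_polar]
  exact inv_pos.2 (one_add_pos x.2)

theorem norm_polar_le (x : Circle × Set.Ici (0 : ℝ)) : ‖polar x‖ ≤ 1 := by
  rw [norm_polar]
  have := x.2.2
  rw [Set.mem_Ici] at this
  exact inv_le_one_of_one_le₀ (by linarith)

theorem continuous_polar : Continuous polar := by
  unfold polar
  refine Continuous.mul ?_ (continuous_subtype_val.comp continuous_fst)
  refine Complex.continuous_ofReal.comp (Continuous.inv₀ (by fun_prop) ?_)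
  exact fun x => (one_add_pos x.2).ne'

/-- The polar coordinates. -/
def polarInv (w : {w : ℂ // w ≠ 0}) : Circle × Set.Ici (0 : ℝ) :=
  (⟨(w : ℂ) / ‖(w : ℂ)‖, by
    refine mem_sphere_zero_iff_norm.2 ?_
    rw [norm_div, Complex.norm_real, norm_norm,
      div_self (norm_ne_zero_iff.2 w.2)]⟩,
    ⟨max (‖(w : ℂ)‖⁻¹ - 1) 0, Set.mem_Ici.2 (le_max_right _ _)⟩)

theorem continuous_polarInv : Continuous polarInv := by
  unfold polarInv
  have h0 : ∀ w : {w : ℂ // w ≠ 0}, ‖(w : ℂ)‖ ≠ 0 := fun w => norm_ne_zero_iff.2 w.2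
  refine Continuous.prodMk (Continuous.subtype_mk ?_ _) (Continuous.subtype_mk ?_ _)
  · refine Continuous.div (by fun_prop) (by fun_prop) fun w => ?_
    exact_mod_cast h0 w
  · exact ((Continuous.inv₀ (by fun_prop) h0).sub continuous_const).max continuous_const

theorem polar_polarInv {w : {w : ℂ // w ≠ 0}} (hw : ‖(w : ℂ)‖ ≤ 1) : polar (polarInv w) = w := by
  have h0 : 0 < ‖(w : ℂ)‖ := norm_pos_iff.2 w.2
  have h1 : 1 ≤ ‖(w : ℂ)‖⁻¹ := (one_le_inv₀ h0).2 hw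
  have h2 : (1 + max (‖(w : ℂ)‖⁻¹ - 1) 0)⁻¹ = ‖(w : ℂ)‖ := by
    rw [max_eq_left (by linarith), add_sub_cancel, inv_inv]
  change (((1 + max (‖(w : ℂ)‖⁻¹ - 1) 0)⁻¹ : ℝ) : ℂ) * ((w : ℂ) / ‖(w : ℂ)‖) = w
  rw [h2, mul_div_cancel₀]
  exact_mod_cast h0.ne'

theorem polarInv_polar (x : Circle × Set.Ici (0 : ℝ)) :
    polarInv ⟨polar x, polar_ne_zero x⟩ = x := by
  refine Prod.ext (Subtype.ext ?_) (Subtype.ext ?_)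
  · change polar x / ‖polar x‖ = x.1
    rw [norm_polar, polar, mul_div_cancel_left₀]
    exact_mod_cast (inv_pos.2 (one_add_pos x.2)).ne'
  · change max (‖polar x‖⁻¹ - 1) 0 = x.2
    rw [norm_polar, inv_inv, add_sub_cancel_left]
    exact max_eq_left x.2.2

theorem isEmbedding_polar : Topology.IsEmbedding polar := by
  have h1 : Topology.IsEmbedding fun x => (⟨polar x, polar_ne_zero x⟩ : {w : ℂ // w ≠ 0}) :=
    Topology.IsEmbedding.of_leftInverse polarInv_polar continuous_polarInv
      (continuous_polar.subtype_mk _)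
  exact Topology.IsEmbedding.subtypeVal.comp h1

theorem exists_polar_eq {w : ℂ} (h0 : w ≠ 0) (h1 : ‖w‖ ≤ 1) : ∃ x, polar x = w :=
  ⟨_, polar_polarInv (w := ⟨w, h0⟩) h1⟩

section Puncture

variable {X : Type*} [TopologicalSpace X] {Φ : X → Sphere2} {p : Sphere2}

/-- A puncture of a surface is surrounded by an elementary loop. -/
theorem exists_elementaryComponent (hΦ : Topology.IsOpenEmbedding Φ) (hp : p ∉ Set.range Φ)
    (hp' : insert p (Set.range Φ) ∈ 𝓝 p) :
    ∃ (c : Circle → X) (C : Set X), IsElementaryComponent c C ∧ p ∈ closure (Φ '' C) := by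
  obtain ⟨κ, hκ, h0, hκU⟩ := exists_punctured_chart hp'
  choose g hg using fun x => hκU (polar x) (norm_polar_le x) (polar_ne_zero x)
  have hgc : Continuous g := by
    rw [hΦ.isInducing.continuous_iff]
    have : Φ ∘ g = fun x => κ (polar x) := funext hg
    rw [this]
    exact hκ.continuous.comp continuous_polar
  have hge : Topology.IsEmbedding g := by
    refine Topology.IsEmbedding.of_comp hgc hΦ.continuous ?_
    have : Φ ∘ g = κ ∘ polar := funext hg
    rw [this]
    exact hκ.isEmbedding.comp isEmbedding_polar
  have hmem : ∀ {x w}, κ w = Φ x → ‖w‖ ≤ 1 → ∃ y, g y = x ∧ polar y = w := fun {x w} hw h1 => by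
    have hw0 : w ≠ 0 := by
      rintro rfl
      exact hp ⟨x, by rw [← hw, h0]⟩
    obtain ⟨y, rfl⟩ := exists_polar_eq hw0 h1
    exact ⟨y, hΦ.injective (by rw [hg, hw]), rfl⟩
  refine ⟨fun z => g (z, ⟨0, Set.self_mem_Ici⟩), Set.range g,
    ⟨g, ⟨hge, ?_⟩, ?_, fun z => rfl, rfl⟩, ?_⟩
  -- The range is the trace on the surface of a compact disc of the sphere: the centre of the disc
  -- is the puncture, which is not in the image of `Φ`.
  · have h1 : Set.range g = Φ ⁻¹' (κ '' Metric.closedBall 0 1) := by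
      ext x
      constructor
      · rintro ⟨y, rfl⟩
        exact ⟨polar y, by simpa using norm_polar_le y, (hg y).symm⟩
      · rintro ⟨w, hw, hwx⟩
        obtain ⟨y, rfl, -⟩ := hmem hwx (by simpa using hw)
        exact ⟨y, rfl⟩
    rw [h1]
    exact (((isCompact_closedBall 0 1).image hκ.continuous).isClosed).preimage hΦ.continuous
  · have h1 : g '' {x | 0 < (x.2 : ℝ)} = Φ ⁻¹' (κ '' Metric.ball 0 1) := by
      ext x
      constructor
      · rintro ⟨y, hy, rfl⟩
        have hy : 0 < (y.2 : ℝ) := hy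
        refine ⟨polar y, ?_, (hg y).symm⟩
        rw [mem_ball_zero_iff, norm_polar]
        exact inv_lt_one_of_one_lt₀ (by linarith)
      · rintro ⟨w, hw, hwx⟩
        have hw : ‖w‖ < 1 := by simpa using hw
        obtain ⟨y, rfl, rfl⟩ := hmem hwx hw.le
        refine ⟨y, ?_, rfl⟩
        change 0 < (y.2 : ℝ)
        rw [norm_polar] at hw
        have := (inv_lt_one₀ (one_add_pos y.2)).1 hw
        linarith
    rw [h1]
    exact (hκ.isOpenMap _ Metric.isOpen_ball).preimage hΦ.continuous
  · rw [← h0, mem_closure_iff_nhds]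
    intro V hV
    have h1 : κ ⁻¹' V ∈ 𝓝 0 := hκ.continuous.continuousAt hV
    obtain ⟨ρ, hρ, hball⟩ := Metric.mem_nhds_iff.1 h1
    let y : Circle × Set.Ici (0 : ℝ) := (1, ⟨ρ⁻¹, (inv_pos.2 hρ).le⟩)
    refine ⟨Φ (g y), ?_, g y, ⟨y, rfl⟩, rfl⟩
    rw [hg]
    refine hball ?_
    rw [mem_ball_zero_iff, norm_polar]
    have : 0 < ρ⁻¹ := inv_pos.2 hρ
    exact inv_lt_of_inv_lt₀ hρ (by change ρ⁻¹ < 1 + ρ⁻¹; linarith)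

/-- The complex exponential maps a half-plane onto the punctured disc. -/
theorem isPreconnected_punctured_ball {ρ : ℝ} (hρ : 0 < ρ) :
    IsPreconnected (Metric.ball (0 : ℂ) ρ \ {0}) := by
  have h1 : Metric.ball (0 : ℂ) ρ \ {0} = Complex.exp '' {z | z.re < Real.log ρ} := by
    ext w
    constructor
    · rintro ⟨hw, hw0⟩
      have hw0 : w ≠ 0 := hw0
      refine ⟨Complex.log w, ?_, Complex.exp_log hw0⟩
      change (Complex.log w).re < _
      rw [Complex.log_re]
      exact Real.log_lt_log (norm_pos_iff.2 hw0) (by simpa using hw)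
    · rintro ⟨z, hz, rfl⟩
      refine ⟨?_, Complex.exp_ne_zero z⟩
      rw [mem_ball_zero_iff, Complex.norm_exp, ← Real.exp_log hρ]
      exact Real.exp_lt_exp.2 hz
  rw [h1]
  exact ((convex_halfSpace_re_lt _).isPreconnected).image _ Complex.continuous_exp.continuousOn

/-- An elementary component that accumulates at a puncture contains a neighbourhood of it. -/
theorem exists_nhds_subset_component (hΦ : Topology.IsOpenEmbedding Φ) (hp : p ∉ Set.range Φ)
    (hp' : insert p (Set.range Φ) ∈ 𝓝 p) {c : Circle → X} {C : Set X}
    (hC : IsElementaryComponent c C) (hpC : p ∈ closure (Φ '' C)) :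
    ∃ V ∈ 𝓝 p, ∀ x, Φ x ∈ V → x ∈ C := by
  obtain ⟨h, hh, ho, hc, rfl⟩ := hC
  obtain ⟨κ, hκ, h0, hκU⟩ := exists_punctured_chart hp'
  have hcc : Continuous c := by
    have : c = fun z => h (z, ⟨0, Set.self_mem_Ici⟩) := funext fun z => (hc z).symm
    rw [this]
    exact hh.continuous.comp (by fun_prop)
  have hK : IsClosed (Set.range (Φ ∘ c)) := (isCompact_range (hΦ.continuous.comp hcc)).isClosed
  have hpK : (Set.range (Φ ∘ c))ᶜ ∈ 𝓝 p := hK.isOpen_compl.mem_nhds (by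
    rintro ⟨z, hz⟩
    exact hp ⟨c z, hz⟩)
  rw [← h0] at hpK
  obtain ⟨ρ', hρ', hball⟩ := Metric.mem_nhds_iff.1 (hκ.continuous.continuousAt hpK)
  set ρ := min ρ' 1 with hρdef
  have hρ : 0 < ρ := lt_min hρ' one_pos
  have hV : κ '' Metric.ball 0 ρ ∈ 𝓝 p := by
    rw [← h0]
    exact (hκ.isOpenMap _ Metric.isOpen_ball).mem_nhds ⟨0, by simpa using hρ, rfl⟩
  refine ⟨_, hV, ?_⟩
  have hdisj : ∀ w ∈ Metric.ball (0 : ℂ) ρ, ∀ z, κ w ≠ Φ (c z) := fun w hw z hwz =>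
    hball (Metric.ball_subset_ball (min_le_left _ _) hw) ⟨z, hwz.symm⟩
  have hw0 : ∀ {x w}, κ w = Φ x → w ≠ 0 := fun {x w} hw => by
    rintro rfl
    exact hp ⟨x, by rw [← hw, h0]⟩
  -- The small punctured disc is connected and avoids the boundary loop, so it is covered by two
  -- disjoint open sets, the open part of the component and the complement of the component. It
  -- meets the first because the component accumulates at `p`.
  have hsub : κ '' (Metric.ball 0 ρ \ {0}) ⊆ Φ '' (h '' {x | 0 < (x.2 : ℝ)}) := by
    refine IsPreconnected.subset_left_of_subset_union (v := Φ '' (Set.range h)ᶜ)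
      (hΦ.isOpenMap _ ho) (hΦ.isOpenMap _ hh.isClosed_range.isOpen_compl) ?_ ?_ ?_
      ((isPreconnected_punctured_ball hρ).image _ hκ.continuous.continuousOn)
    · rw [Set.disjoint_image_iff hΦ.injective]
      exact Set.disjoint_compl_right_iff_subset.2 (Set.image_subset_range _ _)
    · rintro _ ⟨w, ⟨hw, hw0⟩, rfl⟩
      have hw1 : ‖w‖ < ρ := by simpa using hw
      obtain ⟨x, hx⟩ := hκU w (hw1.le.trans (min_le_right _ _)) hw0
      by_cases hxr : x ∈ Set.range h
      · left
        obtain ⟨⟨z, r⟩, rfl⟩ := hxr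
        refine ⟨_, ⟨(z, r), ?_, rfl⟩, hx⟩
        refine lt_of_le_of_ne (Set.mem_Ici.1 r.2) fun hr => ?_
        have hr : r = ⟨0, Set.self_mem_Ici⟩ := Subtype.ext hr.symm
        rw [hr, hc] at hx
        exact hdisj w hw z hx.symm
      · exact Or.inr ⟨x, hxr, hx⟩
    · obtain ⟨_, ⟨w, hw, rfl⟩, _, ⟨⟨z, r⟩, rfl⟩, hx⟩ := mem_closure_iff_nhds.1 hpC _ hV
      refine ⟨κ w, ⟨w, ⟨hw, hw0 hx.symm⟩, rfl⟩, _, ⟨(z, r), ?_, rfl⟩, hx⟩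
      refine lt_of_le_of_ne (Set.mem_Ici.1 r.2) fun hr => ?_
      have hr : r = ⟨0, Set.self_mem_Ici⟩ := Subtype.ext hr.symm
      rw [hr, hc] at hx
      exact hdisj w hw z hx.symm
  rintro x ⟨w, hw, hwx⟩
  obtain ⟨_, ⟨y, -, rfl⟩, hy⟩ := hsub ⟨w, ⟨hw, hw0 hwx⟩, rfl⟩
  rw [hwx] at hy
  rw [← hΦ.injective hy]
  exact ⟨y, rfl⟩

end Puncture

end

section

variable {γ : Fin 3 → SL3} {P Q : Fin 3 → V3}

namespace HexagonLift

/-! ### Small loops around the ends -/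

/-- The parametrisation of the triangles in the domain. -/
def tileLift (h : HexagonLift γ P Q) (ε : Bool) (x : quadrant) : h.Omega :=
  h.toOmega ⟨h.sect ε x, Set.mem_iUnion.2 ⟨_, h.sect_mem ε x.2⟩⟩

theorem proj_tileLift (h : HexagonLift γ P Q) (ε : Bool) (x : quadrant) :
    h.proj (h.tileLift ε x) = h.tilePoint ε x := rfl

theorem continuous_tileLift (h : HexagonLift γ P Q) (ε : Bool) : Continuous (h.tileLift ε) :=
  h.continuous_toOmega.comp (Continuous.subtype_mk (continuous_iff_continuousAt.2 fun x =>
    (h.continuousAt_sect ε x.2).comp continuous_subtype_val.continuousAt) _)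

theorem proj_smul (h : HexagonLift γ P Q) (g : holGroup γ) (x : h.Omega) :
    h.proj (g • x) = h.proj x := h.isQuotientCoveringMap.map_smul g

theorem tileLift_glue (h : HexagonLift γ P Q) {x : quadrant} {i : Fin 3} (hi : (x : V3) i = 0) :
    h.tileLift true x = glue γ i • h.tileLift false x := by
  obtain ⟨c, hc, hs⟩ := h.sect_true_eq x.2 hi
  refine Subtype.ext ?_
  change toP (h.sect true x) = (glue γ i : SL3) • toP (h.sect false x)
  rw [hs, toP_smul hc.ne', smul_toP]
  exact h.tiling.ne_zero_of_mem_dom (Set.mem_iUnion.2 ⟨_, h.sect_mem false x.2⟩)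

/-- A segment across the triangle, close to the vertex `i`. -/
def cut (i : Fin 3) (r t : ℝ) : V3 :=
  Pi.single i 1 + r • ((1 - t) • Pi.single (i + 1) 1 + t • Pi.single (i + 2) 1)

theorem cut_apply (i : Fin 3) (r t : ℝ) :
    cut i r t i = 1 ∧ cut i r t (i + 1) = r * (1 - t) ∧ cut i r t (i + 2) = r * t := by
  fin_cases i <;> simp [cut]

theorem cut_mem_quadrant (i : Fin 3) {r t : ℝ} (hr : 0 < r) (h0 : 0 ≤ t) (h1 : t ≤ 1) :
    cut i r t ∈ quadrant := by
  obtain ⟨e0, e1, e2⟩ := cut_apply i r t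
  have h3 : 0 ≤ r * (1 - t) := mul_nonneg hr.le (by linarith)
  have h4 : 0 ≤ r * t := mul_nonneg hr.le h0
  constructor
  · intro j
    rcases fin3_cases i j with rfl | rfl | rfl
    · rw [e0]; exact zero_le_one
    · rw [e1]; exact h3
    · rw [e2]; exact h4
  · intro j
    rcases fin3_cases i j with rfl | rfl | rfl
    · rw [e1, e2]; linarith
    · rw [fin3_add_one_add_one, fin3_add_one_add_two, e0, e2]; linarith
    · rw [fin3_add_two_add_one, fin3_add_two_add_two, e0, e1]; linarith

theorem continuous_cut (i : Fin 3) : Continuous fun x : ℝ × ℝ => cut i x.1 x.2 := by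
  unfold cut
  fun_prop

/-- The segments tend to the vertex. -/
theorem eventually_cut (i : Fin 3) {W : Set V3} (hW : W ∈ 𝓝 (Pi.single i 1)) :
    ∃ r : ℝ, 0 < r ∧ ∀ t, 0 ≤ t → t ≤ 1 → cut i r t ∈ W := by
  obtain ⟨O, hOW, hO, hiO⟩ := mem_nhds_iff.1 hW
  have h1 : ({0} : Set ℝ) ×ˢ Set.Icc (0 : ℝ) 1 ⊆ (fun x : ℝ × ℝ => cut i x.1 x.2) ⁻¹' O := by
    rintro ⟨r, t⟩ ⟨hr, -⟩
    have hr : r = 0 := hr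
    subst hr
    simpa [cut] using hiO
  -- Compactness of `[0, 1]` provides one `r` that works for all `t`.
  obtain ⟨u, v, hu, hv, hu0, hv1, huv⟩ := generalized_tube_lemma isCompact_singleton
    isCompact_Icc (hO.preimage (continuous_cut i)) h1
  obtain ⟨ρ, hρ, hball⟩ := Metric.isOpen_iff.1 hu 0 (hu0 rfl)
  refine ⟨ρ / 2, by positivity, fun t h0 h1 => hOW (huv (a := (ρ / 2, t)) ⟨hball ?_, hv1 ⟨h0, h1⟩⟩)⟩
  rw [mem_ball_zero_iff, Real.norm_of_nonneg (by positivity)]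
  linarith

theorem fold_single (ε : Bool) (i : Fin 3) : dir (fold (sgn ε) (Pi.single i 1)) = endPoint i := by
  rw [endPoint, fold_eq_of_minc_eq_zero (minc_single i)]

/-- There are loops with holonomy `(γ i)⁻¹` in every neighbourhood of the end `i`. -/
theorem exists_path_near_end (h : HexagonLift γ P Q) (i : Fin 3) {V : Set Sphere2}
    (hV : V ∈ 𝓝 (endPoint i)) : ∃ l : C(unitInterval, h.Omega),
      (∀ t, h.toSphere (h.proj (l t)) ∈ V) ∧ l 1 = (gen γ i)⁻¹ • l 0 := by
  have hW : ∀ ε, {x : V3 | dir (fold (sgn ε) x) ∈ V} ∈ 𝓝 (Pi.single i 1 : V3) := fun ε => by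
    have h0 := fold_ne_zero (abs_sgn ε) (single_nonneg i) (single_ne_zero i)
    refine (ContinuousAt.comp (g := dir) (continuousAt_dir h0)
      (continuous_fold (sgn ε)).continuousAt) ?_
    rw [Function.comp_apply, fold_single]
    exact hV
  obtain ⟨r, hr, hcut⟩ := eventually_cut i (Filter.inter_mem (hW true) (hW false))
  let x : unitInterval → quadrant := fun t => ⟨cut i r t, cut_mem_quadrant i hr t.2.1 t.2.2⟩
  have hx : Continuous x := Continuous.subtype_mk
    ((continuous_cut i).comp (continuous_const.prodMk continuous_subtype_val)) _
  have hxV : ∀ ε t, h.toSphere (h.tilePoint ε (x t)) ∈ V := fun ε t => by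
    rw [toSphere_tilePoint]
    cases ε
    · exact (hcut t t.2.1 t.2.2).2
    · exact (hcut t t.2.1 t.2.2).1
  have hx0 : (x 0 : V3) (i + 2) = 0 := by
    change cut i r ((0 : unitInterval) : ℝ) (i + 2) = 0
    rw [(cut_apply i r _).2.2]; simp
  have hx1 : (x 1 : V3) (i + 1) = 0 := by
    change cut i r ((1 : unitInterval) : ℝ) (i + 1) = 0
    rw [(cut_apply i r _).2.1]; simp
  have := h.isQuotientCoveringMap.toContinuousConstSMul
  -- The loop crosses `T₀` near the vertex, from the side `i + 2` to the side `i + 1`, and then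
  -- crosses the adjacent translate of `T 0` along the same segment reversed. Its endpoints differ
  -- by the product computed in `glue_mul_inv`.
  let p₁ : Path (h.tileLift true (x 0)) (h.tileLift true (x 1)) :=
    { toFun := fun t => h.tileLift true (x t)
      continuous_toFun := (h.continuous_tileLift true).comp hx
      source' := rfl
      target' := rfl }
  let p₂ : Path (h.tileLift true (x 1)) (glue γ (i + 1) • h.tileLift false (x 0)) :=
    { toFun := fun t => glue γ (i + 1) • h.tileLift false (x (unitInterval.symm t))
      continuous_toFun :=
        (continuous_const_smul (glue γ (i + 1))).comp
          ((h.continuous_tileLift false).comp (hx.comp unitInterval.continuous_symm))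
      source' := by rw [unitInterval.symm_zero, ← h.tileLift_glue hx1]
      target' := by rw [unitInterval.symm_one] }
  have hp₁ : ∀ t, p₁ t = h.tileLift true (x t) := fun _ => rfl
  have hp₂ : ∀ t, p₂ t = glue γ (i + 1) • h.tileLift false (x (unitInterval.symm t)) := fun _ => rfl
  refine ⟨(p₁.trans p₂).toContinuousMap, fun t => ?_, ?_⟩
  · have ht : (p₁.trans p₂) t ∈ Set.range p₁ ∪ Set.range p₂ := by
      rw [← Path.trans_range]; exact ⟨t, rfl⟩
    change h.toSphere (h.proj ((p₁.trans p₂) t)) ∈ V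
    rcases ht with ⟨s, hs⟩ | ⟨s, hs⟩
    · rw [← hs, hp₁, proj_tileLift]
      exact hxV true s
    · rw [← hs, hp₂, proj_smul, proj_tileLift]
      exact hxV false _
  · change (p₁.trans p₂) 1 = _ • (p₁.trans p₂) 0
    rw [Path.target, Path.source, h.tileLift_glue hx0, ← h.glue_mul_inv i, smul_smul,
      inv_mul_cancel_right]

/-! ### The pair of pants -/

theorem isOpenEmbedding_toSphere (h : HexagonLift γ P Q) :
    Topology.IsOpenEmbedding h.toSphere := by
  have ho : IsOpen {x : Sphere2 | x ∉ Set.range endPoint} :=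
    (Set.finite_range endPoint).isClosed.isOpen_compl
  exact ho.isOpenEmbedding_subtypeVal.comp h.homeo.isOpenEmbedding

theorem range_toSphere (h : HexagonLift γ P Q) : Set.range h.toSphere = (Set.range endPoint)ᶜ := by
  ext s
  constructor
  · rintro ⟨z, rfl⟩
    exact h.toSphere_notMem z
  · intro hs
    exact ⟨h.homeo.symm ⟨s, hs⟩, congrArg Subtype.val (h.homeo.apply_symm_apply ⟨s, hs⟩)⟩

theorem insert_endPoint_mem_nhds (h : HexagonLift γ P Q) (i : Fin 3) :
    insert (endPoint i) (Set.range h.toSphere) ∈ 𝓝 (endPoint i) := by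
  have hf : (endPoint '' {i}ᶜ).Finite := Set.toFinite _
  refine Filter.mem_of_superset (hf.isClosed.isOpen_compl.mem_nhds ?_) fun s hs => ?_
  · rintro ⟨j, hj, hji⟩
    exact hj (endPoint_injective hji)
  · rw [h.range_toSphere]
    by_cases hsi : s ∈ Set.range endPoint
    · obtain ⟨j, rfl⟩ := hsi
      by_cases hj : j = i
      · exact Or.inl (by rw [hj])
      · exact absurd ⟨j, hj, rfl⟩ hs
    · exact Or.inr hsi

theorem endPoint_notMem_range (h : HexagonLift γ P Q) (i : Fin 3) :
    endPoint i ∉ Set.range h.toSphere := by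
  rw [h.range_toSphere]
  exact fun hn => hn ⟨i, rfl⟩

/-- The holonomy of the elementary loops that go around the end `i`. -/
theorem holonomy_of_isElementaryComponent (h : HexagonLift γ P Q) {i : Fin 3}
    {c : Circle → h.Surface} {C : Set h.Surface} (hC : IsElementaryComponent c C)
    (hi : endPoint i ∈ closure (h.toSphere '' C)) :
    (∃ g, IsHolonomy (holGroup γ) h.Omega c g) ∧
      ∀ g, IsHolonomy (holGroup γ) h.Omega c g → IsConj g (γ i) ∨ IsConj g (γ i)⁻¹ := by
  have hq := h.isQuotientCoveringMap
  obtain ⟨V, hV, hVC⟩ := exists_nhds_subset_component h.isOpenEmbedding_toSphere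
    (h.endPoint_notMem_range i) (h.insert_endPoint_mem_nhds i) hC hi
  obtain ⟨l, hl, hl1⟩ := h.exists_path_near_end i hV
  obtain ⟨f, hf, -, hfc, rfl⟩ := hC
  obtain ⟨H, g₀, hH, hHf, hg₀⟩ := exists_cylinder_lift hq hf.continuous
  have hH0 : ∀ t : ℝ, Quotient.mk (orbitSetoid (holGroup γ) h.Omega) (H (t, 0)) =
      c (Circle.exp (2 * Real.pi * t)) := fun t => by
    rw [hHf, ← hfc]
    simp [cylinderMap]
  refine ⟨⟨g₀, g₀.2, ⟨fun t => H (t, 0), by fun_prop⟩, fun t => hH0 t, ?_⟩, ?_⟩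
  · have h1 := hg₀ 1 0 0
    simp only [Int.cast_one, zpow_one, zero_add] at h1
    exact (congrArg Subtype.val h1).symm
  · rintro g ⟨hg, k, hk, hgk⟩
    obtain ⟨w, hw⟩ := exists_eq_conj hq hH hHf hg₀ (l := k) (k := ⟨g, hg⟩)
      (fun t => by rw [hk, hfc]) (Subtype.ext hgk.symm)
    -- The small loop around the end stays in the component, so `(γ i)⁻¹` is conjugate to a power of
    -- the holonomy `g₀`. By `zpow_eq_gen` the exponent is `1` or `-1`.
    obtain ⟨u, n, hu⟩ := exists_eq_conj_zpow hq hf.isEmbedding hH hHf hg₀ (p := l)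
      (fun t => hVC _ (hl t)) hl1
    have hu' : gen γ i = u * g₀ ^ (-n) * u⁻¹ := by
      rw [← inv_inv (gen γ i), hu]; group
    have hgw : IsConj g₀ (⟨g, hg⟩ : holGroup γ) := isConj_iff.2 ⟨w, hw.symm⟩
    have key : ∀ k : holGroup γ, IsConj g₀ k → IsConj g (k : SL3) := fun k hk =>
      (holGroup γ).subtype.map_isConj (hgw.symm.trans hk)
    rcases h.zpow_eq_gen hu' with hn | hn
    · left
      refine key (gen γ i) (isConj_iff.2 ⟨u, ?_⟩)
      rw [hu', hn, zpow_one]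
    · right
      refine key (gen γ i)⁻¹ (isConj_iff.2 ⟨u, ?_⟩)
      rw [hu', hn]; group

theorem isProperlyConvexPants (h : HexagonLift γ P Q) {δ : Fin 3 → SL3}
    (hδ : ∀ i, IsConj (γ i) (δ i)) : IsProperlyConvexPants (holGroup γ) h.Omega δ := by
  refine ⟨h.isProperlyConvexSurface, endPoint, h.homeo, endPoint_injective, fun i => ⟨?_, ?_⟩⟩
  · exact exists_elementaryComponent h.isOpenEmbedding_toSphere (h.endPoint_notMem_range i)
      (h.insert_endPoint_mem_nhds i)
  · intro c C hC hi
    obtain ⟨h1, h2⟩ := h.holonomy_of_isElementaryComponent hC hi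
    refine ⟨h1, fun g hg => (h2 g hg).imp (fun h3 => h3.trans (hδ i)) fun h3 => h3.trans ?_⟩
    obtain ⟨u, hu⟩ := isConj_iff.1 (hδ i)
    exact isConj_iff.2 ⟨u, by rw [← hu]; group⟩

end HexagonLift

end

end ConvexPants

end

theorem mainTheorem7 (δ : Fin 3 → ConvexPants.SL3)
    (hδ : ∀ i, ConvexPants.IsHyperbolic (δ i) ∨ ConvexPants.IsQuasiHyperbolic (δ i) ∨
      ConvexPants.IsParabolic (δ i))
    (T₀ : Set ConvexPants.P2) (T : Fin 3 → Set ConvexPants.P2) (γ : Fin 3 → ConvexPants.SL3)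
    (hQ : ConvexPants.IsQPoint δ T₀ T γ) :
    IsOpen (ConvexPants.tiledSet T₀ T γ) ∧
    ConvexPants.IsProperlyConvex (ConvexPants.tiledSet T₀ T γ) ∧
    Nonempty (ConvexPants.holGroup γ ≃* FreeGroup (Fin 2)) ∧
    ConvexPants.IsProperlyConvexPants (ConvexPants.holGroup γ)
      (ConvexPants.tiledSet T₀ T γ) δ := by
  obtain ⟨p, q, hG⟩ := hQ
  obtain ⟨P, Q, h, hT₀, hT⟩ := ConvexPants.exists_hexagonLift hδ hG
  have hΩ : ConvexPants.tiledSet T₀ T γ = h.Omega := h.tiledSet_eq hT₀ hT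
  rw [hΩ]
  exact ⟨h.isOpen_Omega, h.isProperlyConvex_Omega, ⟨h.freeEquiv.symm⟩,
    h.isProperlyConvexPants hG.conj⟩
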